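/- **Theorem (Sharpness).** Let $d\ge 1$ be an integer, let $M\ge 1$ be real, and let $b>0$ be such that $b^{-1}$ is an integer exceeding $2dM$. Let $Y=\{Y_z\}_{z\in\mathbb Z^d}$ be an iid family of random elements of a measurable space $S$. For $x\in b\mathbb Z^d$ let $\mathcal U_x=\mathcal U_x(Y)\in[0,\infty)$ be a random variable and $\mathcal Q_x=\mathcal Q_x(\cdot\,;Y)$ a random probability measure on the cube $Mx+[0,Mb]^d$, both measurable functions of $Y$, and put $\mathcal E_x=\mathcal U_x\mathcal Q_x$. Assume translation covariance: for all $x\in b\mathbb Z^d$, $z_0\in\mathbb Z^d$, $\mathcal U_{x+z_0}(Y)=\mathcal U_x(\{Y_{z+z_0}\}_{z})$, and $\mathcal Q_{x+z_0}(\cdot\,;Y)$ is the translate by $Mz_0$ of $\mathcal Q_x(\cdot\,;\{Y_{z+z_0}\}_z)$. For $z\in\mathbb Z^d$ let $I_b(z)=b\mathbb Z^d\cap(z+[0,1)^d)$, $I_b^+(z)=b\mathbb Z^d\cap(z+[-1,2)^d)$, $I_b^{++}(z)=b\mathbb Z^d\cap(z+[-2,3)^d)$. Assume: 1. (*1-dependence*)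 for $z\in\mathbb Z^d$ and $x\in I_b(z)$, $\mathcal E_x(Y)=\mathcal E_x(Y')$ whenever $Y_w=Y'_w$ for all $w\in z+\{-1,0,1\}^d$; 2. (*uniformly bounded local intensity*) there is $\rho>0$ such that almost surely $\mathcal U_x\le\rho$ for all $x\in b\mathbb Z^d$; 3. (*coverage*) $\mathbb P(\mathcal U_x>0\text{ for some }x\in I_b(0))>q_0(d)$, where $q_0(d)$ is the infimum of all $q\in[0,1]$ such that every 6-dependent (not necessarily stationary) nearest-neighbour site percolation model on $\mathbb Z^d$ in which each site is open with probability at least $q$ has almost surely an infinite open cluster; here 6-dependence means that the restrictions to any two sets of sites at $\ell^\infty$-distance larger than $6$ are independent; 4. (*essential connectedness*) there is $\eta>0$ such that almost surely, for all $z\in\mathbb Z^d$ and all $x,x'\in I_b^+(z)$ with $\mathcal U_x,\mathcal U_{x'}>0$, there is a finite sequence $x=x_0,x_1,\dots,x_m=x'$ in which consecutive sites are at $\ell^\infty$-distance $b$ and each intermediate site $x_i$, $0<i<m$, lies in $I_b^{++}(z)$ and satisfies $\mathcal U_{x_i}\ge\eta$. For $\lambda>0$ let $X^{\mathsf s}$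 be the Cox point process on $\mathbb R^d$ with random intensity measure $\lambda\sum_{x\in b\mathbb Z^d}\mathcal E_x$, constructed as follows. Fix a bimeasurable bijection $\Gamma:[0,Mb]^d\to[0,1]$, let $\Phi_x^{-1}(\cdot\,;Y)$ be the inverse distribution function of the push-forward under $\Gamma$ of $\mathcal Q_x$ translated by $-Mx$, let $V_x=\{(V_{x,i},U_{x,i})\}_{i\ge1}$, $x\in b\mathbb Z^d$, be iid homogeneous Poisson point processes on $[0,1]\times[0,\infty)$ with intensity $\lambda$, independent of $Y$, and let $$X^{\mathsf s}=\bigcup_{x\in b\mathbb Z^d}\big\{Mx+\Gamma^{-1}(\Phi_x^{-1}(V_{x,i};Y)) : U_{x,i}\le\mathcal U_x(Y)\big\}.$$ Write $\mathbb P_\lambda$ for the resulting probability, and for $A,B\subset\mathbb R^d$ write $A\leftrightsquigarrow B$ if there is a path between $A$ and $B$ in the union of the open Euclidean balls of radius $1/2$ centred at the points of $X^{\mathsf s}$. Let $\Lambda_r=[-r,r]^d$, $\partial\Lambda_n=\Lambda_{n-M}\setminus\Lambda_{n-2M}$ for $n\in\mathbb N$, $$\theta(\lambda)=\lim_{n\to\infty}\mathbb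 P_\lambda(\Lambda_{3M}\leftrightsquigarrow\partial\Lambda_n),\qquad \lambda_c=\inf\{\lambda>0:\theta(\lambda)>0\}.$$ Then (i) $\limsup_{n\to\infty} n^{-1}\log\mathbb P_\lambda(\Lambda_{3M}\leftrightsquigarrow\partial\Lambda_n)<0$ for every $0<\lambda<\lambda_c$ (with $\log 0=-\infty$), and (ii) $\liminf_{\lambda\downarrow\lambda_c}\theta(\lambda)/(\lambda-\lambda_c)\in(0,\infty]$. -/

import Mathlib

open MeasureTheory ProbabilityTheory Filter Topology Set
open scoped NNReal ENNReal

noncomputable section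

namespace CoxPercolation

/-! ### Site percolation on the integer lattice and the threshold `q₀(d)` -/

/-- The lattice `ℤ^d`. -/
abbrev Lattice (d : ℕ) : Type := Fin d → ℤ

/-- Nearest neighbours in `ℤ^d`. -/
def NearestNeighbours {d : ℕ} (z w : Lattice d) : Prop := ∑ i, |z i - w i| = 1

/-- The open cluster of `z` in the site configuration `ω` (`ω z = true` means that `z` is open);
it is `{z}` if `z` is closed. -/
def openCluster {d : ℕ} (ω : Lattice d → Bool) (z : Lattice d) : Set (Lattice d) :=
  {w | Relation.ReflTransGen
    (fun a c => NearestNeighbours a c ∧ ω a = true ∧ ω c = true) z w}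

/-- A site percolation model is `k`-dependent if its restrictions to two sets of sites at
`ℓ^∞`-distance larger than `k` are independent. -/
def IsKDependent {d : ℕ} (k : ℤ) (μ : Measure (Lattice d → Bool)) : Prop :=
  ∀ A B : Set (Lattice d), (∀ a ∈ A, ∀ c ∈ B, ∃ i, k < |a i - c i|) →
    IndepFun (fun ω : Lattice d → Bool => fun a : A => ω a)
      (fun ω : Lattice d → Bool => fun c : B => ω c) μ

/-- The site percolation model almost surely has an infinite open cluster. -/
def Percolates {d : ℕ} (μ : Measure (Lattice d → Bool)) : Prop :=
  ∀ᵐ ω ∂μ, ∃ z, (openCluster ω z).Infinite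

/-- The least `q₀(d) ∈ [0, 1]` above which marginal probabilities force every 6-dependent site
percolation model on `ℤ^d` to percolate. -/
def percolationThreshold (d : ℕ) : ℝ :=
  sInf {q | q ∈ Icc (0 : ℝ) 1 ∧ ∀ μ : Measure (Lattice d → Bool), IsProbabilityMeasure μ →
    IsKDependent 6 μ → (∀ z, q ≤ μ.real {ω | ω z = true}) → Percolates μ}

/-! ### Homogeneous Poisson point processes on `[0,1] × [0,∞)` -/

/-- Sample space of a Poisson process on `[0,1] × [0,∞)`: for every strip `[0,1] × [j, j+1]` a
number of points, and a sequence of potential positions relative to the corner `(0, j)`. -/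
abbrev PoissonSample : Type := ℕ → ℕ × (ℕ → unitInterval × unitInterval)

/-- Law on `PoissonSample`: the strips are independent, the number of points in each is
Poisson with mean `lam` (the strip has area one), and positions are iid uniform and independent of
the numbers. Under this law `poissonPoints` is a homogeneous Poisson point process of intensity
`lam`. -/
def poissonLaw (lam : ℝ≥0) : Measure PoissonSample :=
  Measure.infinitePi fun _ : ℕ =>
    (poissonMeasure lam).prod
      (Measure.infinitePi fun _ : ℕ => (volume : Measure (unitInterval × unitInterval)))

instance (lam : ℝ≥0) : IsProbabilityMeasure (poissonLaw lam) := by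
  unfold poissonLaw; infer_instance

/-- The points `(V_i, U_i) ∈ [0,1] × [0,∞)` of the Poisson process. -/
def poissonPoints (s : PoissonSample) : Set (unitInterval × ℝ) :=
  {p | ∃ j i : ℕ, i < (s j).1 ∧ p = (((s j).2 i).1, (j : ℝ) + (((s j).2 i).2 : ℝ))}

/-! ### Environments that are factors of iid -/

/-- The cube `[0, s]^d`. -/
def cube (d : ℕ) (s : ℝ) : Set (EuclideanSpace ℝ (Fin d)) := {p | ∀ i, p i ∈ Icc 0 s}

/-- The data of an environment of class `𝔉` built from `Y ∈ S^{ℤ^d}`. The fine scale is `b = 1/N`,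
and the site `x = b k` of `b ℤ^d` is represented by `k ∈ ℤ^d`; hence `x + z` is represented by
`k + N z` for `z ∈ ℤ^d`. `Q k Y` is the law of the position relative to the corner `M x`, i.e. the
random probability measure `𝓠_x` on `M x + [0, M b]^d` is the translate of `Q k Y` by `M x`. -/
structure FactorEnvironment (d : ℕ) (S : Type*) [MeasurableSpace S] where
  M : ℝ
  one_le_M : 1 ≤ M
  N : ℕ
  two_d_M_lt_N : 2 * d * M < N
  U : Lattice d → (Lattice d → S) → ℝ≥0
  measurable_U : ∀ k, Measurable (U k)
  Q : Lattice d → Kernel (Lattice d → S) (cube d (M / N))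
  isMarkovKernel_Q : ∀ k, IsMarkovKernel (Q k)
  U_covariant : ∀ (k z : Lattice d) (Y : Lattice d → S),
    U (k + (N : ℤ) • z) Y = U k (fun w => Y (w + z))
  Q_covariant : ∀ (k z : Lattice d) (Y : Lattice d → S),
    Q (k + (N : ℤ) • z) Y = Q k (fun w => Y (w + z))

/-- The law of the iid family `Y`. -/
def iidLaw (d : ℕ) {S : Type*} [MeasurableSpace S] (ν : Measure S) [IsProbabilityMeasure ν] :
    Measure (Lattice d → S) :=
  Measure.infinitePi fun _ => ν

instance (d : ℕ) {S : Type*} [MeasurableSpace S] (ν : Measure S) [IsProbabilityMeasure ν] :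
    IsProbabilityMeasure (iidLaw d ν) := by
  unfold iidLaw; infer_instance

namespace FactorEnvironment

variable {d : ℕ} {S : Type*} [MeasurableSpace S] (E : FactorEnvironment d S)

/-- The corner `M x = M b k` of the cube `Q(x; b, M)`, where `x = b k`. -/
def corner (k : Lattice d) : EuclideanSpace ℝ (Fin d) :=
  WithLp.toLp 2 fun i => E.M / E.N * (k i : ℝ)

/-- The local environment `𝓔_x = 𝓤_x 𝓠_x`, a measure on `ℝ^d`. -/
def localEnv (k : Lattice d) (Y : Lattice d → S) : Measure (EuclideanSpace ℝ (Fin d)) :=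
  (E.U k Y : ℝ≥0∞) • (E.Q k Y).map
    (fun p : cube d (E.M / E.N) => E.corner k + (p : EuclideanSpace ℝ (Fin d)))

/-- `b ℤ^d ∩ (z + [l, r)^d)` for integers `l`, `r`. -/
def block (z : Lattice d) (l r : ℤ) : Set (Lattice d) :=
  {k | ∀ i, (E.N : ℤ) * (z i + l) ≤ k i ∧ k i < (E.N : ℤ) * (z i + r)}

/-- 1-dependence. -/
def OneDependent : Prop :=
  ∀ z, ∀ k ∈ E.block z 0 1, ∀ Y Y' : Lattice d → S,
    (∀ w, (∀ i, |w i - z i| ≤ 1) → Y w = Y' w) → E.localEnv k Y = E.localEnv k Y'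

variable (ν : Measure S) [IsProbabilityMeasure ν]

/-- Uniformly bounded local intensity. -/
def BoundedIntensity : Prop :=
  ∃ ρ : ℝ≥0, 0 < ρ ∧ ∀ᵐ Y ∂(iidLaw d ν), ∀ k, E.U k Y ≤ ρ

/-- Coverage: the origin of `ℤ^d` is non-empty with probability larger than `q₀(d)`. -/
def Coverage : Prop :=
  percolationThreshold d < (iidLaw d ν).real {Y | ∃ k ∈ E.block 0 0 1, 0 < E.U k Y}

/-- The sites `b k` and `b k'` are at `ℓ^∞`-distance exactly `b`. -/
def Adjacent (k k' : Lattice d) : Prop := k ≠ k' ∧ ∀ i, |k i - k' i| ≤ 1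

/-- `k` and `k'` are connected by a chain of adjacent `η`-supported sites in
`b ℤ^d ∩ (z + [-2, 3)^d)`. The endpoints `k` and `k'` themselves need not be `η`-supported. -/
def SupportedChain (η : ℝ≥0) (Y : Lattice d → S) (z k k' : Lattice d) : Prop :=
  ∃ (m : ℕ) (c : ℕ → Lattice d), c 0 = k ∧ c m = k' ∧
    (∀ i < m, Adjacent (c i) (c (i + 1))) ∧
    ∀ i, 0 < i → i < m → c i ∈ E.block z (-2) 3 ∧ η ≤ E.U (c i) Y

/-- Essential connectedness. -/
def EssentiallyConnected : Prop :=
  ∃ η : ℝ≥0, 0 < η ∧ ∀ᵐ Y ∂(iidLaw d ν), ∀ z,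
    ∀ k ∈ E.block z (-1) 2, ∀ k' ∈ E.block z (-1) 2,
      0 < E.U k Y → 0 < E.U k' Y → E.SupportedChain η Y z k k'

/-! ### The Cox process and Cox percolation -/

variable (Γ : cube d (E.M / E.N) ≃ᵐ unitInterval)

/-- The inverse distribution function `Φ_x⁻¹(v; Y)` of the push-forward `Γ_* 𝓠_x`. -/
def quantile (k : Lattice d) (Y : Lattice d → S) (v : unitInterval) : unitInterval :=
  sInf {t | (v : ℝ) ≤ ((E.Q k Y).map Γ).real (Iic t)}

/-- The Cox process `X^s = ⋃_x Ψ_x(V_x; Y)` as a function of `Y` and `V`. -/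
def coxPoints (ω : (Lattice d → S) × (Lattice d → PoissonSample)) :
    Set (EuclideanSpace ℝ (Fin d)) :=
  {q | ∃ k, ∃ p ∈ poissonPoints (ω.2 k), p.2 ≤ (E.U k ω.1 : ℝ) ∧
    q = E.corner k + (Γ.symm (E.quantile Γ k ω.1 p.1) : EuclideanSpace ℝ (Fin d))}

end FactorEnvironment

/-- `Y` is iid with marginal law `ν`, the `V_x` are iid Poisson processes of intensity `lam`, and
`Y` and `V` are independent. -/
def jointLaw (d : ℕ) {S : Type*} [MeasurableSpace S] (ν : Measure S) [IsProbabilityMeasure ν]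
    (lam : ℝ) : Measure ((Lattice d → S) × (Lattice d → PoissonSample)) :=
  (iidLaw d ν).prod (Measure.infinitePi fun _ => poissonLaw lam.toNNReal)

instance (d : ℕ) {S : Type*} [MeasurableSpace S] (ν : Measure S) [IsProbabilityMeasure ν]
    (lam : ℝ) : IsProbabilityMeasure (jointLaw d ν lam) := by
  unfold jointLaw; infer_instance

/-- The union of the Euclidean balls of radius `1/2` around the points of `X`. The balls are open,
so that two of them intersect if and only if their centres are at distance less than `1`. -/
def occupied {d : ℕ} (X : Set (EuclideanSpace ℝ (Fin d))) : Set (EuclideanSpace ℝ (Fin d)) :=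
  ⋃ x ∈ X, Metric.ball x (1 / 2)

/-- There is a path between `A` and `B` in the union of balls. -/
def Connected {d : ℕ} (X A B : Set (EuclideanSpace ℝ (Fin d))) : Prop :=
  ∃ a ∈ A, ∃ c ∈ B, JoinedIn (occupied X) a c

/-- `Λ_r = [-r, r]^d`. -/
def box (d : ℕ) (r : ℝ) : Set (EuclideanSpace ℝ (Fin d)) := {p | ∀ i, |p i| ≤ r}

namespace FactorEnvironment

variable {d : ℕ} {S : Type*} [MeasurableSpace S] (E : FactorEnvironment d S)

/-- `∂Λ_r = Λ_{r - M} \ Λ_{r - 2M}`. -/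
def shell (r : ℝ) : Set (EuclideanSpace ℝ (Fin d)) := box d (r - E.M) \ box d (r - 2 * E.M)

variable (ν : Measure S) [IsProbabilityMeasure ν] (Γ : cube d (E.M / E.N) ≃ᵐ unitInterval)

/-- The probability that `Λ_{3M}` and `∂Λ_n` are connected. -/
def connProb (lam : ℝ) (n : ℕ) : ℝ≥0∞ :=
  jointLaw d ν lam {ω | Connected (E.coxPoints Γ ω) (box d (3 * E.M)) (E.shell n)}

/-- The percolation probability `θ(λ)`. The limit exists, see `tendsto_theta`. -/
def theta (lam : ℝ) : ℝ := limUnder atTop fun n : ℕ => (E.connProb ν Γ lam n).toReal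

/-- The critical intensity `λ_c`. -/
def criticalIntensity : ℝ := sInf {lam | 0 < lam ∧ 0 < E.theta ν Γ lam}

theorem connected_shell_of_le (X : Set (EuclideanSpace ℝ (Fin d))) {r s : ℝ} (hr : 5 * E.M ≤ r)
    (hrs : r ≤ s) (h : Connected X (box d (3 * E.M)) (E.shell s)) :
    Connected X (box d (3 * E.M)) (E.shell r) := by
  have hM := E.one_le_M
  have mem : ∀ (p : EuclideanSpace ℝ (Fin d)) (t : ℝ), 0 ≤ t →
      (p ∈ box d t ↔ ‖(WithLp.ofLp p : Fin d → ℝ)‖ ≤ t) := fun p t ht => by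
    rw [pi_norm_le_iff_of_nonneg ht]; rfl
  obtain ⟨a, ha, c, hc, γ, hγ⟩ := h
  let g : unitInterval → ℝ := fun t => ‖(WithLp.ofLp (γ t) : Fin d → ℝ)‖
  have hg : Continuous g := by fun_prop
  have h0 : g 0 ≤ 3 * E.M := by
    have := (mem a _ (by linarith)).1 ha
    simpa [g] using this
  have h1 : s - 2 * E.M < g 1 := by
    have := (not_congr (mem c (s - 2 * E.M) (by linarith))).1 hc.2
    simpa [g] using this
  have key : ∃ t, r - 2 * E.M < g t ∧ g t ≤ r - E.M := by
    by_cases h2 : g 1 ≤ r - E.M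
    · exact ⟨1, by linarith, h2⟩
    · obtain ⟨t, ht⟩ := mem_range_of_exists_le_of_exists_ge hg
        ⟨0, show g 0 ≤ r - E.M by linarith⟩ ⟨1, by linarith⟩
      exact ⟨t, by linarith, by linarith⟩
  obtain ⟨t, ht1, ht2⟩ := key
  refine ⟨a, ha, γ t, ⟨(mem _ _ (by linarith)).2 ht2, fun hh => ?_⟩, ?_⟩
  · have := (mem _ _ (by linarith)).1 hh
    exact absurd this (not_le.2 ht1)
  · refine ⟨(γ.truncateOfLE t.2.1).cast (by simp) (by simp), fun u => ?_⟩
    have : (γ.truncateOfLE t.2.1) u ∈ range γ := γ.truncate_range (mem_range_self _)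
    obtain ⟨v, hv⟩ := this
    rw [Path.cast_coe, ← hv]
    exact hγ v

theorem tendsto_theta (lam : ℝ) :
    Tendsto (fun n : ℕ => (E.connProb ν Γ lam n).toReal) atTop (𝓝 (E.theta ν Γ lam)) := by
  obtain ⟨m, hm⟩ := exists_nat_ge (5 * E.M)
  have hanti : Antitone fun n : ℕ => (E.connProb ν Γ lam (n + m)).toReal := by
    intro n n' hn
    refine ENNReal.toReal_mono (measure_ne_top _ _) (measure_mono fun ω hω => ?_)
    refine E.connected_shell_of_le _ ?_ ?_ hω
    · push_cast; linarith [(n : ℕ).cast_nonneg (α := ℝ)]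
    · exact_mod_cast Nat.add_le_add_right hn m
  refine tendsto_nhds_limUnder ⟨_, (tendsto_add_atTop_iff_nat m).1
    (tendsto_atTop_ciInf hanti ⟨0, ?_⟩)⟩
  rintro _ ⟨n, rfl⟩
  exact ENNReal.toReal_nonneg

end FactorEnvironment

end CoxPercolation

end

/-! ### Product measures -/

namespace MeasureTheory

/-! Let θ_n(λ) be the probability that Λ_{3M} is connected to ∂Λ_n. The proof follows the method of
Duminil-Copin, Raoufi and Tassion: the OSSS inequality for adaptive explorations gives θ_n' ≥ c (n /
Σ_n) θ_n with Σ_n = ∑_{m<n} θ_m, and this family of inequalities forces a sharp transition.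
Everything is done with finite differences in λ, so no derivative of θ_n is ever taken.

One coarse coordinate z carries Y_z together with the Poisson processes of all fine sites in the
block of z; these coordinates are independent. For k < n, explore the clusters that meet ∂Λ_k. A
connection from Λ_{3M} to ∂Λ_n has to cross ∂Λ_k, so the exploration decides it
(`exploration_determines`), and `OSSS.Exploration.osss` bounds θ_n(1 - θ_n) by the sum over e of the
probability that e is revealed times the influence of e. A coordinate is revealed only if its
neighbourhood is connected to ∂Λ_k, which by translation covariance costs about θ_m, where m is the
distance from e to the shell (`measure_mem_final_le`). Averaging over k turns this into a factor Σ_n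
/ n (`osss_average`).

By 1-dependence the influence of e is at most twice the probability that the connection exists but
is lost when the points in the blocks next to e are deleted (`influence_le`). Conditionally on
environment and marks, the connection is an increasing event of finitely many iid Poisson counts,
and deleting points means setting counts to zero. A Russo-type inequality
(`PoissonCounts.law_add_sum_clear_le`) then shows that raising λ increases θ_n by at least a
multiple of the sum of these same deletion probabilities. Since 1 - θ_n is bounded below for bounded
λ (`connReal_le`), the two estimates combine into `differenceInequality`, and `SharpThreshold.sharp`
gives both conclusions.

It remains to see that θ(λ) > 0 for some λ, so that λ_c is the infimum of a nonempty set. This is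
where coverage and essential connectedness enter: at high intensity the blocks that are well charged
form a 6-dependent site percolation whose density exceeds q_0(d), and its infinite cluster is
followed by a chain of overlapping balls (`exists_theta_pos`). -/

theorem infinitePi_prod_map_unzip {ι : Type*} {X Y : ι → Type*} [∀ i, MeasurableSpace (X i)]
    [∀ i, MeasurableSpace (Y i)] (μ : ∀ i, Measure (X i)) (ν : ∀ i, Measure (Y i))
    [∀ i, IsProbabilityMeasure (μ i)] [∀ i, IsProbabilityMeasure (ν i)] :
    (Measure.infinitePi fun i => (μ i).prod (ν i)).map
        (fun x => ((fun i => (x i).1, fun i => (x i).2) : (∀ i, X i) × ∀ i, Y i)) =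
      (Measure.infinitePi μ).prod (Measure.infinitePi ν) := by
  classical
  symm
  refine Measure.prod_eq_generateFrom
    (C := squareCylinders fun i => {s : Set (X i) | MeasurableSet s})
    (D := squareCylinders fun i => {s : Set (Y i) | MeasurableSet s})
    generateFrom_squareCylinders generateFrom_squareCylinders
    (isPiSystem_squareCylinders (fun i => MeasurableSpace.isPiSystem_measurableSet)
      fun i => MeasurableSet.univ)
    (isPiSystem_squareCylinders (fun i => MeasurableSpace.isPiSystem_measurableSet)
      fun i => MeasurableSet.univ)
    ⟨fun _ => univ, fun _ => ⟨∅, fun _ => univ, by simp, by simp⟩, fun _ => measure_lt_top _ _,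
      iUnion_const _⟩
    ⟨fun _ => univ, fun _ => ⟨∅, fun _ => univ, by simp, by simp⟩, fun _ => measure_lt_top _ _,
      iUnion_const _⟩ ?_
  rintro _ ⟨s, t, ht, rfl⟩ _ ⟨s', t', ht', rfl⟩
  simp only [Set.mem_pi, mem_univ, mem_ofPred_eq, forall_true_left] at ht ht'
  have hs : MeasurableSet ((s : Set ι).pi t) := .pi s.countable_toSet fun i _ => ht i
  have hs' : MeasurableSet ((s' : Set ι).pi t') := .pi s'.countable_toSet fun i _ => ht' i
  rw [Measure.map_apply (by fun_prop) (hs.prod hs')]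
  have : (fun x : ∀ i, X i × Y i => ((fun i => (x i).1, fun i => (x i).2) :
        (∀ i, X i) × ∀ i, Y i)) ⁻¹' ((s : Set ι).pi t ×ˢ (s' : Set ι).pi t') =
      ((s ∪ s' : Finset ι) : Set ι).pi fun i =>
        (if i ∈ s then t i else univ) ×ˢ (if i ∈ s' then t' i else univ) := by
    ext x
    simp only [mem_preimage, mem_prod, Set.mem_pi, Finset.mem_coe, Finset.mem_union]
    constructor
    · rintro ⟨h1, h2⟩ i -
      constructor <;> split_ifs <;> simp_all
    · intro h
      exact ⟨fun i hi => by simpa [hi] using (h i (Or.inl hi)).1,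
        fun i hi => by simpa [hi] using (h i (Or.inr hi)).2⟩
  rw [this, Measure.infinitePi_pi _ (fun i _ => by split_ifs <;> simp [ht, ht', MeasurableSet.prod]),
    Measure.infinitePi_pi _ fun i _ => ht i, Measure.infinitePi_pi _ fun i _ => ht' i]
  simp_rw [Measure.prod_prod]
  rw [Finset.prod_mul_distrib]
  congr 1
  · rw [← Finset.prod_subset (Finset.subset_union_left (s₁ := s) (s₂ := s'))
      (fun i _ hi => by simp [hi])]
    exact Finset.prod_congr rfl fun i hi => by simp [hi]
  · rw [← Finset.prod_subset (Finset.subset_union_right (s₁ := s) (s₂ := s'))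
      (fun i _ hi => by simp [hi])]
    exact Finset.prod_congr rfl fun i hi => by simp [hi]

theorem measurePreserving_unzip {ι : Type*} {X Y : ι → Type*} [∀ i, MeasurableSpace (X i)]
    [∀ i, MeasurableSpace (Y i)] (μ : ∀ i, Measure (X i)) (ν : ∀ i, Measure (Y i))
    [∀ i, IsProbabilityMeasure (μ i)] [∀ i, IsProbabilityMeasure (ν i)] :
    MeasurePreserving (fun x : ∀ i, X i × Y i => ((fun i => (x i).1, fun i => (x i).2) :
        (∀ i, X i) × ∀ i, Y i)) (Measure.infinitePi fun i => (μ i).prod (ν i))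
      ((Measure.infinitePi μ).prod (Measure.infinitePi ν)) :=
  ⟨by fun_prop, infinitePi_prod_map_unzip μ ν⟩

theorem measurePreserving_zip {ι : Type*} {X Y : ι → Type*} [∀ i, MeasurableSpace (X i)]
    [∀ i, MeasurableSpace (Y i)] (μ : ∀ i, Measure (X i)) (ν : ∀ i, Measure (Y i))
    [∀ i, IsProbabilityMeasure (μ i)] [∀ i, IsProbabilityMeasure (ν i)] :
    MeasurePreserving (fun (p : (∀ i, X i) × ∀ i, Y i) i => (p.1 i, p.2 i))
      ((Measure.infinitePi μ).prod (Measure.infinitePi ν))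
      (Measure.infinitePi fun i => (μ i).prod (ν i)) := by
  refine ⟨by fun_prop, ?_⟩
  rw [← infinitePi_prod_map_unzip, Measure.map_map (by fun_prop) (by fun_prop)]
  exact Measure.map_id

open scoped Classical in
/-- Exchanging the coordinates in `R` of two independent copies of a product measure. -/
theorem measurePreserving_swap_on {ι X : Type*} [MeasurableSpace X] (μ : Measure X)
    [IsProbabilityMeasure μ] (R : Set ι) :
    MeasurePreserving (fun p : (ι → X) × (ι → X) =>
        ((fun i => if i ∈ R then p.2 i else p.1 i, fun i => if i ∈ R then p.1 i else p.2 i) :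
          (ι → X) × (ι → X)))
      ((Measure.infinitePi fun _ => μ).prod (Measure.infinitePi fun _ => μ))
      ((Measure.infinitePi fun _ => μ).prod (Measure.infinitePi fun _ => μ)) := by
  have h1 := measurePreserving_zip (fun _ : ι => μ) (fun _ : ι => μ)
  have hf : ∀ i : ι, Measurable (fun q : X × X => if i ∈ R then q.swap else q) := fun i => by
    split_ifs
    · exact measurable_swap
    · exact measurable_id
  have h2 : MeasurePreserving (fun (x : ι → X × X) i => if i ∈ R then (x i).swap else x i)
      (Measure.infinitePi fun _ : ι => μ.prod μ) (Measure.infinitePi fun _ : ι => μ.prod μ) := by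
    refine ⟨measurable_pi_lambda _ fun i => (hf i).comp (measurable_pi_apply i), ?_⟩
    rw [Measure.infinitePi_map_pi (fun _ : ι => μ.prod μ) hf]
    congr 1
    funext i
    split_ifs
    · exact Measure.prod_swap
    · exact Measure.map_id
  have h3 := measurePreserving_unzip (fun _ : ι => μ) (fun _ : ι => μ)
  convert h3.comp (h2.comp h1) using 1
  funext p
  ext i <;> by_cases hi : i ∈ R <;> simp [hi]

theorem measurePreserving_prod_prod_comm {α β γ δ : Type*} [MeasurableSpace α]
    [MeasurableSpace β] [MeasurableSpace γ] [MeasurableSpace δ] (a : Measure α) (b : Measure β)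
    (c : Measure γ) (e : Measure δ) [SFinite a] [SFinite b] [SFinite c] [SFinite e] :
    MeasurePreserving (fun p : (α × β) × (γ × δ) => ((p.1.1, p.2.1), (p.1.2, p.2.2)))
      ((a.prod b).prod (c.prod e)) ((a.prod c).prod (b.prod e)) := by
  have h1 := measurePreserving_prodAssoc a b (c.prod e)
  have h2 := (MeasurePreserving.id a).prod (measurePreserving_prodAssoc b c e).symm
  have h3 := (MeasurePreserving.id a).prod
    ((Measure.measurePreserving_swap (μ := b) (ν := c)).prod (MeasurePreserving.id e))
  have h4 := (MeasurePreserving.id a).prod (measurePreserving_prodAssoc c b e)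
  have h5 := (measurePreserving_prodAssoc a c (b.prod e)).symm
  exact h5.comp (h4.comp (h3.comp (h2.comp h1)))

end MeasureTheory

/-! ### The OSSS inequality -/

namespace OSSS

variable {I K A B : Type*} (g : K → I)

open scoped Classical in
/-- The configuration that equals `ω'` on the coordinates belonging to `R` and `ω` elsewhere; the
coordinate `k : K` belongs to `R` if `g k ∈ R`. -/
noncomputable def mix (R : Set I) (ω ω' : (I → A) × (K → B)) : (I → A) × (K → B) :=
  (fun z => if z ∈ R then ω'.1 z else ω.1 z, fun k => if g k ∈ R then ω'.2 k else ω.2 k)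

/-- The configurations `ω` and `ω'` agree on `R`. -/
def Agree (R : Set I) (ω ω' : (I → A) × (K → B)) : Prop :=
  (∀ z ∈ R, ω.1 z = ω'.1 z) ∧ ∀ k, g k ∈ R → ω.2 k = ω'.2 k

variable {g}

theorem Agree.symm {R : Set I} {ω ω' : (I → A) × (K → B)} (h : Agree g R ω ω') :
    Agree g R ω' ω :=
  ⟨fun z hz => (h.1 z hz).symm, fun k hk => (h.2 k hk).symm⟩

theorem Agree.mono {R R' : Set I} {ω ω' : (I → A) × (K → B)} (h : Agree g R ω ω')
    (hR : R' ⊆ R) : Agree g R' ω ω' :=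
  ⟨fun z hz => h.1 z (hR hz), fun k hk => h.2 k (hR hk)⟩

theorem mix_agree_left {R R' : Set I} (h : Disjoint R R') (ω ω' : (I → A) × (K → B)) :
    Agree g R' (mix g R ω ω') ω :=
  ⟨fun _ hz => if_neg fun hz' => h.ne_of_mem hz' hz rfl,
    fun _ hk => if_neg fun hk' => h.ne_of_mem hk' hk rfl⟩

theorem mix_agree_right {R R' : Set I} (h : R' ⊆ R) (ω ω' : (I → A) × (K → B)) :
    Agree g R' (mix g R ω ω') ω' :=
  ⟨fun _ hz => if_pos (h hz), fun _ hk => if_pos (h hk)⟩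

variable [MeasurableSpace A] [MeasurableSpace B] (α : Measure A) (β : Measure B)
  [IsProbabilityMeasure α] [IsProbabilityMeasure β]

variable (I K) in
/-- The law of two independent iid families. -/
noncomputable def law : Measure ((I → A) × (K → B)) :=
  (Measure.infinitePi fun _ : I => α).prod (Measure.infinitePi fun _ : K => β)

instance : IsProbabilityMeasure (law I K α β) := by
  unfold law; infer_instance

-- This exchange of coordinates between two independent copies replaces all conditioning:
-- independence, pivotality and stopping arguments below are obtained by pulling an event back along
-- it.
variable (g) in
theorem measurePreserving_mix (R : Set I) :
    MeasurePreserving (fun p : ((I → A) × (K → B)) × ((I → A) × (K → B)) =>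
      (mix g R p.1 p.2, mix g R p.2 p.1)) ((law I K α β).prod (law I K α β))
      ((law I K α β).prod (law I K α β)) := by
  have h1 := measurePreserving_prod_prod_comm (Measure.infinitePi fun _ : I => α)
    (Measure.infinitePi fun _ : K => β) (Measure.infinitePi fun _ : I => α)
    (Measure.infinitePi fun _ : K => β)
  have h2 := (measurePreserving_swap_on α R).prod (measurePreserving_swap_on β (g ⁻¹' R))
  have h3 := measurePreserving_prod_prod_comm (Measure.infinitePi fun _ : I => α)
    (Measure.infinitePi fun _ : I => α) (Measure.infinitePi fun _ : K => β)
    (Measure.infinitePi fun _ : K => β)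
  exact h3.comp (h2.comp h1)

variable (g) in
theorem measurable_mix (R : Set I) :
    Measurable (fun p : ((I → A) × (K → B)) × ((I → A) × (K → B)) => mix g R p.1 p.2) := by
  unfold mix
  refine Measurable.prodMk ?_ ?_ <;> refine measurable_pi_lambda _ fun x => ?_ <;> split_ifs <;>
    fun_prop

/-- Events that depend on disjoint sets of coordinates are independent. -/
theorem measure_inter_of_disjoint {R R' : Set I} (hR : Disjoint R R')
    {C D : Set ((I → A) × (K → B))} (hC : MeasurableSet C) (hD : MeasurableSet D)
    (hCR : ∀ ω ω', Agree g R ω ω' → (ω ∈ C ↔ ω' ∈ C))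
    (hDR : ∀ ω ω', Agree g R' ω ω' → (ω ∈ D ↔ ω' ∈ D)) :
    law I K α β (C ∩ D) = law I K α β C * law I K α β D := by
  -- After the exchange on `R` the event `C` is read off the second copy and `D` off the first, so
  -- the probability factorises.
  have h1 : law I K α β (C ∩ D) = ((law I K α β).prod (law I K α β)) ((C ∩ D) ×ˢ univ) := by
    rw [Measure.prod_prod, measure_univ, mul_one]
  rw [h1, ← (measurePreserving_mix g α β R).measure_preimage
    ((hC.inter hD).prod .univ).nullMeasurableSet, mul_comm, ← Measure.prod_prod]
  congr 1
  ext p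
  simp only [mem_preimage, mem_prod, mem_inter_iff, mem_univ, and_true]
  rw [hCR _ _ (mix_agree_right Subset.rfl p.1 p.2), hDR _ _ (mix_agree_left hR p.1 p.2), and_comm]

/-- The influence of the coordinates belonging to `e` on the event `C`. -/
noncomputable def influence (g : K → I) (C : Set ((I → A) × (K → B))) (e : I) : ℝ≥0∞ :=
  ((law I K α β).prod (law I K α β)) {p | ¬ (p.1 ∈ C ↔ mix g {e} p.1 p.2 ∈ C)}

/-- This is one step of the interpolation in `osss`. Exchanging the coordinates in `R` moves the
event `D` to the second copy and turns the comparison of the two mixtures into resampling `e` alone.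
For a fixed first copy, `D` then depends on `R` and the flip on `e ∉ R`, so they are independent. -/
theorem measure_pivotal_of_agree {C D : Set ((I → A) × (K → B))} (hC : MeasurableSet C)
    (hD : MeasurableSet D) {R : Set I} {e : I} (he : e ∉ R)
    (hDR : ∀ ω ω', Agree g R ω ω' → (ω ∈ D ↔ ω' ∈ D)) :
    ((law I K α β).prod (law I K α β))
        {p | p.1 ∈ D ∧ ¬ (mix g R p.1 p.2 ∈ C ↔ mix g (insert e R) p.1 p.2 ∈ C)} =
      law I K α β D * influence α β g C e := by
  have hm := measurable_mix (A := A) (B := B) g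
  have hC' : ∀ S : Set I, MeasurableSet
      {p : ((I → A) × (K → B)) × ((I → A) × (K → B)) | mix g S p.1 p.2 ∈ C} := fun S => hm S hC
  have h0 : MeasurableSet {p : ((I → A) × (K → B)) × ((I → A) × (K → B)) | p.1 ∈ C} :=
    measurable_fst hC
  have hS : MeasurableSet {p : ((I → A) × (K → B)) × ((I → A) × (K → B)) |
      p.1 ∈ D ∧ ¬ (mix g R p.1 p.2 ∈ C ↔ mix g (insert e R) p.1 p.2 ∈ C)} :=
    (measurable_fst hD).inter (((hC' R).iff (hC' _)).compl)
  have hT : MeasurableSet {p : ((I → A) × (K → B)) × ((I → A) × (K → B)) |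
      ¬ (p.1 ∈ C ↔ mix g {e} p.1 p.2 ∈ C)} := (h0.iff (hC' _)).compl
  rw [← (measurePreserving_mix g α β R).measure_preimage hS.nullMeasurableSet]
  have : (fun p : ((I → A) × (K → B)) × ((I → A) × (K → B)) =>
      (mix g R p.1 p.2, mix g R p.2 p.1)) ⁻¹'
      {p | p.1 ∈ D ∧ ¬ (mix g R p.1 p.2 ∈ C ↔ mix g (insert e R) p.1 p.2 ∈ C)} =
      (univ ×ˢ D) ∩ {p | ¬ (p.1 ∈ C ↔ mix g {e} p.1 p.2 ∈ C)} := by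
    ext p
    have e1 : mix g R (mix g R p.1 p.2) (mix g R p.2 p.1) = p.1 := by
      ext x <;> simp only [mix] <;> split_ifs <;> rfl
    have e2 : mix g (insert e R) (mix g R p.1 p.2) (mix g R p.2 p.1) = mix g {e} p.1 p.2 := by
      ext x
      · by_cases h1 : x = e
        · subst h1; simp [mix, he]
        · by_cases h2 : x ∈ R <;> simp [mix, h1, h2]
      · by_cases h1 : g x = e
        · simp [mix, he, h1]
        · by_cases h2 : g x ∈ R <;> simp [mix, h1, h2]
    simp only [mem_preimage, mem_ofPred_eq, mem_inter_iff, mem_prod, mem_univ, true_and, e1, e2]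
    rw [hDR _ _ (mix_agree_right Subset.rfl p.1 p.2)]
  rw [this, Measure.prod_apply ((MeasurableSet.univ.prod hD).inter hT), influence,
    Measure.prod_apply hT, ← lintegral_const_mul' _ _ (measure_ne_top _ _)]
  refine lintegral_congr fun ω => ?_
  have hsec : MeasurableSet (Prod.mk ω ⁻¹' {p : ((I → A) × (K → B)) × ((I → A) × (K → B)) |
      ¬ (p.1 ∈ C ↔ mix g {e} p.1 p.2 ∈ C)}) := measurable_prodMk_left hT
  rw [← measure_inter_of_disjoint α β (R := R) (R' := {e}) (by simpa using he) hD hsec hDR]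
  · congr 1
    ext ω'
    simp
  · intro ω₁ ω₂ h
    have : mix g {e} ω ω₁ = mix g {e} ω ω₂ := by
      ext x
      · by_cases h1 : x = e
        · subst h1; simp [mix, h.1 x rfl]
        · simp [mix, h1]
      · by_cases h1 : g x = e
        · simp [mix, h1, h.2 x h1]
        · simp [mix, h1]
    simp [this]

/-! ### Adaptive explorations and the OSSS inequality -/

variable {α β}

/-- An adaptive rule that selects the next coordinate to be revealed from the values of the
coordinates revealed so far; it only selects coordinates in the finite set `F`. -/
structure Exploration (g : K → I) (A B : Type*) [MeasurableSpace A] [MeasurableSpace B]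
    (F : Finset I) where
  next : Finset I → (I → A) × (K → B) → Option I
  next_mem : ∀ R ω e, next R ω = some e → e ∈ F ∧ e ∉ R
  next_congr : ∀ (R : Finset I) (ω ω'), Agree g (R : Set I) ω ω' → next R ω = next R ω'
  measurableSet_next : ∀ R o, MeasurableSet {ω | next R ω = o}

namespace Exploration

variable {F : Finset I} (T : Exploration g A B F)

open scoped Classical in
/-- The set of coordinates revealed in the first `t` steps. -/
noncomputable def revealed (ω : (I → A) × (K → B)) : ℕ → Finset I
  | 0 => ∅
  | t + 1 => match T.next (revealed ω t) ω with
    | none => revealed ω t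
    | some e => insert e (revealed ω t)

theorem revealed_succ_none {ω : (I → A) × (K → B)} {t : ℕ}
    (h : T.next (T.revealed ω t) ω = none) : T.revealed ω (t + 1) = T.revealed ω t := by
  rw [revealed, h]

open scoped Classical in
theorem revealed_succ_some {ω : (I → A) × (K → B)} {t : ℕ} {e : I}
    (h : T.next (T.revealed ω t) ω = some e) :
    T.revealed ω (t + 1) = insert e (T.revealed ω t) := by
  rw [revealed, h]

theorem mem_revealed_succ_some {ω : (I → A) × (K → B)} {t : ℕ} {e w : I}
    (h : T.next (T.revealed ω t) ω = some e) :
    w ∈ T.revealed ω (t + 1) ↔ w = e ∨ w ∈ T.revealed ω t := by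
  classical
  rw [T.revealed_succ_some h, Finset.mem_insert]

theorem revealed_subset_succ (ω : (I → A) × (K → B)) (t : ℕ) :
    T.revealed ω t ⊆ T.revealed ω (t + 1) := by
  classical
  cases h : T.next (T.revealed ω t) ω with
  | none => rw [T.revealed_succ_none h]
  | some e => rw [T.revealed_succ_some h]; exact Finset.subset_insert _ _

theorem revealed_mono (ω : (I → A) × (K → B)) : Monotone (T.revealed ω) :=
  monotone_nat_of_le_succ (T.revealed_subset_succ ω)

theorem revealed_subset (ω : (I → A) × (K → B)) (t : ℕ) : T.revealed ω t ⊆ F := by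
  classical
  induction t with
  | zero => exact Finset.empty_subset _
  | succ t ih =>
    cases h : T.next (T.revealed ω t) ω with
    | none => rwa [T.revealed_succ_none h]
    | some e =>
      rw [T.revealed_succ_some h]
      exact Finset.insert_subset (T.next_mem _ _ _ h).1 ih

/-- The stopping-time property: the rule only looks at what it has already revealed. -/
theorem revealed_congr {ω ω' : (I → A) × (K → B)} {t : ℕ}
    (h : Agree g (T.revealed ω t : Set I) ω ω') : T.revealed ω' t = T.revealed ω t := by
  classical
  induction t with
  | zero => rfl
  | succ t ih =>
    have h1 := ih (h.mono (T.revealed_subset_succ ω t))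
    have h2 := T.next_congr _ _ _ (h.mono (T.revealed_subset_succ ω t))
    rw [revealed, revealed, h1, h2]

/-- Each active step reveals a new coordinate of `F`, so `F.card` steps exhaust the exploration;
this justifies the definition of `final`. -/
theorem card_revealed {ω : (I → A) × (K → B)} {t : ℕ}
    (h : T.next (T.revealed ω t) ω ≠ none) : t < (T.revealed ω (t + 1)).card := by
  classical
  induction t with
  | zero =>
    obtain ⟨e, he⟩ := Option.ne_none_iff_exists'.1 h
    rw [T.revealed_succ_some he]; simp
  | succ t ih =>
    have h' : T.next (T.revealed ω t) ω ≠ none := fun hn => by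
      rw [T.revealed_succ_none hn] at h; exact h hn
    obtain ⟨e, he⟩ := Option.ne_none_iff_exists'.1 h
    rw [T.revealed_succ_some he, Finset.card_insert_of_notMem (T.next_mem _ _ _ he).2]
    have := ih h'
    omega

/-- The set of coordinates revealed when the exploration stops. -/
noncomputable def final (ω : (I → A) × (K → B)) : Finset I := T.revealed ω F.card

theorem next_final (ω : (I → A) × (K → B)) : T.next (T.final ω) ω = none := by
  by_contra h
  have h1 := T.card_revealed h
  have h2 := Finset.card_le_card (T.revealed_subset ω (F.card + 1))
  omega

theorem measurableSet_revealed (t : ℕ) (R : Finset I) :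
    MeasurableSet {ω | T.revealed ω t = R} := by
  classical
  induction t generalizing R with
  | zero => exact MeasurableSet.const (∅ = R)
  | succ t ih =>
    have : {ω | T.revealed ω (t + 1) = R} = ⋃ R' ∈ F.powerset,
        {ω | T.revealed ω t = R'} ∩ (({ω | T.next R' ω = none} ∩ {_ω | R' = R}) ∪
          ⋃ e ∈ F, {ω | T.next R' ω = some e} ∩ {_ω | insert e R' = R}) := by
      ext ω
      simp only [mem_ofPred_eq, mem_iUnion, mem_inter_iff, mem_union, Finset.mem_powerset]
      constructor
      · intro h
        refine ⟨_, T.revealed_subset ω t, rfl, ?_⟩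
        cases hn : T.next (T.revealed ω t) ω with
        | none => exact Or.inl ⟨rfl, by rw [← h, T.revealed_succ_none hn]⟩
        | some e =>
          exact Or.inr ⟨e, (T.next_mem _ _ _ hn).1, rfl, by rw [← h, T.revealed_succ_some hn]⟩
      · rintro ⟨R', -, rfl, ⟨h1, h2⟩ | ⟨e, -, h1, h2⟩⟩
        · rw [T.revealed_succ_none h1, h2]
        · rw [T.revealed_succ_some h1, h2]
    rw [this]
    refine Finset.measurableSet_biUnion _ fun R' _ => (ih R').inter ?_
    exact ((T.measurableSet_next _ _).inter (.const _)).union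
      (Finset.measurableSet_biUnion _ fun e _ => (T.measurableSet_next _ _).inter (.const _))

variable (α β)

/-- Two configurations that agree on the explored coordinates, one of them being replaced
there by an independent copy. -/
theorem measure_mem_and_mix_final {C : Set ((I → A) × (K → B))} (hC : MeasurableSet C)
    (hdet : ∀ ω ω', Agree g (T.final ω : Set I) ω ω' → (ω ∈ C ↔ ω' ∈ C)) :
    ((law I K α β).prod (law I K α β)) {p | p.1 ∈ C ∧ mix g (T.final p.1) p.1 p.2 ∈ C} =
      law I K α β C * law I K α β C := by
  classical
  have hm := measurable_mix (A := A) (B := B) g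
  -- Exchanging the coordinates outside `R` changes neither the event that the exploration stops at
  -- `R` nor, there, membership in `C`, while the mixture becomes the whole second copy.
  have key : ∀ R : Finset I, ((law I K α β).prod (law I K α β))
      {p | T.final p.1 = R ∧ p.1 ∈ C ∧ mix g (R : Set I) p.1 p.2 ∈ C} =
      ((law I K α β).prod (law I K α β)) {p | T.final p.1 = R ∧ p.1 ∈ C ∧ p.2 ∈ C} := by
    intro R
    have hS : MeasurableSet {p : ((I → A) × (K → B)) × ((I → A) × (K → B)) |
        T.final p.1 = R ∧ p.1 ∈ C ∧ p.2 ∈ C} :=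
      (measurable_fst (T.measurableSet_revealed _ R)).inter
        ((measurable_fst hC).inter (measurable_snd hC))
    rw [← (measurePreserving_mix g α β (R : Set I)ᶜ).measure_preimage hS.nullMeasurableSet]
    congr 1
    ext p
    simp only [mem_ofPred_eq, mem_preimage]
    have e1 : mix g (R : Set I)ᶜ p.2 p.1 = mix g (R : Set I) p.1 p.2 := by
      ext x <;> simp [mix]
    have e2 : Agree g (R : Set I) p.1 (mix g (R : Set I)ᶜ p.1 p.2) :=
      (mix_agree_left disjoint_compl_left _ _).symm
    rw [e1]
    constructor
    · rintro ⟨rfl, h1, h2⟩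
      exact ⟨T.revealed_congr e2, (hdet _ _ e2).1 h1, h2⟩
    · rintro ⟨h0, h1, h2⟩
      have e3 : Agree g (T.final (mix g (R : Set I)ᶜ p.1 p.2) : Set I)
          (mix g (R : Set I)ᶜ p.1 p.2) p.1 := by rw [h0]; exact e2.symm
      exact ⟨by rw [← h0]; exact T.revealed_congr e3, (hdet _ _ e3).1 h1, h2⟩
  have hdec : ∀ S : Finset I → Set (((I → A) × (K → B)) × ((I → A) × (K → B))),
      (∀ R, MeasurableSet (S R)) →
      ((law I K α β).prod (law I K α β)) {p | p ∈ S (T.final p.1)} =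
      ∑ R ∈ F.powerset, ((law I K α β).prod (law I K α β)) {p | T.final p.1 = R ∧ p ∈ S R} := by
    intro S hS
    rw [← measure_biUnion_finset]
    · congr 1
      ext p
      simp only [mem_ofPred_eq, mem_iUnion, Finset.mem_powerset]
      constructor
      · intro h
        exact ⟨_, T.revealed_subset _ _, rfl, h⟩
      · rintro ⟨R, -, rfl, h⟩
        exact h
    · intro R _ R' _ hne
      rw [Function.onFun, Set.disjoint_left]
      rintro p ⟨h, -⟩ ⟨h', -⟩
      exact hne (h.symm.trans h')
    · exact fun R _ => (measurable_fst (T.measurableSet_revealed _ R)).inter (hS R)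
  have h1 := hdec (fun R => {p | p.1 ∈ C ∧ mix g (R : Set I) p.1 p.2 ∈ C})
    fun R => (measurable_fst hC).inter (hm _ hC)
  have h2 := hdec (fun _ => C ×ˢ C) fun R => hC.prod hC
  have h3 : {p : ((I → A) × (K → B)) × ((I → A) × (K → B)) | p ∈ C ×ˢ C} = C ×ˢ C := rfl
  rw [h3, Measure.prod_prod] at h2
  rw [h2]
  refine h1.trans (Finset.sum_congr rfl fun R _ => ?_)
  exact key R

/-- Replace the revealed coordinates of the first copy by those of the second, one at a time in the
order of the exploration. If the first copy lies in `C`, either the last mixture does too, which has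
probability P(C)² because the last mixture is a fresh configuration, or membership changes at some
step. The step that reveals `e` contributes the probability of that revealment times the influence
of `e`. -/
theorem osss {C : Set ((I → A) × (K → B))} (hC : MeasurableSet C)
    (hdet : ∀ ω ω', Agree g (T.final ω : Set I) ω ω' → (ω ∈ C ↔ ω' ∈ C)) :
    law I K α β C ≤ law I K α β C * law I K α β C +
      ∑ e ∈ F, law I K α β {ω | e ∈ T.final ω} * influence α β g C e := by
  classical
  set P := (law I K α β).prod (law I K α β) with hP
  let D : ℕ → Finset I → I → Set ((I → A) × (K → B)) := fun t R e =>
    {ω | T.revealed ω t = R ∧ T.next R ω = some e}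
  have hD : ∀ t R e, MeasurableSet (D t R e) := fun t R e =>
    (T.measurableSet_revealed t R).inter (T.measurableSet_next R _)
  let Z : ℕ → Finset I → I → Set (((I → A) × (K → B)) × ((I → A) × (K → B))) := fun t R e =>
    {p | p.1 ∈ D t R e ∧ ¬ (mix g (R : Set I) p.1 p.2 ∈ C ↔
      mix g (insert e (R : Set I)) p.1 p.2 ∈ C)}
  have hZ : ∀ t R e, P (Z t R e) ≤ law I K α β (D t R e) * influence α β g C e := by
    intro t R e
    by_cases he : e ∈ R
    · have : Z t R e = ∅ := by
        ext p
        simp only [mem_empty_iff_false, iff_false]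
        rintro ⟨⟨-, h⟩, -⟩
        exact (T.next_mem _ _ _ h).2 he
      simp [this]
    · refine (measure_pivotal_of_agree α β hC (hD t R e) (R := (R : Set I)) (by simpa using he)
        ?_).le
      intro ω ω' h
      constructor
      · rintro ⟨rfl, h2⟩
        exact ⟨T.revealed_congr h, by rw [← h2, T.next_congr _ _ _ h]⟩
      · rintro ⟨rfl, h2⟩
        exact ⟨T.revealed_congr h.symm, by rw [← h2, T.next_congr _ _ _ h]⟩
  have hcover : {p : ((I → A) × (K → B)) × ((I → A) × (K → B)) | p.1 ∈ C} ⊆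
      {p | p.1 ∈ C ∧ mix g (T.final p.1) p.1 p.2 ∈ C} ∪
        ⋃ e ∈ F, ⋃ t ∈ Finset.range F.card, ⋃ R ∈ F.powerset, Z t R e := by
    intro p hp
    by_contra hcon
    simp only [mem_union, mem_ofPred_eq, mem_iUnion, not_or, not_and, not_exists,
      Finset.mem_range, Finset.mem_powerset] at hcon
    have hall : ∀ t ≤ F.card, mix g (T.revealed p.1 t : Set I) p.1 p.2 ∈ C := by
      intro t ht
      induction t with
      | zero =>
        have : mix g ((T.revealed p.1 0 : Finset I) : Set I) p.1 p.2 = p.1 := by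
          ext x <;> simp [mix, revealed]
        rw [this]; exact hp
      | succ t ih =>
        have ih := ih (by omega)
        cases hn : T.next (T.revealed p.1 t) p.1 with
        | none => rwa [T.revealed_succ_none hn]
        | some e =>
          by_contra hc
          refine hcon.2 e (T.next_mem _ _ _ hn).1 t (by omega) (T.revealed p.1 t)
            (T.revealed_subset _ _) ⟨⟨rfl, hn⟩, fun hiff => hc ?_⟩
          rw [T.revealed_succ_some hn, Finset.coe_insert]
          exact hiff.1 ih
    exact hcon.1 hp (hall _ le_rfl)
  -- A coordinate is revealed at most once, so these events are disjoint over time and over revealed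
  -- sets.
  have hsum : ∀ e, ∑ t ∈ Finset.range F.card, ∑ R ∈ F.powerset, law I K α β (D t R e) ≤
      law I K α β {ω | e ∈ T.final ω} := by
    intro e
    rw [← Finset.sum_product']
    rw [← measure_biUnion_finset (f := fun q : ℕ × Finset I => D q.1 q.2 e)]
    · refine measure_mono ?_
      intro ω hω
      simp only [mem_iUnion] at hω
      obtain ⟨⟨t, R⟩, hq, h, hn⟩ := hω
      dsimp only at h hn
      subst h
      simp only [Finset.mem_product, Finset.mem_range] at hq
      have h1 : e ∈ T.revealed ω (t + 1) := by
        rw [T.revealed_succ_some hn]; exact Finset.mem_insert_self _ _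
      exact T.revealed_mono ω (by omega : t + 1 ≤ F.card) h1
    · rintro ⟨t, R⟩ - ⟨t', R'⟩ - hne
      rw [Function.onFun, Set.disjoint_left]
      rintro ω ⟨h0, h⟩ ⟨h0', h'⟩
      dsimp only at h0 h h0' h'
      subst h0 h0'
      have aux : ∀ s s', s < s' → T.next (T.revealed ω s) ω = some e →
          T.next (T.revealed ω s') ω = some e → False := by
        intro s s' hss hs hs'
        have h1 : e ∈ T.revealed ω (s + 1) := by
          rw [T.revealed_succ_some hs]; exact Finset.mem_insert_self _ _
        exact (T.next_mem _ _ _ hs').2 (T.revealed_mono ω hss h1)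
      rcases lt_trichotomy t t' with hlt | rfl | hlt
      · exact aux _ _ hlt h h'
      · exact hne rfl
      · exact aux _ _ hlt h' h
    · exact fun q _ => hD _ _ _
  calc law I K α β C = P {p | p.1 ∈ C} := by
        have : {p : ((I → A) × (K → B)) × ((I → A) × (K → B)) | p.1 ∈ C} = C ×ˢ univ := by
          ext p; simp
        rw [this, hP, Measure.prod_prod, measure_univ, mul_one]
    _ ≤ P {p | p.1 ∈ C ∧ mix g (T.final p.1) p.1 p.2 ∈ C} +
        P (⋃ e ∈ F, ⋃ t ∈ Finset.range F.card, ⋃ R ∈ F.powerset, Z t R e) :=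
        (measure_mono hcover).trans (measure_union_le _ _)
    _ ≤ _ := by
        rw [hP, T.measure_mem_and_mix_final α β hC hdet]
        gcongr
        refine (measure_biUnion_finset_le _ _).trans (Finset.sum_le_sum fun e _ => ?_)
        refine (measure_biUnion_finset_le _ _).trans ?_
        refine le_trans ?_ (mul_le_mul_left (hsum e) _)
        rw [Finset.sum_mul]
        refine Finset.sum_le_sum fun t _ => ?_
        rw [Finset.sum_mul]
        exact (measure_biUnion_finset_le _ _).trans (Finset.sum_le_sum fun R _ => hZ t R e)

end Exploration

end OSSS

/-! ### Sharpness from a family of finite difference inequalities -/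

namespace SharpThreshold

theorem exists_fine_partition (s t m a : ℝ) :
    ∃ N : ℕ, 0 < N ∧ 1 / 2 ≤ Real.exp (-m * ((t - s) / N)) ∧ a * ((t - s) / N) ≤ 1 := by
  have h1 : Tendsto (fun N : ℕ => (t - s) / (N : ℝ)) atTop (𝓝 0) :=
    tendsto_const_div_atTop_nhds_zero_nat _
  have h2 : Tendsto (fun N : ℕ => Real.exp (-m * ((t - s) / (N : ℝ)))) atTop (𝓝 1) := by
    have := (Real.continuous_exp.tendsto _).comp (h1.const_mul (-m))
    simpa [Function.comp_def] using this
  have h3 : Tendsto (fun N : ℕ => a * ((t - s) / (N : ℝ))) atTop (𝓝 0) := by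
    simpa using h1.const_mul a
  obtain ⟨N, hN⟩ := ((h2.eventually_const_le (by norm_num : (1 / 2 : ℝ) < 1)).and
    ((h3.eventually_le_const (by norm_num : (0 : ℝ) < 1)).and (eventually_gt_atTop 0))).exists
  exact ⟨N, hN.2.2, hN.1, hN.2.1⟩

/-- On a fine enough partition the error factor is at least 1/2. The rate `m` does not enter the
conclusion, which is essential because later it grows with the volume of the box. -/
theorem le_sub_of_increments {T : ℝ → ℝ} {s t a m : ℝ} (hst : s < t) (ha : 0 ≤ a)
    (h : ∀ x y, s ≤ x → x < y → y ≤ t → a * (y - x) * Real.exp (-m * (y - x)) ≤ T y - T x) :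
    a * (t - s) / 2 ≤ T t - T s := by
  obtain ⟨N, hN, h1, -⟩ := exists_fine_partition s t m a
  have hN' : (0 : ℝ) < N := by exact_mod_cast hN
  set δ := (t - s) / N with hδ
  have hδ0 : 0 < δ := div_pos (by linarith) hN'
  have hδN : N * δ = t - s := by rw [hδ]; field_simp
  have key : ∀ i : ℕ, i ≤ N → i * (a * δ / 2) ≤ T (s + i * δ) - T s := by
    intro i hi
    induction i with
    | zero => simp
    | succ i ih =>
      have ih := ih (by omega)
      have hi' : ((i : ℝ) + 1) ≤ N := by exact_mod_cast hi
      have h2 := h (s + i * δ) (s + (i + 1) * δ) (by nlinarith [(i : ℕ).cast_nonneg (α := ℝ)])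
        (by nlinarith) (by nlinarith)
      have h3 : s + (i + 1) * δ - (s + i * δ) = δ := by ring
      rw [h3] at h2
      have h4 : a * δ * (1 / 2) ≤ a * δ * Real.exp (-m * δ) :=
        mul_le_mul_of_nonneg_left h1 (by positivity)
      push_cast
      linarith
  have := key N le_rfl
  rw [hδN] at this
  have h5 : (N : ℝ) * (a * δ / 2) = a * (t - s) / 2 := by rw [← hδN]; ring
  rw [h5] at this
  simpa using this

/-- A discrete Grönwall inequality on a partition so fine that the error factor is at least 1/2. -/
theorem exp_mul_le_of_increments {f : ℝ → ℝ} {s t a m : ℝ} (hst : s < t) (ha : 0 ≤ a)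
    (hf : ∀ x, 0 ≤ f x)
    (h : ∀ x y, s ≤ x → x < y → y ≤ t →
      a * (y - x) * Real.exp (-m * (y - x)) * f x ≤ f y - f x) :
    Real.exp (a * (t - s) / 4) * f s ≤ f t := by
  obtain ⟨N, hN, h1, h1'⟩ := exists_fine_partition s t m a
  have hN' : (0 : ℝ) < N := by exact_mod_cast hN
  set δ := (t - s) / N with hδ
  have hδ0 : 0 < δ := div_pos (by linarith) hN'
  have hδN : N * δ = t - s := by rw [hδ]; field_simp
  -- With u = aδ ≤ 1, exp(u/4) ≤ 1/(1 - u/4) ≤ 1 + u/2.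
  have hexp : Real.exp (a * δ / 4) ≤ 1 + a * δ / 2 := by
    have h0 : 0 ≤ a * δ := by positivity
    have h2 := Real.add_one_le_exp (-(a * δ / 4))
    rw [Real.exp_neg, le_inv_comm₀ (by linarith) (Real.exp_pos _)] at h2
    refine h2.trans ?_
    rw [inv_le_iff_one_le_mul₀ (by linarith)]
    nlinarith
  have key : ∀ i : ℕ, i ≤ N → Real.exp (i * (a * δ / 4)) * f s ≤ f (s + i * δ) := by
    intro i hi
    induction i with
    | zero => simp
    | succ i ih =>
      have ih := ih (by omega)
      have hi' : ((i : ℝ) + 1) ≤ N := by exact_mod_cast hi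
      have h2 := h (s + i * δ) (s + (i + 1) * δ) (by nlinarith [(i : ℕ).cast_nonneg (α := ℝ)])
        (by nlinarith) (by nlinarith)
      have h3 : s + (i + 1) * δ - (s + i * δ) = δ := by ring
      rw [h3] at h2
      have h4 : a * δ * (1 / 2) * f (s + i * δ) ≤ a * δ * Real.exp (-m * δ) * f (s + i * δ) :=
        mul_le_mul_of_nonneg_right (mul_le_mul_of_nonneg_left h1 (by positivity)) (hf _)
      push_cast
      have h5 : Real.exp (((i : ℝ) + 1) * (a * δ / 4)) * f s =
          Real.exp (a * δ / 4) * (Real.exp (i * (a * δ / 4)) * f s) := by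
        rw [← mul_assoc, ← Real.exp_add]; ring_nf
      rw [h5]
      calc Real.exp (a * δ / 4) * (Real.exp (i * (a * δ / 4)) * f s)
          ≤ (1 + a * δ / 2) * f (s + i * δ) := by
            gcongr
            exact mul_nonneg (Real.exp_pos _).le (hf _)
        _ ≤ _ := by linarith
  have := key N le_rfl
  rw [hδN] at this
  have h5 : (N : ℝ) * (a * δ / 4) = a * (t - s) / 4 := by rw [← hδN]; ring
  rw [h5] at this
  simpa using this

/-- The sequence that equals `1` before `n₀` and `θ` from `n₀` on. -/
noncomputable def padded (θ : ℕ → ℝ → ℝ) (n₀ n : ℕ) (x : ℝ) : ℝ := if n < n₀ then 1 else θ n x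

/-- Partial sums of `padded`. -/
noncomputable def partialSum (θ : ℕ → ℝ → ℝ) (n₀ n : ℕ) (x : ℝ) : ℝ :=
  ∑ k ∈ Finset.range n, padded θ n₀ k x

/-- The finite difference inequality on `(0, b]` behind a sharp threshold. -/
def DifferenceInequality (θ : ℕ → ℝ → ℝ) (n₀ : ℕ) (b c : ℝ) : Prop :=
  ∀ n, n₀ ≤ n → ∃ m : ℝ, 0 ≤ m ∧ ∀ x y, 0 < x → x < y → y ≤ b →
    c * (n / partialSum θ n₀ n x) * (y - x) * Real.exp (-m * (y - x)) * θ n x ≤ θ n y - θ n x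

variable {θ : ℕ → ℝ → ℝ} {n₀ : ℕ}

theorem padded_nonneg (h0 : ∀ n x, 0 ≤ θ n x) (n : ℕ) (x : ℝ) : 0 ≤ padded θ n₀ n x := by
  unfold padded; split_ifs
  · exact zero_le_one
  · exact h0 _ _

theorem padded_mono (hmono : ∀ n, n₀ ≤ n → Monotone (θ n)) (n : ℕ) :
    Monotone (padded θ n₀ n) := by
  intro x y hxy
  unfold padded; split_ifs with h
  · exact le_rfl
  · exact hmono _ (not_lt.1 h) hxy

theorem partialSum_mono (hmono : ∀ n, n₀ ≤ n → Monotone (θ n)) (n : ℕ) :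
    Monotone (partialSum θ n₀ n) := fun _ _ hxy =>
  Finset.sum_le_sum fun k _ => padded_mono hmono k hxy

theorem one_le_partialSum (h0 : ∀ n x, 0 ≤ θ n x) (hn₀ : 0 < n₀) {n : ℕ} (hn : 0 < n) (x : ℝ) :
    1 ≤ partialSum θ n₀ n x := by
  have := Finset.single_le_sum (f := fun k => padded θ n₀ k x) (fun k _ => padded_nonneg h0 k x)
    (Finset.mem_range.2 hn)
  refine le_trans (le_of_eq ?_) this
  simp [padded, hn₀]

theorem partialSum_self (x : ℝ) : partialSum θ n₀ n₀ x = n₀ := by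
  unfold partialSum
  rw [Finset.sum_congr rfl (g := fun _ => (1 : ℝ))]
  · simp
  · intro k hk
    simp [padded, Finset.mem_range.1 hk]

/-- The quotients θ_i / Σ_i are those produced by the difference inequality after division by i.
Their sum dominates the logarithmic growth of Σ because log(1 + u) ≤ u. -/
theorem log_partialSum_le (h0 : ∀ n x, 0 ≤ θ n x) (hn₀ : 0 < n₀) {n : ℕ} (hn : n₀ ≤ n) (x : ℝ) :
    Real.log (partialSum θ n₀ n x) - Real.log n₀ ≤
      ∑ i ∈ Finset.Ico n₀ n, θ i x / partialSum θ n₀ i x := by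
  induction n, hn using Nat.le_induction with
  | base => simp [partialSum_self]
  | succ n hn ih =>
    rw [Finset.sum_Ico_succ_top hn]
    have h1 := one_le_partialSum h0 hn₀ (hn₀.trans_le hn) x
    have h2 : partialSum θ n₀ (n + 1) x = partialSum θ n₀ n x + θ n x := by
      rw [partialSum, Finset.sum_range_succ, ← partialSum, padded, if_neg (by omega)]
    have h3 : Real.log (partialSum θ n₀ (n + 1) x) ≤
        Real.log (partialSum θ n₀ n x) + θ n x / partialSum θ n₀ n x := by
      have h4 : partialSum θ n₀ (n + 1) x =
          partialSum θ n₀ n x * (1 + θ n x / partialSum θ n₀ n x) := by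
        rw [h2]; field_simp
      have h5 : 0 ≤ θ n x / partialSum θ n₀ n x := div_nonneg (h0 _ _) (by linarith)
      rw [h4, Real.log_mul (by linarith) (by linarith)]
      have := Real.log_le_sub_one_of_pos (show 0 < 1 + θ n x / partialSum θ n₀ n x by linarith)
      linarith
    linarith

variable {b c : ℝ}

/-- The quantity to follow is T = ∑ θ_i / i. By the difference inequality it grows with the
parameter at rate at least c (log Σ_n - log n₀) up to the error factor, while at `t` it is at most
of order θ_k(t) log n, apart from the `k` initial terms. -/
theorem log_growth (h0 : ∀ n x, 0 ≤ θ n x) (h1 : ∀ n x, θ n x ≤ 1)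
    (hmono : ∀ n, n₀ ≤ n → Monotone (θ n))
    (hanti : ∀ x m n, n₀ ≤ m → m ≤ n → θ n x ≤ θ m x) (hn₀ : 0 < n₀) (hc : 0 ≤ c)
    (hd : DifferenceInequality θ n₀ b c) {s t : ℝ} (hs : 0 < s) (hst : s < t) (ht : t ≤ b)
    {n k : ℕ} (hn : n₀ ≤ n) (hk : n₀ ≤ k) :
    c / 2 * (t - s) * (Real.log (partialSum θ n₀ n s) - Real.log n₀) ≤
      k + θ k t * (1 + Real.log n) := by
  let T : ℝ → ℝ := fun x => ∑ i ∈ Finset.Ico n₀ n, θ i x / i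
  have hpos : ∀ i x, n₀ ≤ i → 0 < partialSum θ n₀ i x := fun i x hi =>
    zero_lt_one.trans_le (one_le_partialSum h0 hn₀ (hn₀.trans_le hi) x)
  choose! m hm0 hm using hd
  -- Summing the rates provides a single rate valid for all indices; its size is irrelevant to
  -- `le_sub_of_increments`.
  have hbig : ∀ i ∈ Finset.Ico n₀ n, m i ≤ ∑ i ∈ Finset.Ico n₀ n, m i := fun i hi =>
    Finset.single_le_sum (f := m) (fun j hj => hm0 j (Finset.mem_Ico.1 hj).1) hi
  have hlog0 : 0 ≤ Real.log (partialSum θ n₀ n s) - Real.log n₀ := by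
    have : (n₀ : ℝ) ≤ partialSum θ n₀ n s := by
      rw [← partialSum_self (θ := θ) (n₀ := n₀) s]
      exact Finset.sum_le_sum_of_subset_of_nonneg (Finset.range_mono hn)
        fun i _ _ => padded_nonneg h0 i s
    have := Real.log_le_log (by exact_mod_cast hn₀) this
    linarith
  have hT := le_sub_of_increments (T := T) (m := ∑ i ∈ Finset.Ico n₀ n, m i)
    (a := c * (Real.log (partialSum θ n₀ n s) - Real.log n₀)) hst (mul_nonneg hc hlog0) (by
      intro x y hx hxy hy
      have hstep : ∀ i ∈ Finset.Ico n₀ n,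
          c * (y - x) * Real.exp (-(∑ i ∈ Finset.Ico n₀ n, m i) * (y - x)) *
            (θ i x / partialSum θ n₀ i x) ≤ θ i y / i - θ i x / i := by
        intro i hi
        have hi' := (Finset.mem_Ico.1 hi).1
        have hi0 : (0 : ℝ) < i := by exact_mod_cast hn₀.trans_le hi'
        have h2 := hm i hi' x y (hs.trans_le hx) hxy (hy.trans ht)
        rw [← sub_div, le_div_iff₀ hi0]
        refine le_trans (le_of_eq_of_le ?_ (mul_le_mul_of_nonneg_left (Real.exp_le_exp.2
          (show -(∑ i ∈ Finset.Ico n₀ n, m i) * (y - x) ≤ -m i * (y - x) by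
            nlinarith [hbig i hi])) (show 0 ≤ c * (i / partialSum θ n₀ i x) * (y - x) * θ i x from
            ?_))) (le_of_eq_of_le ?_ h2)
        · ring
        · have := hpos i x hi'
          have := h0 i x
          have : 0 ≤ y - x := by linarith
          positivity
        · ring
      have hsum := Finset.sum_le_sum hstep
      rw [← Finset.mul_sum, Finset.sum_sub_distrib] at hsum
      refine le_trans ?_ hsum
      have h3 := log_partialSum_le h0 hn₀ hn x
      have h4 : Real.log (partialSum θ n₀ n s) ≤ Real.log (partialSum θ n₀ n x) :=
        Real.log_le_log (hpos n s hn) (partialSum_mono hmono n hx)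
      have h5 : 0 ≤ c * (y - x) * Real.exp (-(∑ i ∈ Finset.Ico n₀ n, m i) * (y - x)) :=
        mul_nonneg (mul_nonneg hc (by linarith)) (Real.exp_pos _).le
      calc _ = c * (y - x) * Real.exp (-(∑ i ∈ Finset.Ico n₀ n, m i) * (y - x)) *
            (Real.log (partialSum θ n₀ n s) - Real.log n₀) := by ring
        _ ≤ _ := mul_le_mul_of_nonneg_left (by linarith) h5)
  have hTs : 0 ≤ T s := Finset.sum_nonneg fun i _ => div_nonneg (h0 _ _) (Nat.cast_nonneg _)
  have hTt : T t ≤ k + θ k t * (1 + Real.log n) := by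
    have h2 : T t ≤ ∑ i ∈ Finset.Ico n₀ n, ((if i < k then 1 else 0) + θ k t * (i : ℝ)⁻¹) := by
      refine Finset.sum_le_sum fun i hi => ?_
      have hi' := (Finset.mem_Ico.1 hi).1
      have hi0 : (1 : ℝ) ≤ i := by exact_mod_cast hn₀.trans_le hi'
      split_ifs with hik
      · have : θ i t / i ≤ 1 := by
          rw [div_le_one (by linarith)]; exact (h1 i t).trans hi0
        have : 0 ≤ θ k t * (i : ℝ)⁻¹ := mul_nonneg (h0 _ _) (by positivity)
        linarith
      · rw [zero_add, div_eq_mul_inv]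
        exact mul_le_mul_of_nonneg_right (hanti t k i hk (by omega)) (by positivity)
    refine h2.trans ?_
    rw [Finset.sum_add_distrib, ← Finset.mul_sum]
    gcongr
    · rw [Finset.sum_boole]
      have : (Finset.filter (fun i => i < k) (Finset.Ico n₀ n)).card ≤ (Finset.range k).card :=
        Finset.card_le_card fun i hi => Finset.mem_range.2 (Finset.mem_filter.1 hi).2
      rw [Finset.card_range] at this
      exact_mod_cast this
    · exact h0 _ _
    · have h3 := harmonic_le_one_add_log n
      rw [harmonic_eq_sum_Icc] at h3
      push_cast at h3
      refine le_trans (Finset.sum_le_sum_of_subset_of_nonneg ?_ fun i _ _ => by positivity) h3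
      intro i hi
      rw [Finset.mem_Ico] at hi
      exact Finset.mem_Icc.2 ⟨hn₀.trans_le hi.1, hi.2.le⟩
  have : c * (Real.log (partialSum θ n₀ n s) - Real.log n₀) * (t - s) / 2 =
      c / 2 * (t - s) * (Real.log (partialSum θ n₀ n s) - Real.log n₀) := by ring
  linarith

/-- Divide `log_growth` by log n along the given subsequence, with `k` fixed, and let `k` tend to
infinity at the end. If Σ_n(s) grows at least like n^γ infinitely often, the limit at `t` is bounded
below linearly in t - s. -/
theorem le_limit_of_frequently (h0 : ∀ n x, 0 ≤ θ n x) (h1 : ∀ n x, θ n x ≤ 1)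
    (hmono : ∀ n, n₀ ≤ n → Monotone (θ n)) (hanti : ∀ x m n, n₀ ≤ m → m ≤ n → θ n x ≤ θ m x)
    (hn₀ : 0 < n₀) (hc : 0 ≤ c) (hd : DifferenceInequality θ n₀ b c) {s t : ℝ} (hs : 0 < s)
    (hst : s < t) (ht : t ≤ b) {γ C l : ℝ} (hl : Tendsto (fun n => θ n t) atTop (𝓝 l))
    (hfreq : ∃ᶠ n : ℕ in atTop, γ * Real.log n - C ≤ Real.log (partialSum θ n₀ n s)) :
    c / 2 * (t - s) * γ ≤ l := by
  refine ge_of_tendsto hl ?_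
  filter_upwards [eventually_ge_atTop n₀] with k hk
  by_contra hlt
  push Not at hlt
  set δ := c / 2 * (t - s) * γ - θ k t with hδ
  have hδ0 : 0 < δ := by linarith
  have hlog : Tendsto (fun n : ℕ => Real.log n) atTop atTop :=
    Real.tendsto_log_atTop.comp tendsto_natCast_atTop_atTop
  have hev := hlog.eventually_gt_atTop
    ((k + θ k t + c / 2 * (t - s) * (C + Real.log n₀)) / δ)
  obtain ⟨n, h2, h3, hn⟩ := (hfreq.and_eventually (hev.and (eventually_ge_atTop n₀))).exists
  have h4 := log_growth h0 h1 hmono hanti hn₀ hc hd hs hst ht hn hk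
  rw [div_lt_iff₀ hδ0] at h3
  have h5 : c / 2 * (t - s) * (γ * Real.log n - C) ≤
      c / 2 * (t - s) * Real.log (partialSum θ n₀ n s) :=
    mul_le_mul_of_nonneg_left h2 (mul_nonneg (by linarith) (by linarith))
  rw [hδ] at h3
  nlinarith

/-- An upper bound `κ` on Σ_n at the larger parameter gives growth rate at least c n / κ throughout
the interval; since θ_n ≤ 1 at its right end, θ_n is exponentially small at its left end. -/
theorem le_exp_neg (h0 : ∀ n x, 0 ≤ θ n x) (h1 : ∀ n x, θ n x ≤ 1)
    (hmono : ∀ n, n₀ ≤ n → Monotone (θ n)) (hn₀ : 0 < n₀) (hc : 0 ≤ c)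
    (hd : DifferenceInequality θ n₀ b c) {s t : ℝ} (hs : 0 < s) (hst : s < t) (ht : t ≤ b)
    {n : ℕ} (hn : n₀ ≤ n) {κ : ℝ} (hκ : partialSum θ n₀ n t ≤ κ) :
    θ n s ≤ Real.exp (-(c * (n / κ) * (t - s) / 4)) := by
  obtain ⟨m, -, hm⟩ := hd n hn
  have hpos : ∀ x, 0 < partialSum θ n₀ n x := fun x =>
    zero_lt_one.trans_le (one_le_partialSum h0 hn₀ (hn₀.trans_le hn) x)
  have hκ0 : 0 < κ := (hpos t).trans_le hκ
  have := exp_mul_le_of_increments (f := θ n) (a := c * (n / κ)) (m := m) hst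
    (by positivity) (h0 n) (by
      intro x y hx hxy hy
      refine le_trans ?_ (hm x y (hs.trans_le hx) hxy (hy.trans ht))
      have h2 : partialSum θ n₀ n x ≤ κ := (partialSum_mono hmono n (hxy.le.trans hy)).trans hκ
      have h3 : (n : ℝ) / κ ≤ n / partialSum θ n₀ n x :=
        div_le_div_of_nonneg_left (Nat.cast_nonneg _) (hpos x) h2
      have h4 : 0 ≤ y - x := by linarith
      have h5 := h0 n x
      gcongr)
  rw [Real.exp_neg, ← one_div, le_div_iff₀ (Real.exp_pos _), mul_comm]
  exact this.trans (h1 _ _)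

/-- Below the critical point the decay bootstraps, each stage consuming a slice of the parameter
interval: Σ_n ≤ √n, hence θ_n ≤ exp(-q√n), hence Σ_n is bounded, hence θ_n decays exponentially.
Above it, Σ_n grows linearly, so `le_limit_of_frequently` applies with exponent one. -/
theorem sharp {l : ℝ → ℝ} (h0 : ∀ n x, 0 ≤ θ n x) (h1 : ∀ n x, θ n x ≤ 1)
    (hmono : ∀ n, n₀ ≤ n → Monotone (θ n)) (hanti : ∀ x m n, n₀ ≤ m → m ≤ n → θ n x ≤ θ m x)
    (hl : ∀ x, Tendsto (fun n => θ n x) atTop (𝓝 (l x))) (hn₀ : 0 < n₀)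
    (hd : ∀ b, 0 < b → ∃ c, 0 < c ∧ DifferenceInequality θ n₀ b c)
    (hne : {x | 0 < x ∧ 0 < l x}.Nonempty) :
    (∀ s, 0 < s → s < sInf {x | 0 < x ∧ 0 < l x} →
      ∃ κ : ℝ, 0 < κ ∧ ∀ᶠ n : ℕ in atTop, θ n s ≤ Real.exp (-(κ * n))) ∧
    ∃ κ : ℝ, 0 < κ ∧ ∀ᶠ t in 𝓝[>] sInf {x | 0 < x ∧ 0 < l x},
      κ ≤ l t / (t - sInf {x | 0 < x ∧ 0 < l x}) := by
  set xc := sInf {x | 0 < x ∧ 0 < l x} with hxc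
  have hbdd : BddBelow {x | 0 < x ∧ 0 < l x} := ⟨0, fun x hx => hx.1.le⟩
  have hxc0 : 0 ≤ xc := le_csInf hne fun x hx => hx.1.le
  have hl0 : ∀ x, 0 ≤ l x := fun x => ge_of_tendsto' (hl x) fun n => h0 n x
  have hlmono : Monotone l := fun x y hxy =>
    le_of_tendsto_of_tendsto (hl x) (hl y)
      (eventually_atTop.2 ⟨n₀, fun n hn => hmono n hn hxy⟩)
  obtain ⟨c, hc, hD⟩ := hd (xc + 1) (by linarith)
  have hpos : ∀ n x, 0 < n → 0 < partialSum θ n₀ n x := fun n x hn =>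
    zero_lt_one.trans_le (one_le_partialSum h0 hn₀ hn x)
  constructor
  · intro s hs hsx
    obtain ⟨x₁, hsx₁, hx₁⟩ := exists_between hsx
    obtain ⟨x₂, hx₁₂, hx₂⟩ := exists_between hx₁
    obtain ⟨x₃, hx₂₃, hx₃⟩ := exists_between hx₂
    have hl3 : l x₃ = 0 := by
      by_contra hne'
      have : xc ≤ x₃ := csInf_le hbdd ⟨by linarith, lt_of_le_of_ne (hl0 _) (Ne.symm hne')⟩
      linarith
    -- Otherwise Σ_n(x₂) exceeds √n infinitely often, and the exponent γ = 1/2 forces a positive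
    -- limit at `x₃`, which is still below the critical point.
    have hev : ∀ᶠ n : ℕ in atTop, partialSum θ n₀ n x₂ ≤ Real.sqrt n := by
      by_contra hcon
      have hfreq : ∃ᶠ n : ℕ in atTop,
          1 / 2 * Real.log n - 0 ≤ Real.log (partialSum θ n₀ n x₂) := by
        rw [not_eventually] at hcon
        refine (hcon.and_eventually (eventually_gt_atTop 0)).mono ?_
        rintro n ⟨h, hn⟩
        push Not at h
        have hn' : (0 : ℝ) < n := by exact_mod_cast hn
        have := Real.log_le_log (Real.sqrt_pos.2 hn') h.le
        rw [Real.log_sqrt hn'.le] at this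
        linarith
      have := le_limit_of_frequently h0 h1 hmono hanti hn₀ hc.le hD (by linarith) hx₂₃
        (by linarith) (hl x₃) hfreq
      rw [hl3] at this
      have h5 : 0 < c / 2 * (x₃ - x₂) * (1 / 2) := by
        have : 0 < x₃ - x₂ := by linarith
        positivity
      linarith
    obtain ⟨n₁, hn₁⟩ := eventually_atTop.1 hev
    set q := c * (x₂ - x₁) / 4 with hq
    have hq0 : 0 < q := by
      have : 0 < x₂ - x₁ := by linarith
      positivity
    have hdec : ∀ n : ℕ, n₀ ≤ n → n₁ ≤ n → θ n x₁ ≤ 24 / q ^ 4 * (1 / (n : ℝ) ^ 2) := by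
      intro n hn hn'
      have hnpos : (0 : ℝ) < n := by exact_mod_cast hn₀.trans_le hn
      have h2 := le_exp_neg h0 h1 hmono hn₀ hc.le hD (by linarith) hx₁₂ (by linarith) hn
        (hn₁ n hn')
      have h3 : c * (n / Real.sqrt n) * (x₂ - x₁) / 4 = q * Real.sqrt n := by
        rw [Real.div_sqrt, hq]; ring
      rw [h3, Real.exp_neg] at h2
      have hs0 := Real.sqrt_pos.2 hnpos
      -- The bound y⁴/4! ≤ exp y at y = q√n gives a decay of order n⁻², enough for summability; this
      -- is the origin of the constant 24.
      have h4 := Real.pow_div_factorial_le_exp (q * Real.sqrt n) (by positivity) 4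
      have h5 : (q * Real.sqrt n) ^ 4 / (Nat.factorial 4 : ℝ) = q ^ 4 * (n : ℝ) ^ 2 / 24 := by
        have : Real.sqrt n ^ 4 = (n : ℝ) ^ 2 := by
          rw [show (4 : ℕ) = 2 * 2 from rfl, pow_mul, Real.sq_sqrt hnpos.le]
        rw [mul_pow, this]; norm_num [Nat.factorial]
      rw [h5] at h4
      refine h2.trans ((inv_anti₀ (by positivity) h4).trans (le_of_eq ?_))
      field_simp
    have hsum : ∃ κ : ℝ, 0 < κ ∧ ∀ n, partialSum θ n₀ n x₁ ≤ κ := by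
      have hS : Summable fun n : ℕ => 24 / q ^ 4 * (1 / (n : ℝ) ^ 2) :=
        (Real.summable_one_div_nat_pow.2 (by norm_num)).mul_left _
      refine ⟨(max n₀ n₁ : ℕ) + ∑' n : ℕ, 24 / q ^ 4 * (1 / (n : ℝ) ^ 2) + 1, ?_, fun n => ?_⟩
      · have : 0 ≤ ∑' n : ℕ, 24 / q ^ 4 * (1 / (n : ℝ) ^ 2) := tsum_nonneg fun n => by positivity
        positivity
      · have h2 : ∀ k ∈ Finset.range n, padded θ n₀ k x₁ ≤
            (if k < max n₀ n₁ then 1 else 0) + 24 / q ^ 4 * (1 / (k : ℝ) ^ 2) := by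
          intro k _
          have hp : 0 ≤ 24 / q ^ 4 * (1 / (k : ℝ) ^ 2) := by positivity
          split_ifs with hk
          · have : padded θ n₀ k x₁ ≤ 1 := by
              unfold padded; split_ifs
              · exact le_rfl
              · exact h1 _ _
            linarith
          · rw [padded, if_neg (by omega), zero_add]
            exact hdec k (by omega) (by omega)
        refine (Finset.sum_le_sum h2).trans ?_
        rw [Finset.sum_add_distrib]
        have h3 : ∑ k ∈ Finset.range n, (if k < max n₀ n₁ then (1 : ℝ) else 0) ≤
            (max n₀ n₁ : ℕ) := by
          rw [Finset.sum_boole]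
          have : (Finset.filter (fun i => i < max n₀ n₁) (Finset.range n)).card ≤
              (Finset.range (max n₀ n₁)).card :=
            Finset.card_le_card fun i hi => Finset.mem_range.2 (Finset.mem_filter.1 hi).2
          rw [Finset.card_range] at this
          exact_mod_cast this
        have h4 := hS.sum_le_tsum (Finset.range n) fun k _ => by positivity
        linarith
    obtain ⟨κ, hκ0, hκ⟩ := hsum
    refine ⟨c * (x₁ - s) / (4 * κ), ?_, ?_⟩
    · have : 0 < x₁ - s := by linarith
      positivity
    · filter_upwards [eventually_ge_atTop n₀] with n hn
      refine (le_exp_neg h0 h1 hmono hn₀ hc.le hD hs hsx₁ (by linarith) hn (hκ n)).trans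
        (le_of_eq ?_)
      congr 2
      field_simp
  -- The lower bound Σ_n(s) ≥ n l(s) with l(s) > 0 is used at an auxiliary `s`, which is then sent
  -- down to the critical point.
  · have hlin : ∀ s t, xc < s → s < t → t ≤ xc + 1 → c / 2 * (t - s) ≤ l t := by
      intro s t hs hst ht
      obtain ⟨x, hx, hxs⟩ := exists_lt_of_csInf_lt hne hs
      have hls : 0 < l s := hx.2.trans_le (hlmono hxs.le)
      have := le_limit_of_frequently h0 h1 hmono hanti hn₀ hc.le hD (s := s) (t := t)
        (by linarith) hst ht (γ := 1) (C := -Real.log (l s)) (hl t) (Eventually.frequently (by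
          filter_upwards [eventually_gt_atTop 0] with n hn
          have hn' : (0 : ℝ) < n := by exact_mod_cast hn
          have h2 : n * l s ≤ partialSum θ n₀ n s := by
            unfold partialSum
            rw [← nsmul_eq_mul]
            conv_lhs => rw [← Finset.card_range n]
            refine Finset.card_nsmul_le_sum _ _ _ fun k _ => ?_
            unfold padded; split_ifs with hk
            · exact le_of_tendsto' (hl s) fun n => h1 n s
            · refine le_of_tendsto (hl s) ?_
              filter_upwards [eventually_ge_atTop k] with n hn
              exact hanti s k n (by omega) hn
          have h3 := Real.log_le_log (by positivity) h2
          rw [Real.log_mul hn'.ne' hls.ne'] at h3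
          linarith))
      linarith
    refine ⟨c / 2, by linarith, ?_⟩
    have hmem : Ioc xc (xc + 1) ∈ 𝓝[>] xc := Ioc_mem_nhdsGT (by linarith)
    filter_upwards [hmem] with t ht
    rw [le_div_iff₀ (by linarith [ht.1])]
    have htend : Tendsto (fun s => c / 2 * (t - s)) (𝓝[>] xc) (𝓝 (c / 2 * (t - xc))) := by
      refine Tendsto.mono_left ?_ nhdsWithin_le_nhds
      exact (by fun_prop : Continuous fun s : ℝ => c / 2 * (t - s)).tendsto xc
    refine le_of_tendsto htend ?_
    filter_upwards [Ioo_mem_nhdsGT ht.1] with s hs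
    exact hlin s t hs.1 hs.2 ht.2

end SharpThreshold

/-! ### Increasing events of independent Poisson variables -/

namespace MeasureTheory

/-- A product law is obtained by drawing coordinate `i` separately; the other law need only agree
away from `i`, so the mean of a single count can be changed. -/
theorem measurePreserving_update_infinitePi {ι : Type*} [DecidableEq ι] {X : ι → Type*}
    [∀ i, MeasurableSpace (X i)] (μ μ' : ∀ i, Measure (X i)) [∀ i, IsProbabilityMeasure (μ i)]
    [∀ i, IsProbabilityMeasure (μ' i)] (i : ι) (h : ∀ j, j ≠ i → μ j = μ' j) :
    MeasurePreserving (fun p : X i × ∀ j, X j => Function.update p.2 i p.1)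
      ((μ i).prod (Measure.infinitePi μ')) (Measure.infinitePi μ) := by
  have hmeas : Measurable (fun p : X i × ∀ j, X j => Function.update p.2 i p.1) := by
    refine measurable_pi_lambda _ fun j => ?_
    rcases eq_or_ne j i with rfl | hj
    · simpa using measurable_fst
    · simp only [Function.update_of_ne hj]; fun_prop
  refine ⟨hmeas, Measure.eq_infinitePi _ fun s t ht => ?_⟩
  rw [Measure.map_apply hmeas (.pi s.countable_toSet fun j _ => ht j)]
  have : (fun p : X i × ∀ j, X j => Function.update p.2 i p.1) ⁻¹' ((s : Set ι).pi t) =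
      (if i ∈ s then t i else univ) ×ˢ (((s.erase i : Finset ι) : Set ι).pi t) := by
    ext p
    simp only [mem_preimage, Set.mem_pi, Finset.mem_coe, mem_prod, Finset.mem_erase]
    constructor
    · intro hp
      refine ⟨?_, fun j hj => by simpa [hj.1] using hp j hj.2⟩
      split_ifs with his
      · simpa using hp i his
      · trivial
    · rintro ⟨h1, h2⟩ j hj
      rcases eq_or_ne j i with rfl | hji
      · simpa [hj] using h1
      · simpa [hji] using h2 j ⟨hji, hj⟩
  rw [this, Measure.prod_prod, Measure.infinitePi_pi _ fun j _ => ht j]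
  have h2 : ∏ j ∈ s.erase i, μ' j (t j) = ∏ j ∈ s.erase i, μ j (t j) :=
    Finset.prod_congr rfl fun j hj => by rw [h j (Finset.ne_of_mem_erase hj)]
  rw [h2]
  split_ifs with his
  · exact Finset.mul_prod_erase s (fun j => μ j (t j)) his
  · rw [measure_univ, one_mul, Finset.erase_eq_of_notMem his]

theorem infinitePi_congr_of_dependsOn {ι : Type*} {X : ι → Type*}
    [∀ i, MeasurableSpace (X i)] (μ μ' : ∀ i, Measure (X i)) [∀ i, IsProbabilityMeasure (μ i)]
    [∀ i, IsProbabilityMeasure (μ' i)] (s : Finset ι) (h : ∀ i ∈ s, μ i = μ' i)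
    {C : Set (∀ i, X i)} (hC : MeasurableSet C)
    (hdep : ∀ x y : ∀ i, X i, (∀ i ∈ s, x i = y i) → (x ∈ C ↔ y ∈ C)) :
    Measure.infinitePi μ C = Measure.infinitePi μ' C := by
  classical
  rcases isEmpty_or_nonempty (∀ i, X i) with hE | ⟨⟨x₀⟩⟩
  · rw [Set.eq_empty_of_isEmpty C, measure_empty, measure_empty]
  let ext : (∀ i : s, X i) → ∀ i, X i := fun x i => if hi : i ∈ s then x ⟨i, hi⟩ else x₀ i
  have hext : Measurable ext := by
    refine measurable_pi_lambda _ fun i => ?_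
    by_cases hi : i ∈ s
    · simp only [ext, hi, dite_true]; fun_prop
    · simp only [ext, hi, dite_false]; fun_prop
  have hpre : C = s.restrict ⁻¹' (ext ⁻¹' C) := by
    ext x
    exact hdep _ _ fun i hi => by simp [ext, hi]
  have hr : Measurable (s.restrict (π := X)) := Finset.measurable_restrict s
  rw [hpre, ← Measure.map_apply hr (hext hC), ← Measure.map_apply hr (hext hC),
    Measure.infinitePi_map_restrict, Measure.infinitePi_map_restrict]
  congr 2
  funext i
  exact h i i.2

end MeasureTheory

namespace PoissonCounts

/-- The probability that a Poisson variable of mean `s` is less than `L`. -/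
noncomputable def lowerTail (L : ℕ) (s : ℝ) : ℝ :=
  ∑ n ∈ Finset.range L, Real.exp (-s) * s ^ n / n.factorial

/-- The derivatives of the Poisson weights telescope and only the last one survives. -/
theorem hasDerivAt_lowerTail (L : ℕ) (s : ℝ) :
    HasDerivAt (lowerTail (L + 1)) (-(Real.exp (-s) * s ^ L / L.factorial)) s := by
  have hexp : HasDerivAt (fun s : ℝ => Real.exp (-s)) (-Real.exp (-s)) s := by
    simpa using (hasDerivAt_neg s).exp
  induction L with
  | zero =>
    have : lowerTail (0 + 1) = fun s => Real.exp (-s) := by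
      funext s; simp [lowerTail]
    rw [this]
    simpa using hexp
  | succ L ih =>
    have : lowerTail (L + 1 + 1) = fun s => lowerTail (L + 1) s +
        Real.exp (-s) * s ^ (L + 1) / (L + 1).factorial := by
      funext s; rw [lowerTail, Finset.sum_range_succ]; rfl
    rw [this]
    refine (ih.add ((hexp.mul (hasDerivAt_pow (L + 1) s)).div_const _)).congr_deriv ?_
    rw [Nat.factorial_succ]
    have h1 : (L.factorial : ℝ) ≠ 0 := by positivity
    have h2 : ((L : ℝ) + 1) ≠ 0 := by positivity
    push_cast
    field_simp
    simp

theorem lowerTail_zero (L : ℕ) : lowerTail (L + 1) 0 = 1 := by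
  simp [lowerTail, Finset.sum_range_succ']

theorem one_sub_lowerTail_le (L : ℕ) {s : ℝ} (hs : 0 ≤ s) :
    1 - lowerTail (L + 1) s ≤ s ^ (L + 1) / L.factorial := by
  let φ : ℝ → ℝ := fun s => s ^ (L + 1) / L.factorial + lowerTail (L + 1) s
  have hφ : ∀ s, HasDerivAt φ (((L + 1 : ℕ) : ℝ) * s ^ L / L.factorial +
      -(Real.exp (-s) * s ^ L / L.factorial)) s := fun s =>
    ((hasDerivAt_pow (L + 1) s).div_const _).add (hasDerivAt_lowerTail L s)
  have hmono : MonotoneOn φ (Ici 0) := by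
    refine monotoneOn_of_deriv_nonneg (convex_Ici 0)
      (fun s _ => (hφ s).continuousAt.continuousWithinAt)
      (fun s _ => (hφ s).differentiableAt.differentiableWithinAt) fun s hs => ?_
    rw [interior_Ici] at hs
    rw [(hφ s).deriv, ← sub_eq_add_neg, ← sub_div]
    have h1 : Real.exp (-s) ≤ 1 := Real.exp_le_one_iff.2 (by linarith [mem_Ioi.1 hs])
    have h2 : 0 ≤ s ^ L := pow_nonneg (mem_Ioi.1 hs).le _
    have h3 : (1 : ℝ) ≤ ((L + 1 : ℕ) : ℝ) := by exact_mod_cast Nat.succ_pos L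
    refine div_nonneg ?_ (by positivity)
    nlinarith
  have := hmono (mem_Ici.2 le_rfl) (mem_Ici.2 hs) hs
  simp only [φ, lowerTail_zero] at this
  simp at this
  linarith

/-- The density at x in [s, t] is at least exp(-t) s^L / L!, and by `one_sub_lowerTail_le` this is
at least exp(-t) / s times the upper tail at `s`. The tail is thus compared with itself, uniformly
in `L`. -/
theorem lowerTail_sub_le (L : ℕ) {s t : ℝ} (hs : 0 < s) (hst : s ≤ t) :
    (t - s) * Real.exp (-t) * s⁻¹ * (1 - lowerTail (L + 1) s) ≤
      lowerTail (L + 1) s - lowerTail (L + 1) t := by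
  set κ := Real.exp (-t) * s ^ L / L.factorial with hκ
  let ψ : ℝ → ℝ := fun x => -lowerTail (L + 1) x - κ * x
  have hψ : ∀ x, HasDerivAt ψ (-(-(Real.exp (-x) * x ^ L / L.factorial)) - κ * 1) x := fun x =>
    (hasDerivAt_lowerTail L x).neg.sub ((hasDerivAt_id x).const_mul κ)
  have hmono : MonotoneOn ψ (Icc s t) := by
    refine monotoneOn_of_deriv_nonneg (convex_Icc s t)
      (fun x _ => (hψ x).continuousAt.continuousWithinAt)
      (fun x _ => (hψ x).differentiableAt.differentiableWithinAt) fun x hx => ?_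
    rw [interior_Icc] at hx
    rw [(hψ x).deriv, neg_neg, mul_one, sub_nonneg, hκ]
    have h1 : Real.exp (-t) ≤ Real.exp (-x) := Real.exp_le_exp.2 (by linarith [hx.2])
    have h2 : s ^ L ≤ x ^ L := pow_le_pow_left₀ hs.le hx.1.le L
    gcongr
  have h1 := hmono (left_mem_Icc.2 hst) (right_mem_Icc.2 hst) hst
  simp only [ψ] at h1
  have h2 := one_sub_lowerTail_le L hs.le
  have h3 : (t - s) * Real.exp (-t) * s⁻¹ * (1 - lowerTail (L + 1) s) ≤
      (t - s) * Real.exp (-t) * s⁻¹ * (s ^ (L + 1) / L.factorial) :=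
    mul_le_mul_of_nonneg_left h2 (mul_nonneg (mul_nonneg (by linarith) (Real.exp_pos _).le)
      (by positivity))
  have h4 : (t - s) * Real.exp (-t) * s⁻¹ * (s ^ (L + 1) / L.factorial) = κ * (t - s) := by
    rw [hκ, pow_succ]; field_simp
  linarith

theorem poissonMeasure_real_Iio (s : ℝ≥0) (L : ℕ) :
    (poissonMeasure s).real (Iio L) = lowerTail L s := by
  have : (Iio L : Set ℕ) = ((Finset.range L : Finset ℕ) : Set ℕ) := by ext; simp
  rw [this, ← sum_measureReal_singleton]
  exact Finset.sum_congr rfl fun n _ => poissonMeasure_real_singleton s n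

theorem poissonMeasure_upperSet_add_le {s t : ℝ≥0} (hs : 0 < s) (hst : s ≤ t) {C : Set ℕ}
    (hC : IsUpperSet C) (h0 : 0 ∉ C) :
    poissonMeasure s C + ENNReal.ofReal ((t - s) * Real.exp (-t) * (s : ℝ)⁻¹) *
      poissonMeasure s C ≤ poissonMeasure t C := by
  classical
  rcases C.eq_empty_or_nonempty with rfl | hne
  · simp
  set L := sInf C with hL
  have hLC : L ∈ C := Nat.sInf_mem hne
  have hCL : C = (Iio L)ᶜ := by
    ext n
    simp only [mem_compl_iff, mem_Iio, not_lt]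
    exact ⟨fun h => Nat.sInf_le h, fun h => hC h hLC⟩
  obtain ⟨k, hk⟩ : ∃ k, L = k + 1 := Nat.exists_eq_succ_of_ne_zero fun h => h0 (h ▸ hLC)
  have hr : ∀ u : ℝ≥0, poissonMeasure u C = ENNReal.ofReal (1 - lowerTail (k + 1) u) := by
    intro u
    rw [hCL, ← ofReal_measureReal, measureReal_compl measurableSet_Iio, probReal_univ,
      poissonMeasure_real_Iio, hk]
  have hnn : 0 ≤ 1 - lowerTail (k + 1) s := by
    rw [← poissonMeasure_real_Iio, sub_nonneg]; exact measureReal_le_one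
  have hst' : (s : ℝ) ≤ t := by exact_mod_cast hst
  have hκ : 0 ≤ ((t : ℝ) - s) * Real.exp (-t) * (s : ℝ)⁻¹ :=
    mul_nonneg (mul_nonneg (by linarith) (Real.exp_pos _).le) (by positivity)
  rw [hr, hr, ← ENNReal.ofReal_mul hκ, ← ENNReal.ofReal_add hnn (mul_nonneg hκ hnn)]
  refine ENNReal.ofReal_le_ofReal ?_
  have := lowerTail_sub_le k (s := s) (t := t) (by exact_mod_cast hs) hst'
  linarith

/-- The Poisson weights compare term by term, so no monotonicity of `C` is needed. It will be
applied to pivotal events, which need not be increasing. -/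
theorem poissonMeasure_mono_of_le {s t : ℝ≥0} (hst : s ≤ t) (C : Set ℕ) :
    ENNReal.ofReal (Real.exp (-(t - s))) * poissonMeasure s C ≤ poissonMeasure t C := by
  have key : ENNReal.ofReal (Real.exp (-(t - s))) • poissonMeasure s ≤ poissonMeasure t := by
    refine Measure.le_iff.2 fun D hD => ?_
    rw [← D.biUnion_of_singleton, measure_biUnion D.to_countable
      (fun a _ b _ hab => by simpa using hab) (fun _ _ => .singleton _),
      measure_biUnion D.to_countable
      (fun a _ b _ hab => by simpa using hab) (fun _ _ => .singleton _)]
    refine ENNReal.tsum_le_tsum fun n => ?_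
    rw [Measure.smul_apply, smul_eq_mul, poissonMeasure_singleton, poissonMeasure_singleton,
      ← ENNReal.ofReal_mul (Real.exp_pos _).le]
    refine ENNReal.ofReal_le_ofReal ?_
    have h1 : Real.exp (-(t - s)) * (Real.exp (-s) * s ^ (n : ℕ) / (n : ℕ).factorial) =
        Real.exp (-t) * s ^ (n : ℕ) / (n : ℕ).factorial := by
      rw [mul_div_assoc', ← mul_assoc, ← Real.exp_add]; ring_nf
    rw [h1]
    gcongr
  exact key C

theorem poissonMeasure_upperSet_mono {s t : ℝ≥0} (hst : s ≤ t) {C : Set ℕ}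
    (hC : IsUpperSet C) : poissonMeasure s C ≤ poissonMeasure t C := by
  by_cases h0 : 0 ∈ C
  · have : C = univ := eq_univ_of_forall fun n => hC (Nat.zero_le n) h0
    simp [this]
  · rcases eq_or_lt_of_le (show 0 ≤ s from zero_le) with rfl | hs
    · have h1 : poissonMeasure 0 C ≤ poissonMeasure 0 {0}ᶜ :=
        measure_mono fun n hn h => h0 (by simpa [mem_singleton_iff.1 h] using hn)
      have h2 : poissonMeasure 0 ({0}ᶜ : Set ℕ) = 0 := by
        rw [prob_compl_eq_zero_iff (.singleton _), poissonMeasure_singleton]; simp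
      rw [h2] at h1
      exact h1.trans zero_le
    · exact le_self_add.trans (poissonMeasure_upperSet_add_le hs hst hC h0)

/-! ### Pivotal counts in products of Poisson laws -/

variable {ι : Type*}

/-- The law of independent Poisson variables with means `Λ i`. -/
noncomputable def law (Λ : ι → ℝ≥0) : Measure (ι → ℕ) :=
  Measure.infinitePi fun i => poissonMeasure (Λ i)

instance (Λ : ι → ℝ≥0) : IsProbabilityMeasure (law Λ) := by
  unfold law; infer_instance

open scoped Classical in
/-- The counts with those in `T` replaced by `0`. -/
noncomputable def clear (T : Finset ι) (n : ι → ℕ) : ι → ℕ := fun i => if i ∈ T then 0 else n i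

theorem clear_empty (n : ι → ℕ) : clear ∅ n = n := by
  funext i; simp [clear]

section

variable [DecidableEq ι]

theorem clear_insert (T : Finset ι) (i : ι) (n : ι → ℕ) :
    clear (insert i T) n = Function.update (clear T n) i 0 := by
  funext j
  rcases eq_or_ne j i with rfl | hj
  · simp [clear]
  · simp [clear, hj]

theorem measurable_update_zero (i : ι) : Measurable fun n : ι → ℕ => Function.update n i 0 :=
  measurable_update_left

theorem measurePreserving_update (Λ : ι → ℝ≥0) (i : ι) (t : ℝ≥0) :
    MeasurePreserving (fun p : ℕ × (ι → ℕ) => Function.update p.2 i p.1)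
      ((poissonMeasure t).prod (law Λ)) (law (Function.update Λ i t)) := by
  have := measurePreserving_update_infinitePi (X := fun _ : ι => ℕ)
    (fun j => poissonMeasure (Function.update Λ i t j)) (fun j => poissonMeasure (Λ j)) i
    fun j hj => by rw [Function.update_of_ne hj]
  rw [Function.update_self] at this
  exact this

/-- Integrating out one count. -/
theorem law_update_apply (Λ : ι → ℝ≥0) (i : ι) (t : ℝ≥0) {C : Set (ι → ℕ)}
    (hC : MeasurableSet C) :
    law (Function.update Λ i t) C =
      ∫⁻ n, poissonMeasure t {m | Function.update n i m ∈ C} ∂law Λ := by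
  have h := measurePreserving_update Λ i t
  rw [← h.measure_preimage hC.nullMeasurableSet, Measure.prod_apply_symm (h.measurable hC)]
  rfl

theorem law_apply (Λ : ι → ℝ≥0) (i : ι) {C : Set (ι → ℕ)} (hC : MeasurableSet C) :
    law Λ C = ∫⁻ n, poissonMeasure (Λ i) {m | Function.update n i m ∈ C} ∂law Λ := by
  rw [← law_update_apply Λ i (Λ i) hC, Function.update_eq_self]

/-- A finite energy estimate: the count at `i` vanishes with probability exp(-Λ i), independently of
the others. -/
theorem law_update_zero_le (Λ : ι → ℝ≥0) (i : ι) {C : Set (ι → ℕ)} (hC : MeasurableSet C) :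
    law Λ {n | Function.update n i 0 ∈ C} ≤ ENNReal.ofReal (Real.exp (Λ i)) * law Λ C := by
  have h1 : ENNReal.ofReal (Real.exp (-Λ i)) * law Λ {n | Function.update n i 0 ∈ C} ≤
      law Λ C := by
    rw [law_apply Λ i hC, ← lintegral_indicator_one
      (show MeasurableSet {n | Function.update n i 0 ∈ C} from measurable_update_zero i hC),
      ← lintegral_const_mul' _ _ ENNReal.ofReal_ne_top]
    refine lintegral_mono fun n => ?_
    by_cases hn : Function.update n i 0 ∈ C
    · rw [indicator_of_mem (by exact hn), Pi.one_apply, mul_one]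
      have : poissonMeasure (Λ i) {0} = ENNReal.ofReal (Real.exp (-Λ i)) := by
        rw [poissonMeasure_singleton]; simp
      rw [← this]
      exact measure_mono fun m hm => by rw [mem_singleton_iff.1 hm]; exact hn
    · rw [indicator_of_notMem (by exact hn), mul_zero]
      exact zero_le
  calc law Λ {n | Function.update n i 0 ∈ C}
      = ENNReal.ofReal (Real.exp (Λ i)) * (ENNReal.ofReal (Real.exp (-Λ i)) *
        law Λ {n | Function.update n i 0 ∈ C}) := by
        rw [← mul_assoc, ← ENNReal.ofReal_mul (Real.exp_pos _).le, ← Real.exp_add]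
        simp
    _ ≤ _ := by gcongr

theorem law_clear_le (s : ℝ≥0) (T : Finset ι) {C : Set (ι → ℕ)} (hC : MeasurableSet C) :
    law (fun _ => s) {n | clear T n ∈ C} ≤
      ENNReal.ofReal (Real.exp (T.card * s)) * law (fun _ => s) C := by
  induction T using Finset.induction_on generalizing C with
  | empty => simp [clear_empty]
  | insert i T hi ih =>
    have h1 : {n | clear (insert i T) n ∈ C} = {n | clear T n ∈ {n | Function.update n i 0 ∈ C}} := by
      ext n; simp [clear_insert]
    rw [h1]
    refine (ih (measurable_update_zero i hC)).trans ?_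
    refine (mul_le_mul_right (law_update_zero_le _ i hC) _).trans (le_of_eq ?_)
    rw [← mul_assoc, ← ENNReal.ofReal_mul (Real.exp_pos _).le, ← Real.exp_add,
      Finset.card_insert_of_notMem hi]
    push_cast
    ring_nf

/-- The event that the count at `i` is essential for `C`. -/
def pivotal (C : Set (ι → ℕ)) (i : ι) : Set (ι → ℕ) := {n | n ∈ C ∧ Function.update n i 0 ∉ C}

theorem measurableSet_pivotal {C : Set (ι → ℕ)} (hC : MeasurableSet C) (i : ι) :
    MeasurableSet (pivotal C i) := hC.inter (measurable_update_zero i hC).compl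

/-- Set the counts in `T` to zero one by one. If this destroys `C`, some count is pivotal at its
turn for the partially cleared configuration, and `law_clear_le` bounds the cost of that clearing.
-/
theorem law_mem_and_clear_notMem_le (s : ℝ≥0) (T : Finset ι) {C : Set (ι → ℕ)}
    (hC : MeasurableSet C) :
    law (fun _ => s) {n | n ∈ C ∧ clear T n ∉ C} ≤
      ENNReal.ofReal (Real.exp (T.card * s)) * ∑ i ∈ T, law (fun _ => s) (pivotal C i) := by
  induction T using Finset.induction_on with
  | empty =>
    have : {n | n ∈ C ∧ clear ∅ n ∉ C} = ∅ := by
      ext n; simp [clear_empty]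
    simp [this]
  | insert i T hi ih =>
    have hsub : {n | n ∈ C ∧ clear (insert i T) n ∉ C} ⊆
        {n | n ∈ C ∧ clear T n ∉ C} ∪ {n | clear T n ∈ pivotal C i} := by
      rintro n ⟨h1, h2⟩
      by_cases h3 : clear T n ∈ C
      · exact Or.inr ⟨h3, by rwa [← clear_insert]⟩
      · exact Or.inl ⟨h1, h3⟩
    refine (measure_mono hsub).trans ((measure_union_le _ _).trans ?_)
    rw [Finset.sum_insert hi, mul_add, add_comm]
    have hle : ENNReal.ofReal (Real.exp (T.card * s)) ≤
        ENNReal.ofReal (Real.exp ((insert i T).card * s)) := by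
      refine ENNReal.ofReal_le_ofReal (Real.exp_le_exp.2 ?_)
      gcongr
      exact Finset.subset_insert _ _
    exact add_le_add ((law_clear_le s T (measurableSet_pivotal hC i)).trans
      (mul_le_mul_left hle _)) (ih.trans (mul_le_mul_left hle _))

theorem isUpperSet_section {C : Set (ι → ℕ)} (hC : IsUpperSet C) (n : ι → ℕ) (i : ι) :
    IsUpperSet {m | Function.update n i m ∈ C} := fun _ _ hab h =>
  hC (update_le_update_iff.2 ⟨hab, fun _ _ => le_rfl⟩) h

/-- Fix all other counts. If the section of `C` contains zero, `i` is not pivotal and monotonicity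
suffices; otherwise the sections of `C` and of the pivotal event coincide and the one-variable
inequality applies. -/
theorem law_add_pivotal_le (Λ : ι → ℝ≥0) (i : ι) {t : ℝ≥0} (h0 : 0 < Λ i) (ht : Λ i ≤ t)
    {C : Set (ι → ℕ)} (hC : MeasurableSet C) (hup : IsUpperSet C) :
    law Λ C + ENNReal.ofReal ((t - Λ i) * Real.exp (-t) * (Λ i : ℝ)⁻¹) * law Λ (pivotal C i) ≤
      law (Function.update Λ i t) C := by
  have hmeas : Measurable fun n => poissonMeasure (Λ i) {m | Function.update n i m ∈ C} :=
    measurable_measure_prodMk_right ((measurePreserving_update Λ i t).measurable hC)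
  rw [law_update_apply Λ i t hC, law_apply Λ i hC,
    law_apply Λ i (measurableSet_pivotal hC i), ← lintegral_const_mul' _ _ ENNReal.ofReal_ne_top,
    ← lintegral_add_left hmeas]
  refine lintegral_mono fun n => ?_
  have hup' := isUpperSet_section hup n i
  by_cases hn : Function.update n i 0 ∈ C
  · have : {m | Function.update n i m ∈ pivotal C i} = ∅ := by
      ext m; simp [pivotal, hn]
    simp only [this, measure_empty, mul_zero, add_zero]
    exact poissonMeasure_upperSet_mono ht hup'
  · have : {m | Function.update n i m ∈ pivotal C i} = {m | Function.update n i m ∈ C} := by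
      ext m; simp [pivotal, hn]
    rw [this]
    exact poissonMeasure_upperSet_add_le h0 ht hup' hn

theorem exp_mul_law_le (Λ : ι → ℝ≥0) (i : ι) {t : ℝ≥0} (ht : Λ i ≤ t) {C : Set (ι → ℕ)}
    (hC : MeasurableSet C) :
    ENNReal.ofReal (Real.exp (-(t - Λ i))) * law Λ C ≤ law (Function.update Λ i t) C := by
  rw [law_update_apply Λ i t hC, law_apply Λ i hC, ← lintegral_const_mul' _ _ ENNReal.ofReal_ne_top]
  exact lintegral_mono fun n => poissonMeasure_mono_of_le ht _

/-- Raising the means of the counts in `S` from `s` to `t`. -/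
def raise (s t : ℝ≥0) (S : Finset ι) : ι → ℝ≥0 := fun i => if i ∈ S then t else s

theorem raise_empty (s t : ℝ≥0) : raise s t (∅ : Finset ι) = fun _ => s := by
  funext i; simp [raise]

theorem raise_insert (s t : ℝ≥0) (S : Finset ι) (i : ι) :
    raise s t (insert i S) = Function.update (raise s t S) i t := by
  funext j
  rcases eq_or_ne j i with rfl | hj
  · simp [raise]
  · simp [raise, hj]

theorem law_le_law_raise {s t : ℝ≥0} (hst : s ≤ t) (S : Finset ι) {C : Set (ι → ℕ)}
    (hC : MeasurableSet C) (hup : IsUpperSet C) :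
    law (fun _ => s) C ≤ law (raise s t S) C := by
  induction S using Finset.induction_on with
  | empty => simp [raise_empty]
  | insert i S hi ih =>
    refine ih.trans ?_
    rw [raise_insert, law_update_apply _ i t hC, law_apply _ i hC]
    refine lintegral_mono fun n => poissonMeasure_upperSet_mono ?_ (isUpperSet_section hup n i)
    simpa [raise, hi] using hst

theorem exp_mul_law_le_raise {s t : ℝ≥0} (hst : s ≤ t) (S : Finset ι) {C : Set (ι → ℕ)}
    (hC : MeasurableSet C) :
    ENNReal.ofReal (Real.exp (-(S.card * (t - s)))) * law (fun _ => s) C ≤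
      law (raise s t S) C := by
  induction S using Finset.induction_on with
  | empty => simp [raise_empty]
  | insert i S hi ih =>
    rw [raise_insert]
    have h1 := exp_mul_law_le (raise s t S) i (t := t) (by simpa [raise, hi] using hst) hC
    have h2 : raise s t S i = s := by simp [raise, hi]
    rw [h2] at h1
    refine le_trans (le_of_eq ?_) ((mul_le_mul_right ih _).trans h1)
    rw [← mul_assoc, ← ENNReal.ofReal_mul (Real.exp_pos _).le, ← Real.exp_add,
      Finset.card_insert_of_notMem hi]
    push_cast
    ring_nf

/-- A Russo inequality in finite difference form. The means are raised one at a time; the raises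
already made reduce the probability of the next pivotal event by at most exp(-|S|(t - s)). This
factor is the source of the rate `m` in `DifferenceInequality`. -/
theorem law_add_sum_pivotal_le {s t : ℝ≥0} (hs : 0 < s) (hst : s ≤ t) (S : Finset ι)
    {C : Set (ι → ℕ)} (hC : MeasurableSet C) (hup : IsUpperSet C) :
    law (fun _ => s) C + ENNReal.ofReal ((t - s) * Real.exp (-t) * (s : ℝ)⁻¹ *
        Real.exp (-(S.card * (t - s)))) * ∑ i ∈ S, law (fun _ => s) (pivotal C i) ≤
      law (raise s t S) C := by
  have hst' : (s : ℝ) ≤ t := by exact_mod_cast hst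
  have hκ : 0 ≤ ((t : ℝ) - s) * Real.exp (-t) * (s : ℝ)⁻¹ :=
    mul_nonneg (mul_nonneg (by linarith) (Real.exp_pos _).le) (by positivity)
  induction S using Finset.induction_on with
  | empty => simp [raise_empty]
  | insert i S hi ih =>
    rw [raise_insert]
    have h2 : raise s t S i = s := by simp [raise, hi]
    have h1 := law_add_pivotal_le (raise s t S) i (t := t) (by rw [h2]; exact hs)
      (by rw [h2]; exact hst) hC hup
    rw [h2] at h1
    refine le_trans ?_ h1
    have hle : Real.exp (-((insert i S).card * (t - s))) ≤ Real.exp (-(S.card * (t - s))) := by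
      refine Real.exp_le_exp.2 (neg_le_neg ?_)
      refine mul_le_mul_of_nonneg_right ?_ (by linarith)
      exact_mod_cast Finset.card_le_card (Finset.subset_insert _ _)
    rw [Finset.sum_insert hi, mul_add, add_comm (_ * law (fun _ => s) (pivotal C i)), ← add_assoc]
    refine add_le_add (le_trans ?_ ih) ?_
    · gcongr
    · rw [ENNReal.ofReal_mul hκ, mul_assoc]
      gcongr
      refine le_trans ?_ (exp_mul_law_le_raise hst S (measurableSet_pivotal hC i))
      gcongr

end

theorem law_raise_eq [DecidableEq ι] (s t : ℝ≥0) (S : Finset ι) {C : Set (ι → ℕ)}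
    (hC : MeasurableSet C)
    (hdep : ∀ x y : ι → ℕ, (∀ i ∈ S, x i = y i) → (x ∈ C ↔ y ∈ C)) :
    law (raise s t S) C = law (fun _ => t) C :=
  infinitePi_congr_of_dependsOn _ _ S (fun i hi => by simp [raise, hi]) hC hdep

/-- A differential inequality, in integrated form, for increasing events of iid Poisson
variables. -/
theorem law_add_sum_clear_le {I : Type*} {s t : ℝ≥0} (hs : 0 < s) (hst : s ≤ t) (S : Finset ι)
    {C : Set (ι → ℕ)} (hC : MeasurableSet C) (hup : IsUpperSet C)
    (hdep : ∀ x y : ι → ℕ, (∀ i ∈ S, x i = y i) → (x ∈ C ↔ y ∈ C)) (F : Finset I)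
    (T : I → Finset ι) (hT : ∀ e ∈ F, T e ⊆ S) {m r : ℕ} (hm : ∀ e ∈ F, (T e).card ≤ m)
    (hr : ∀ i ∈ S, {e ∈ (F : Set I) | i ∈ T e}.ncard ≤ r) (hr0 : 0 < r) :
    law (fun _ => s) C + ENNReal.ofReal ((t - s) * Real.exp (-t) * (s : ℝ)⁻¹ *
        Real.exp (-(S.card * (t - s))) * (Real.exp (-(m * s)) / r)) *
        ∑ e ∈ F, law (fun _ => s) {n | n ∈ C ∧ clear (T e) n ∉ C} ≤
      law (fun _ => t) C := by
  classical
  rw [← law_raise_eq s t S hC hdep]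
  refine le_trans ?_ (law_add_sum_pivotal_le hs hst S hC hup)
  have hst' : (s : ℝ) ≤ t := by exact_mod_cast hst
  have hκ : 0 ≤ ((t : ℝ) - s) * Real.exp (-t) * (s : ℝ)⁻¹ * Real.exp (-(S.card * (t - s))) :=
    mul_nonneg (mul_nonneg (mul_nonneg (by linarith) (Real.exp_pos _).le) (by positivity))
      (Real.exp_pos _).le
  have hr' : (0 : ℝ) < r := by exact_mod_cast hr0
  rw [ENNReal.ofReal_mul hκ, mul_assoc]
  gcongr
  have h1 : ∑ e ∈ F, law (fun _ => s) {n | n ∈ C ∧ clear (T e) n ∉ C} ≤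
      ENNReal.ofReal (Real.exp (m * s)) *
        ∑ e ∈ F, ∑ i ∈ T e, law (fun _ => s) (pivotal C i) := by
    rw [Finset.mul_sum]
    refine Finset.sum_le_sum fun e he => (law_mem_and_clear_notMem_le s (T e) hC).trans ?_
    gcongr
    exact hm e he
  -- Double counting: each `i` lies in at most `r` of the sets `T e`.
  have h2 : ∑ e ∈ F, ∑ i ∈ T e, law (fun _ => s) (pivotal C i) ≤
      r * ∑ i ∈ S, law (fun _ => s) (pivotal C i) := by
    have : ∀ e ∈ F, ∑ i ∈ T e, law (fun _ => s) (pivotal C i) =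
        ∑ i ∈ S, if i ∈ T e then law (fun _ => s) (pivotal C i) else 0 := by
      intro e he
      rw [← Finset.sum_filter]
      refine Finset.sum_congr ?_ fun _ _ => rfl
      ext i
      simpa using fun hi => hT e he hi
    rw [Finset.sum_congr rfl this, Finset.sum_comm, Finset.mul_sum]
    refine Finset.sum_le_sum fun i hi => ?_
    rw [← Finset.sum_filter, Finset.sum_const, nsmul_eq_mul]
    gcongr
    have h3 := hr i hi
    have h4 : {e ∈ (F : Set I) | i ∈ T e} = ((F.filter fun e => i ∈ T e : Finset I) : Set I) := by
      ext e; simp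
    rwa [h4, Set.ncard_coe_finset] at h3
  refine (mul_le_mul_right (h1.trans (mul_le_mul_right h2 _)) _).trans (le_of_eq ?_)
  rw [← mul_assoc, ← mul_assoc, ← ENNReal.ofReal_mul (by positivity),
    show (r : ℝ≥0∞) = ENNReal.ofReal r by simp, ← ENNReal.ofReal_mul (by positivity)]
  have : Real.exp (-(m * s)) / r * Real.exp (m * s) * r = 1 := by
    rw [Real.exp_neg]
    have := (Real.exp_pos (m * s)).ne'
    field_simp
  rw [this, ENNReal.ofReal_one, one_mul]

end PoissonCounts

noncomputable section

namespace CoxPercolation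

/-! ### Chains of overlapping balls -/

section Link

variable {d : ℕ}

/-- Two points of `X` whose balls overlap. -/
def Step (X : Set (EuclideanSpace ℝ (Fin d))) (x y : EuclideanSpace ℝ (Fin d)) : Prop :=
  x ∈ X ∧ y ∈ X ∧ dist x y < 1

/-- A chain of overlapping balls around points of `X` leads from `A` to `B`. -/
def Link (X A B : Set (EuclideanSpace ℝ (Fin d))) : Prop :=
  ∃ x ∈ X, ∃ y ∈ X, x ∈ Metric.thickening (1 / 2) A ∧ y ∈ Metric.thickening (1 / 2) B ∧
    Relation.ReflTransGen (Step X) x y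

theorem Step.mono {X X' : Set (EuclideanSpace ℝ (Fin d))} (h : X ⊆ X')
    {x y : EuclideanSpace ℝ (Fin d)} (hs : Step X x y) : Step X' x y :=
  ⟨h hs.1, h hs.2.1, hs.2.2⟩

theorem Step.symm {X : Set (EuclideanSpace ℝ (Fin d))} {x y : EuclideanSpace ℝ (Fin d)}
    (hs : Step X x y) : Step X y x :=
  ⟨hs.2.1, hs.1, by rw [dist_comm]; exact hs.2.2⟩

theorem chain_symm {X : Set (EuclideanSpace ℝ (Fin d))} {x y : EuclideanSpace ℝ (Fin d)}
    (h : Relation.ReflTransGen (Step X) x y) : Relation.ReflTransGen (Step X) y x := by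
  induction h with
  | refl => exact .refl
  | tail _ hs ih => exact .head hs.symm ih

theorem chain_mono {X X' : Set (EuclideanSpace ℝ (Fin d))} (h : X ⊆ X')
    {x y : EuclideanSpace ℝ (Fin d)} (hc : Relation.ReflTransGen (Step X) x y) :
    Relation.ReflTransGen (Step X') x y :=
  hc.lift id fun _ _ => Step.mono h

theorem Link.mono {X X' A B : Set (EuclideanSpace ℝ (Fin d))} (h : X ⊆ X') (hl : Link X A B) :
    Link X' A B := by
  obtain ⟨x, hx, y, hy, hxA, hyB, hc⟩ := hl
  exact ⟨x, h hx, y, h hy, hxA, hyB, chain_mono h hc⟩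

theorem ball_subset_occupied {X : Set (EuclideanSpace ℝ (Fin d))}
    {x : EuclideanSpace ℝ (Fin d)} (hx : x ∈ X) : Metric.ball x (1 / 2) ⊆ occupied X :=
  subset_biUnion_of_mem (u := fun x => Metric.ball x (1 / 2)) hx

theorem joinedIn_ball {X : Set (EuclideanSpace ℝ (Fin d))} {x p q : EuclideanSpace ℝ (Fin d)}
    (hx : x ∈ X) (hp : p ∈ Metric.ball x (1 / 2)) (hq : q ∈ Metric.ball x (1 / 2)) :
    JoinedIn (occupied X) p q :=
  (JoinedIn.of_segment_subset ((convex_ball x (1 / 2)).segment_subset hp hq)).mono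
    (ball_subset_occupied hx)

theorem joinedIn_of_chain {X : Set (EuclideanSpace ℝ (Fin d))} {x y : EuclideanSpace ℝ (Fin d)}
    (hx : x ∈ X) (h : Relation.ReflTransGen (Step X) x y) : JoinedIn (occupied X) x y := by
  induction h with
  | refl => exact JoinedIn.refl (ball_subset_occupied hx (Metric.mem_ball_self (by norm_num)))
  | @tail y z _ hs ih =>
    refine ih.trans ?_
    have hm1 : midpoint ℝ y z ∈ Metric.ball y (1 / 2) := by
      rw [Metric.mem_ball, dist_midpoint_left]
      have := hs.2.2
      norm_num
      linarith
    have hm2 : midpoint ℝ y z ∈ Metric.ball z (1 / 2) := by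
      rw [Metric.mem_ball, dist_midpoint_right]
      have := hs.2.2
      norm_num
      linarith
    exact (joinedIn_ball hs.1 (Metric.mem_ball_self (by norm_num)) hm1).trans
      (joinedIn_ball hs.2.1 hm2 (Metric.mem_ball_self (by norm_num)))

/-- The balls reachable from the starting point and the remaining balls form two open sets. They are
disjoint, since overlapping balls have centres at distance less than 1, so the connected range of a
path cannot meet both. Conversely, midpoints join consecutive balls. -/
theorem connected_iff_link (X A B : Set (EuclideanSpace ℝ (Fin d))) :
    Connected X A B ↔ Link X A B := by
  constructor
  · rintro ⟨a, ha, c, hc, hj⟩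
    obtain ⟨x, hx, hax⟩ := mem_iUnion₂.1 hj.source_mem
    obtain ⟨γ, hγ⟩ := hj
    let O₁ : Set (EuclideanSpace ℝ (Fin d)) :=
      ⋃ y ∈ {y ∈ X | Relation.ReflTransGen (Step X) x y}, Metric.ball y (1 / 2)
    let O₂ : Set (EuclideanSpace ℝ (Fin d)) :=
      ⋃ y ∈ {y ∈ X | ¬ Relation.ReflTransGen (Step X) x y}, Metric.ball y (1 / 2)
    have hcover : range γ ⊆ O₁ ∪ O₂ := by
      rintro _ ⟨t, rfl⟩
      obtain ⟨y, hy, hty⟩ := mem_iUnion₂.1 (hγ t)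
      by_cases h : Relation.ReflTransGen (Step X) x y
      · exact Or.inl (mem_iUnion₂.2 ⟨y, ⟨hy, h⟩, hty⟩)
      · exact Or.inr (mem_iUnion₂.2 ⟨y, ⟨hy, h⟩, hty⟩)
    have hdisj : ∀ p, p ∈ O₁ → p ∉ O₂ := by
      intro p h1 h2
      obtain ⟨y, hy, hpy⟩ := mem_iUnion₂.1 h1
      obtain ⟨z, hz, hpz⟩ := mem_iUnion₂.1 h2
      refine hz.2 (hy.2.tail ⟨hy.1, hz.1, ?_⟩)
      have := dist_triangle_left y z p
      rw [Metric.mem_ball] at hpy hpz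
      linarith
    have hpre : IsPreconnected (range γ) := isPreconnected_range γ.continuous
    have hc₁ : c ∈ O₁ := by
      by_contra hcon
      have hc₂ : c ∈ O₂ := (hcover ⟨1, γ.target⟩).resolve_left hcon
      obtain ⟨p, -, hp1, hp2⟩ := hpre O₁ O₂
        (isOpen_biUnion fun _ _ => Metric.isOpen_ball) (isOpen_biUnion fun _ _ => Metric.isOpen_ball)
        hcover ⟨a, ⟨0, γ.source⟩, mem_iUnion₂.2 ⟨x, ⟨hx, .refl⟩, hax⟩⟩ ⟨c, ⟨1, γ.target⟩, hc₂⟩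
      exact hdisj p hp1 hp2
    obtain ⟨y, hy, hcy⟩ := mem_iUnion₂.1 hc₁
    refine ⟨x, hx, y, hy.1, Metric.mem_thickening_iff.2 ⟨a, ha, ?_⟩,
      Metric.mem_thickening_iff.2 ⟨c, hc, ?_⟩, hy.2⟩
    · rw [dist_comm]; exact hax
    · rw [dist_comm]; exact hcy
  · rintro ⟨x, hx, y, hy, hxA, hyB, hc⟩
    obtain ⟨a, ha, hxa⟩ := Metric.mem_thickening_iff.1 hxA
    obtain ⟨c, hc', hyc⟩ := Metric.mem_thickening_iff.1 hyB
    refine ⟨a, ha, c, hc', ?_⟩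
    exact ((joinedIn_ball hx (by rwa [Metric.mem_ball, dist_comm])
      (Metric.mem_ball_self (by norm_num))).trans (joinedIn_of_chain hx hc)).trans
      (joinedIn_ball hy (Metric.mem_ball_self (by norm_num)) (by rwa [Metric.mem_ball, dist_comm]))

theorem measurableSet_reflTransGen {Ω T : Type*} [MeasurableSpace Ω] [Countable T]
    {r : Ω → T → T → Prop} (hr : ∀ a b, MeasurableSet {ω | r ω a b}) (a b : T) :
    MeasurableSet {ω | Relation.ReflTransGen (r ω) a b} := by
  let R : ℕ → T → Set Ω := fun n => Nat.rec (fun b => {_ω | a = b})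
    (fun _ S b => ⋃ c, S c ∩ {ω | r ω c b}) n
  have hR : ∀ n b, MeasurableSet (R n b) := by
    intro n
    induction n with
    | zero => exact fun b => .const _
    | succ n ih => exact fun b => .iUnion fun c => (ih c).inter (hr c b)
  have : {ω | Relation.ReflTransGen (r ω) a b} = ⋃ n, R n b := by
    ext ω
    simp only [mem_ofPred_eq, mem_iUnion]
    constructor
    · intro h
      induction h with
      | refl => exact ⟨0, rfl⟩
      | tail _ hs ih =>
        obtain ⟨n, hn⟩ := ih
        exact ⟨n + 1, mem_iUnion.2 ⟨_, hn, hs⟩⟩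
    · rintro ⟨n, hn⟩
      induction n generalizing b with
      | zero =>
        have : a = b := hn
        rw [this]
      | succ n ih =>
        obtain ⟨c, hc, hs⟩ := mem_iUnion.1 hn
        exact (ih c hc).tail hs
  rw [this]
  exact .iUnion fun n => hR n b

/-- Measurability of the existence of chains between randomly located points. -/
theorem measurableSet_link {Ω T : Type*} [MeasurableSpace Ω] [Countable T]
    {present : Ω → T → Prop} {pos : Ω → T → EuclideanSpace ℝ (Fin d)}
    (hpres : ∀ a, MeasurableSet {ω | present ω a}) (hpos : ∀ a, Measurable fun ω => pos ω a)
    (A B : Set (EuclideanSpace ℝ (Fin d))) :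
    MeasurableSet {ω | Link {q | ∃ a, present ω a ∧ q = pos ω a} A B} := by
  let r : Ω → T → T → Prop := fun ω a b => present ω a ∧ present ω b ∧ dist (pos ω a) (pos ω b) < 1
  have hr : ∀ a b, MeasurableSet {ω | r ω a b} := fun a b =>
    (hpres a).inter ((hpres b).inter
      (measurableSet_lt ((hpos a).dist (hpos b)) measurable_const))
  have : {ω | Link {q | ∃ a, present ω a ∧ q = pos ω a} A B} = ⋃ a, ⋃ b,
      ({ω | present ω a} ∩ {ω | present ω b}) ∩
      (((fun ω => pos ω a) ⁻¹' Metric.thickening (1 / 2) A) ∩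
      (((fun ω => pos ω b) ⁻¹' Metric.thickening (1 / 2) B) ∩
        {ω | Relation.ReflTransGen (r ω) a b})) := by
    ext ω
    simp only [mem_iUnion, mem_inter_iff, mem_ofPred_eq, mem_preimage]
    constructor
    · rintro ⟨x, ⟨a, ha, rfl⟩, y, -, hxA, hyB, hc⟩
      have key : ∀ z, Relation.ReflTransGen (Step {q | ∃ a, present ω a ∧ q = pos ω a})
          (pos ω a) z → ∃ b, present ω b ∧ z = pos ω b ∧ Relation.ReflTransGen (r ω) a b := by
        intro z hz
        induction hz with
        | refl => exact ⟨a, ha, rfl, .refl⟩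
        | tail _ hs ih =>
          obtain ⟨b, hb, rfl, hab⟩ := ih
          obtain ⟨-, ⟨c, hc, rfl⟩, hd⟩ := hs
          exact ⟨c, hc, rfl, hab.tail ⟨hb, hc, hd⟩⟩
      obtain ⟨b, hb, rfl, hab⟩ := key y hc
      exact ⟨a, b, ⟨ha, hb⟩, hxA, hyB, hab⟩
    · rintro ⟨a, b, ⟨ha, hb⟩, hxA, hyB, hab⟩
      refine ⟨pos ω a, ⟨a, ha, rfl⟩, pos ω b, ⟨b, hb, rfl⟩, hxA, hyB, ?_⟩
      exact hab.lift (pos ω) fun c e h => ⟨⟨c, h.1, rfl⟩, ⟨e, h.2.1, rfl⟩, h.2.2⟩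
  rw [this]
  exact .iUnion fun a => .iUnion fun b => ((hpres a).inter (hpres b)).inter
    ((hpos a Metric.isOpen_thickening.measurableSet).inter
      ((hpos b Metric.isOpen_thickening.measurableSet).inter (measurableSet_reflTransGen hr a b)))

end Link

namespace FactorEnvironment

variable {d : ℕ} {S : Type*} [MeasurableSpace S] (E : FactorEnvironment d S)

theorem N_pos : 0 < E.N := by
  have h := E.two_d_M_lt_N
  have hM := E.one_le_M
  have : (0 : ℝ) < E.N := lt_of_le_of_lt (by positivity) h
  exact_mod_cast this

/-- The coarse site whose block contains the fine site `k`. -/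
def coarse (k : Lattice d) : Lattice d := fun i => k i / (E.N : ℤ)

theorem mem_block_coarse (k : Lattice d) : k ∈ E.block (E.coarse k) 0 1 := by
  have hN : (0 : ℤ) < E.N := by exact_mod_cast E.N_pos
  intro i
  have h1 := Int.mul_ediv_add_emod (k i) E.N
  have h2 := Int.emod_nonneg (k i) hN.ne'
  have h3 := Int.emod_lt_of_pos (k i) hN
  simp only [coarse]
  constructor <;> nlinarith

/-! ### Dependence of the environment on the iid family -/

theorem localEnv_univ (k : Lattice d) (Y : Lattice d → S) : E.localEnv k Y univ = E.U k Y := by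
  have := E.isMarkovKernel_Q k
  have hmeas : Measurable (fun p : cube d (E.M / E.N) =>
      E.corner k + (p : EuclideanSpace ℝ (Fin d))) := by fun_prop
  rw [localEnv, Measure.smul_apply, Measure.map_apply hmeas .univ, preimage_univ, measure_univ,
    smul_eq_mul, mul_one]

theorem U_eq_of_localEnv_eq {k : Lattice d} {Y Y' : Lattice d → S}
    (h : E.localEnv k Y = E.localEnv k Y') : E.U k Y = E.U k Y' := by
  have h1 := E.localEnv_univ k Y
  rw [h, E.localEnv_univ] at h1
  exact_mod_cast h1.symm

theorem measurableSet_cube (s : ℝ) : MeasurableSet (cube d s) := by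
  have : cube d s = ⋂ i, {p | p i ∈ Icc 0 s} := by
    ext p; simp [cube]
  rw [this]
  refine .iInter fun i => ?_
  have : Measurable fun p : EuclideanSpace ℝ (Fin d) => p i := by fun_prop
  exact this measurableSet_Icc

/-- The product of intensity and law determines the law only where the intensity is positive; this
is why `Present` demands a positive intensity. -/
theorem Q_eq_of_localEnv_eq {k : Lattice d} {Y Y' : Lattice d → S}
    (h : E.localEnv k Y = E.localEnv k Y') (hU : 0 < E.U k Y) : E.Q k Y = E.Q k Y' := by
  have hemb : MeasurableEmbedding (fun p : cube d (E.M / E.N) =>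
      E.corner k + (p : EuclideanSpace ℝ (Fin d))) :=
    (MeasurableEquiv.addLeft (E.corner k)).measurableEmbedding.comp
      (MeasurableEmbedding.subtype_coe (measurableSet_cube _))
  have hU' := E.U_eq_of_localEnv_eq h
  have h1 : (E.Q k Y).map (fun p : cube d (E.M / E.N) =>
      E.corner k + (p : EuclideanSpace ℝ (Fin d))) = (E.Q k Y').map (fun p : cube d (E.M / E.N) =>
      E.corner k + (p : EuclideanSpace ℝ (Fin d))) := by
    ext s hs
    have h2 := congrArg (fun m => m s) h
    simp only [localEnv, Measure.smul_apply, smul_eq_mul, ← hU'] at h2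
    exact (ENNReal.mul_right_inj (by exact_mod_cast hU.ne') ENNReal.coe_ne_top).1 h2
  rw [← hemb.comap_map (E.Q k Y), h1, hemb.comap_map]

variable (Γ : cube d (E.M / E.N) ≃ᵐ unitInterval)

/-- The quantile is below `t` exactly when the distribution function reaches v at some r < t, and
monotonicity allows r to be taken from a countable dense set. -/
theorem measurable_quantile (k : Lattice d) :
    Measurable fun p : (Lattice d → S) × unitInterval => E.quantile Γ k p.1 p.2 := by
  obtain ⟨Z, hZc, hZd⟩ := TopologicalSpace.exists_countable_dense unitInterval
  have hF : ∀ r, Measurable fun Y => ((E.Q k Y).map Γ).real (Iic r) := by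
    intro r
    have h1 : ∀ Y, ((E.Q k Y).map Γ).real (Iic r) = (E.Q k Y (Γ ⁻¹' Iic r)).toReal := fun Y => by
      rw [measureReal_def, Measure.map_apply Γ.measurable measurableSet_Iic]
    simp_rw [h1]
    exact (Kernel.measurable_coe (E.Q k) (Γ.measurable measurableSet_Iic)).ennreal_toReal
  have hmono : ∀ Y {r r' : unitInterval}, r ≤ r' → ((E.Q k Y).map Γ).real (Iic r) ≤
      ((E.Q k Y).map Γ).real (Iic r') := by
    intro Y r r' h
    have := E.isMarkovKernel_Q k
    have : IsProbabilityMeasure ((E.Q k Y).map Γ) :=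
      Measure.isProbabilityMeasure_map Γ.measurable.aemeasurable
    exact measureReal_mono (Iic_subset_Iic.2 h)
  refine measurable_of_Iio fun t => ?_
  have : (fun p : (Lattice d → S) × unitInterval => E.quantile Γ k p.1 p.2) ⁻¹' Iio t =
      ⋃ r ∈ {r ∈ Z | r < t}, {p | (p.2 : ℝ) ≤ ((E.Q k p.1).map Γ).real (Iic r)} := by
    ext p
    simp only [mem_preimage, mem_Iio, quantile, sInf_lt_iff, mem_iUnion, mem_ofPred_eq, exists_prop]
    constructor
    · rintro ⟨s, hs, hst⟩
      obtain ⟨r, hr, hsr, hrt⟩ := hZd.exists_between hst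
      exact ⟨r, ⟨hr, hrt⟩, hs.trans (hmono _ hsr.le)⟩
    · rintro ⟨r, ⟨-, hrt⟩, h⟩
      exact ⟨r, h, hrt⟩
  rw [this]
  refine .biUnion (hZc.mono fun _ h => h.1) fun r _ => ?_
  exact measurableSet_le (by fun_prop) ((hF r).comp measurable_fst)

/-! ### The points of the Cox process, block by block -/

/-- The point with index `i` in strip `j` of the Poisson process at `k` contributes to the Cox
process. Only strips below `J` are considered. -/
def Present (J : ℕ) (D : Set (Lattice d)) (ω : (Lattice d → S) × (Lattice d → PoissonSample))
    (a : Lattice d × ℕ × ℕ) : Prop :=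
  E.coarse a.1 ∈ D ∧ a.2.1 < J ∧ a.2.2 < (ω.2 a.1 a.2.1).1 ∧ 0 < E.U a.1 ω.1 ∧
    (a.2.1 : ℝ) + ((ω.2 a.1 a.2.1).2 a.2.2).2 ≤ E.U a.1 ω.1

/-- The position of the point of the Cox process with a given index. -/
def position (ω : (Lattice d → S) × (Lattice d → PoissonSample)) (a : Lattice d × ℕ × ℕ) :
    EuclideanSpace ℝ (Fin d) :=
  E.corner a.1 + (Γ.symm (E.quantile Γ a.1 ω.1 ((ω.2 a.1 a.2.1).2 a.2.2).1) :
    EuclideanSpace ℝ (Fin d))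

/-- The points of the Cox process from blocks in `D` and strips below `J`. -/
def points (J : ℕ) (D : Set (Lattice d))
    (ω : (Lattice d → S) × (Lattice d → PoissonSample)) : Set (EuclideanSpace ℝ (Fin d)) :=
  {q | ∃ a, E.Present J D ω a ∧ q = E.position Γ ω a}

theorem measurableSet_present (J : ℕ) (D : Set (Lattice d)) (a : Lattice d × ℕ × ℕ) :
    MeasurableSet {ω | E.Present J D ω a} := by
  have hU : Measurable fun ω : (Lattice d → S) × (Lattice d → PoissonSample) => E.U a.1 ω.1 :=
    (E.measurable_U a.1).comp measurable_fst
  have h1 : Measurable fun ω : (Lattice d → S) × (Lattice d → PoissonSample) =>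
      (ω.2 a.1 a.2.1).1 := by fun_prop
  have h2 : Measurable fun ω : (Lattice d → S) × (Lattice d → PoissonSample) =>
      ((ω.2 a.1 a.2.1).2 a.2.2).2 := by fun_prop
  refine (MeasurableSet.const _).inter ((MeasurableSet.const _).inter (.inter ?_ (.inter ?_ ?_)))
  · exact measurableSet_lt measurable_const h1
  · exact hU measurableSet_Ioi
  · exact measurableSet_le (measurable_const.add (measurable_subtype_coe.comp h2))
      (measurable_coe_nnreal_real.comp hU)

theorem measurable_position (a : Lattice d × ℕ × ℕ) :
    Measurable fun ω => E.position Γ ω a := by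
  have h1 : Measurable fun ω : (Lattice d → S) × (Lattice d → PoissonSample) =>
      (ω.1, ((ω.2 a.1 a.2.1).2 a.2.2).1) := by fun_prop
  have h2 := (E.measurable_quantile Γ a.1).comp h1
  exact measurable_const.add (measurable_subtype_coe.comp (Γ.symm.measurable.comp h2))

theorem measurableSet_link_points (J : ℕ) (D : Set (Lattice d))
    (A B : Set (EuclideanSpace ℝ (Fin d))) :
    MeasurableSet {ω | Link (E.points Γ J D ω) A B} :=
  measurableSet_link (fun a => E.measurableSet_present J D a)
    (fun a => E.measurable_position Γ a) A B

theorem points_mono (J : ℕ) {D D' : Set (Lattice d)} (h : D ⊆ D')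
    (ω : (Lattice d → S) × (Lattice d → PoissonSample)) :
    E.points Γ J D ω ⊆ E.points Γ J D' ω := by
  rintro q ⟨a, ha, rfl⟩
  exact ⟨a, ⟨h ha.1, ha.2⟩, rfl⟩

/-- The cube `M z + [0, M]^d`. -/
def cell (z : Lattice d) : Set (EuclideanSpace ℝ (Fin d)) :=
  {p | ∀ i, E.M * z i ≤ p i ∧ p i ≤ E.M * z i + E.M}

theorem position_mem_cell (ω : (Lattice d → S) × (Lattice d → PoissonSample))
    (a : Lattice d × ℕ × ℕ) : E.position Γ ω a ∈ E.cell (E.coarse a.1) := by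
  intro i
  have hN : (0 : ℝ) < E.N := by exact_mod_cast E.N_pos
  have hM := E.one_le_M
  have hk := E.mem_block_coarse a.1 i
  have h1 : (E.N : ℝ) * E.coarse a.1 i ≤ a.1 i := by
    have : (E.N : ℤ) * E.coarse a.1 i ≤ a.1 i := by simpa using hk.1
    exact_mod_cast this
  have h2 : (a.1 i : ℝ) + 1 ≤ E.N * (E.coarse a.1 i + 1) := by
    have := hk.2
    exact_mod_cast this
  have hp := (Γ.symm (E.quantile Γ a.1 ω.1 ((ω.2 a.1 a.2.1).2 a.2.2).1)).2 i
  have he : E.position Γ ω a i = E.M / E.N * a.1 i +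
      (Γ.symm (E.quantile Γ a.1 ω.1 ((ω.2 a.1 a.2.1).2 a.2.2).1) :
        EuclideanSpace ℝ (Fin d)) i := rfl
  rw [he]
  have h3 : 0 < E.M / E.N := by positivity
  have h4 : E.M / E.N * E.N = E.M := by field_simp
  have h5 := mul_le_mul_of_nonneg_left h1 h3.le
  have h6 := mul_le_mul_of_nonneg_left h2 h3.le
  rw [← mul_assoc, h4] at h5 h6
  constructor
  · linarith [hp.1]
  · linarith [hp.2]

theorem exists_mem_cell {J : ℕ} {D : Set (Lattice d)}
    {ω : (Lattice d → S) × (Lattice d → PoissonSample)} {q : EuclideanSpace ℝ (Fin d)}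
    (hq : q ∈ E.points Γ J D ω) : ∃ z ∈ D, q ∈ E.cell z ∧ q ∈ E.points Γ J {z} ω := by
  obtain ⟨a, ha, rfl⟩ := hq
  exact ⟨_, ha.1, E.position_mem_cell Γ ω a, a, ⟨rfl, ha.2⟩, rfl⟩

/-- The coarse sites at `ℓ^∞`-distance at most one from `D`. -/
def enlarge (D : Set (Lattice d)) : Set (Lattice d) := {w | ∃ z ∈ D, ∀ i, |w i - z i| ≤ 1}

/-- Points of a block depend on Y in the neighbouring blocks but on the Poisson processes of the
block alone. Hence they are functions of the coarse coordinates at distance at most one. -/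
theorem points_congr (hdep : E.OneDependent) (J : ℕ) {D : Set (Lattice d)}
    {ω ω' : (Lattice d → S) × (Lattice d → PoissonSample)}
    (h : OSSS.Agree E.coarse (enlarge D) ω ω') : E.points Γ J D ω = E.points Γ J D ω' := by
  have key : ∀ ω ω' : (Lattice d → S) × (Lattice d → PoissonSample),
      OSSS.Agree E.coarse (enlarge D) ω ω' → E.points Γ J D ω ⊆ E.points Γ J D ω' := by
    rintro ω ω' h q ⟨a, ⟨h1, h2, h3, h4, h5⟩, rfl⟩
    have hE : E.localEnv a.1 ω.1 = E.localEnv a.1 ω'.1 :=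
      hdep _ _ (E.mem_block_coarse a.1) _ _ fun w hw => h.1 w ⟨_, h1, hw⟩
    have hV : ω.2 a.1 = ω'.2 a.1 := h.2 a.1 ⟨_, h1, fun i => by simp⟩
    have hU := E.U_eq_of_localEnv_eq hE
    have hQ := E.Q_eq_of_localEnv_eq hE h4
    rw [hU] at h4 h5
    rw [hV] at h3 h5
    refine ⟨a, ⟨h1, h2, h3, h4, h5⟩, ?_⟩
    simp only [position, quantile, hQ, hV]
  exact Subset.antisymm (key _ _ h) (key _ _ h.symm)

/-! ### Translations -/

/-- The translate of a configuration by a coarse site. -/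
def shift (w : Lattice d) (ω : (Lattice d → S) × (Lattice d → PoissonSample)) :
    (Lattice d → S) × (Lattice d → PoissonSample) :=
  (fun z => ω.1 (z + w), fun k => ω.2 (k + (E.N : ℤ) • w))

theorem measurePreserving_shift (ν : Measure S) [IsProbabilityMeasure ν] (lam : ℝ)
    (w : Lattice d) : MeasurePreserving (E.shift w) (jointLaw d ν lam) (jointLaw d ν lam) := by
  have h1 : MeasurePreserving (fun (Y : Lattice d → S) z => Y (z + w)) (iidLaw d ν)
      (iidLaw d ν) :=
    ⟨by fun_prop, Measure.map_infinitePi_infinitePi_of_inj (P := fun _ : Lattice d => ν)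
      (f := fun z => z + w) (add_left_injective w)⟩
  have h2 : MeasurePreserving (fun (V : Lattice d → PoissonSample) k => V (k + (E.N : ℤ) • w))
      (Measure.infinitePi fun _ => poissonLaw lam.toNNReal)
      (Measure.infinitePi fun _ => poissonLaw lam.toNNReal) :=
    ⟨by fun_prop, Measure.map_infinitePi_infinitePi_of_inj
      (P := fun _ : Lattice d => poissonLaw lam.toNNReal)
      (f := fun k => k + (E.N : ℤ) • w) (add_left_injective _)⟩
  exact h1.prod h2

/-- The corner `M w` of the cell of `w`. -/
def origin (w : Lattice d) : EuclideanSpace ℝ (Fin d) := WithLp.toLp 2 fun i => E.M * w i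

theorem corner_add_smul (k w : Lattice d) :
    E.corner (k + (E.N : ℤ) • w) = E.corner k + E.origin w := by
  have hN : (E.N : ℝ) ≠ 0 := by exact_mod_cast E.N_pos.ne'
  ext i
  simp only [corner, origin, PiLp.add_apply, Pi.add_apply, Pi.smul_apply, smul_eq_mul]
  push_cast
  field_simp

theorem mem_points_shift (J : ℕ) (w : Lattice d)
    (ω : (Lattice d → S) × (Lattice d → PoissonSample)) (q : EuclideanSpace ℝ (Fin d)) :
    q ∈ E.points Γ J univ (E.shift w ω) ↔ q + E.origin w ∈ E.points Γ J univ ω := by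
  have hpos : ∀ a, E.position Γ (E.shift w ω) a + E.origin w =
      E.position Γ ω (a.1 + (E.N : ℤ) • w, a.2) := by
    intro a
    simp only [position, E.corner_add_smul, quantile, E.Q_covariant, shift]
    abel
  have hpres : ∀ a, E.Present J univ (E.shift w ω) a ↔
      E.Present J univ ω (a.1 + (E.N : ℤ) • w, a.2) := by
    intro a
    simp only [Present, E.U_covariant, shift, mem_univ, true_and]
  constructor
  · rintro ⟨a, ha, rfl⟩
    exact ⟨_, (hpres a).1 ha, hpos a⟩
  · rintro ⟨a, ha, hq⟩
    refine ⟨(a.1 - (E.N : ℤ) • w, a.2), (hpres _).2 (by simpa using ha), ?_⟩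
    have := hpos (a.1 - (E.N : ℤ) • w, a.2)
    simp only [sub_add_cancel] at this
    rw [← this] at hq
    exact add_right_cancel hq

theorem link_shift (J : ℕ) (w : Lattice d)
    (ω : (Lattice d → S) × (Lattice d → PoissonSample)) (A B : Set (EuclideanSpace ℝ (Fin d)))
    (h : Link (E.points Γ J univ ω) A B) :
    Link (E.points Γ J univ (E.shift w ω)) ((fun q => q + E.origin w) ⁻¹' A)
      ((fun q => q + E.origin w) ⁻¹' B) := by
  have hthick : ∀ (A : Set (EuclideanSpace ℝ (Fin d))) x, x ∈ Metric.thickening (1 / 2) A →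
      x - E.origin w ∈ Metric.thickening (1 / 2) ((fun q => q + E.origin w) ⁻¹' A) := by
    intro A x hx
    obtain ⟨a, ha, hxa⟩ := Metric.mem_thickening_iff.1 hx
    exact Metric.mem_thickening_iff.2 ⟨a - E.origin w, by simpa using ha, by simpa using hxa⟩
  have hmem : ∀ x, x ∈ E.points Γ J univ ω →
      x - E.origin w ∈ E.points Γ J univ (E.shift w ω) := fun x hx => by
    rw [mem_points_shift]; simpa using hx
  obtain ⟨x, hx, y, hy, hxA, hyB, hc⟩ := h
  exact ⟨_, hmem x hx, _, hmem y hy, hthick A x hxA, hthick B y hyB,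
    hc.lift (fun x => x - E.origin w) fun a b hs => ⟨hmem a hs.1, hmem b hs.2.1, by
      simpa using hs.2.2⟩⟩

/-! ### Comparison with the Cox process -/

/-- A mark equal to zero would be accepted by `coxPoints` at a site of zero intensity but never by
`Present`. -/
theorem ae_mark_ne_zero (ν : Measure S) [IsProbabilityMeasure ν] (lam : ℝ) :
    ∀ᵐ ω ∂(jointLaw d ν lam), ∀ (k : Lattice d) (j i : ℕ), ((ω.2 k j).2 i).2 ≠ 0 := by
  rw [ae_all_iff]; intro k
  rw [ae_all_iff]; intro j
  rw [ae_all_iff]; intro i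
  have h1 : MeasurePreserving (Prod.snd : (Lattice d → S) × (Lattice d → PoissonSample) → _)
      (jointLaw d ν lam) (Measure.infinitePi fun _ => poissonLaw lam.toNNReal) :=
    measurePreserving_snd
  have h2 := measurePreserving_eval_infinitePi
    (fun _ : Lattice d => poissonLaw lam.toNNReal) k
  have h3 := measurePreserving_eval_infinitePi (fun _ : ℕ =>
    (poissonMeasure lam.toNNReal).prod
      (Measure.infinitePi fun _ : ℕ => (volume : Measure (unitInterval × unitInterval)))) j
  have h4 : MeasurePreserving Prod.snd ((poissonMeasure lam.toNNReal).prod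
      (Measure.infinitePi fun _ : ℕ => (volume : Measure (unitInterval × unitInterval)))) _ :=
    measurePreserving_snd
  have h5 := measurePreserving_eval_infinitePi
    (fun _ : ℕ => (volume : Measure (unitInterval × unitInterval))) i
  have h6 : MeasurePreserving Prod.snd (volume : Measure (unitInterval × unitInterval))
      (volume : Measure unitInterval) := measurePreserving_snd
  have h := h6.comp (h5.comp (h4.comp (h3.comp (h2.comp h1))))
  have hne : ∀ᵐ u : unitInterval, u ≠ 0 := by
    rw [ae_iff]
    simp
  exact h.quasiMeasurePreserving.ae hne

/-- Since intensities are at most ρ < J, strips from `J` upwards never contribute. Each fine site is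
left with finitely many relevant counts. -/
theorem ae_coxPoints_eq (ν : Measure S) [IsProbabilityMeasure ν] {ρ : ℝ≥0}
    (hρ : ∀ᵐ Y ∂(iidLaw d ν), ∀ k, E.U k Y ≤ ρ) {J : ℕ} (hJ : ρ < J) (lam : ℝ) :
    ∀ᵐ ω ∂(jointLaw d ν lam), E.coxPoints Γ ω = E.points Γ J univ ω := by
  have h1 : MeasurePreserving (Prod.fst : (Lattice d → S) × (Lattice d → PoissonSample) → _)
      (jointLaw d ν lam) (iidLaw d ν) := measurePreserving_fst
  filter_upwards [h1.quasiMeasurePreserving.ae hρ, ae_mark_ne_zero ν lam] with ω hU hm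
  ext q
  constructor
  · rintro ⟨k, _, ⟨j, i, hi, rfl⟩, hle, rfl⟩
    have hu := ((ω.2 k j).2 i).2.2.1
    have hu' : (0 : ℝ) < ((ω.2 k j).2 i).2 :=
      lt_of_le_of_ne hu fun h => hm k j i (Subtype.ext h.symm)
    dsimp only at hle
    have hj : (0 : ℝ) ≤ j := Nat.cast_nonneg j
    refine ⟨(k, j, i), ⟨mem_univ _, ?_, hi, ?_, hle⟩, rfl⟩
    · have h2 : (E.U k ω.1 : ℝ) ≤ ρ := by exact_mod_cast hU k
      have h3 : (ρ : ℝ) < J := by exact_mod_cast hJ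
      have : (j : ℝ) < J := by linarith
      exact_mod_cast this
    · have : (0 : ℝ) < E.U k ω.1 := by linarith
      exact_mod_cast this
  · rintro ⟨⟨k, j, i⟩, ⟨-, -, hi, -, hle⟩, rfl⟩
    exact ⟨k, _, ⟨j, i, hi, rfl⟩, hle, rfl⟩

theorem connProb_eq (ν : Measure S) [IsProbabilityMeasure ν] {ρ : ℝ≥0}
    (hρ : ∀ᵐ Y ∂(iidLaw d ν), ∀ k, E.U k Y ≤ ρ) {J : ℕ} (hJ : ρ < J) (lam : ℝ) (n : ℕ) :
    E.connProb ν Γ lam n = jointLaw d ν lam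
      {ω | Link (E.points Γ J univ ω) (box d (3 * E.M)) (E.shell n)} := by
  refine measure_congr ?_
  filter_upwards [E.ae_coxPoints_eq Γ ν hρ hJ lam] with ω hω
  change Connected _ _ _ = Link _ _ _
  rw [hω, connected_iff_link]

end FactorEnvironment

end CoxPercolation

end

noncomputable section

namespace CoxPercolation

/-! ### Separating the counts from the marks -/

/-- The configuration with given environment, marks and counts. -/
def assemble {d : ℕ} {S : Type*}
    (p : ((Lattice d → S) × (Lattice d × ℕ → ℕ → unitInterval × unitInterval)) ×
      (Lattice d × ℕ → ℕ)) : (Lattice d → S) × (Lattice d → PoissonSample) :=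
  (p.1.1, fun k j => (p.2 (k, j), p.1.2 (k, j)))

/-- The law of the environment and the marks. -/
def markedLaw (d : ℕ) {S : Type*} [MeasurableSpace S] (ν : Measure S) [IsProbabilityMeasure ν] :
    Measure ((Lattice d → S) × (Lattice d × ℕ → ℕ → unitInterval × unitInterval)) :=
  (iidLaw d ν).prod (Measure.infinitePi fun _ => Measure.infinitePi fun _ => volume)

instance (d : ℕ) {S : Type*} [MeasurableSpace S] (ν : Measure S) [IsProbabilityMeasure ν] :
    IsProbabilityMeasure (markedLaw d ν) := by
  unfold markedLaw; infer_instance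

/-- The parameter enters only through the counts. With environment and marks fixed, connection
events become increasing events of iid Poisson variables. -/
theorem measurePreserving_assemble {d : ℕ} {S : Type*} [MeasurableSpace S] (ν : Measure S)
    [IsProbabilityMeasure ν] (lam : ℝ) :
    MeasurePreserving assemble
      ((markedLaw d ν).prod (PoissonCounts.law fun _ => lam.toNNReal)) (jointLaw d ν lam) := by
  set marks : Measure (Lattice d × ℕ → ℕ → unitInterval × unitInterval) :=
    Measure.infinitePi fun _ => Measure.infinitePi fun _ => volume with hmarks
  set counts : Measure (Lattice d × ℕ → ℕ) :=
    Measure.infinitePi fun _ => poissonMeasure lam.toNNReal with hcounts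
  have h1 := measurePreserving_prodAssoc (iidLaw d ν) marks counts
  have h2 : MeasurePreserving Prod.swap (marks.prod counts) (counts.prod marks) :=
    Measure.measurePreserving_swap
  have h3 := measurePreserving_zip (fun _ : Lattice d × ℕ => poissonMeasure lam.toNNReal)
    (fun _ : Lattice d × ℕ => (Measure.infinitePi fun _ : ℕ =>
      (volume : Measure (unitInterval × unitInterval))))
  have h4 : MeasurePreserving (MeasurableEquiv.curry (Lattice d) ℕ
        (ℕ × (ℕ → unitInterval × unitInterval)))
      (Measure.infinitePi fun _ : Lattice d × ℕ => (poissonMeasure lam.toNNReal).prod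
        (Measure.infinitePi fun _ : ℕ => (volume : Measure (unitInterval × unitInterval))))
      (Measure.infinitePi fun _ : Lattice d => poissonLaw lam.toNNReal) :=
    ⟨MeasurableEquiv.measurable _, Measure.infinitePi_map_curry
      (fun (_ : Lattice d) (_ : ℕ) => (poissonMeasure lam.toNNReal).prod
        (Measure.infinitePi fun _ : ℕ => (volume : Measure (unitInterval × unitInterval))))⟩
  exact ((MeasurePreserving.id (iidLaw d ν)).prod (h4.comp (h3.comp h2))).comp h1

theorem prod_add_sum_le {α β I : Type*} [MeasurableSpace α] [MeasurableSpace β] (σ : Measure α)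
    [SFinite σ] (π π' : Measure β) [SFinite π] [SFinite π'] {C : Set (α × β)}
    (hC : MeasurableSet C) (F : Finset I) {D : I → Set (α × β)} (hD : ∀ e, MeasurableSet (D e))
    (κ : ℝ≥0∞) (h : ∀ a, π (Prod.mk a ⁻¹' C) + κ * ∑ e ∈ F, π (Prod.mk a ⁻¹' D e) ≤
      π' (Prod.mk a ⁻¹' C)) :
    σ.prod π C + κ * ∑ e ∈ F, σ.prod π (D e) ≤ σ.prod π' C := by
  rw [Measure.prod_apply hC, Measure.prod_apply hC]
  simp_rw [fun e => Measure.prod_apply (μ := σ) (ν := π) (hD e)]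
  rw [← lintegral_finsetSum _ fun e _ => measurable_measure_prodMk_left (hD e),
    ← lintegral_const_mul _ (Finset.measurable_sum _ fun e _ =>
      measurable_measure_prodMk_left (hD e)), ← lintegral_add_left
      (measurable_measure_prodMk_left hC)]
  exact lintegral_mono h

namespace FactorEnvironment

variable {d : ℕ} {S : Type*} [MeasurableSpace S] (E : FactorEnvironment d S)

/-- The fine sites in the blocks of `G`. -/
def fine (G : Finset (Lattice d)) : Finset (Lattice d) :=
  open scoped Classical in G.biUnion fun z =>
    Finset.Icc (fun i => (E.N : ℤ) * z i) (fun i => (E.N : ℤ) * z i + E.N - 1)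

theorem mem_fine {G : Finset (Lattice d)} {k : Lattice d} : k ∈ E.fine G ↔ E.coarse k ∈ G := by
  classical
  have hN : (0 : ℤ) < E.N := by exact_mod_cast E.N_pos
  simp only [fine, Finset.mem_biUnion, Finset.mem_Icc, Pi.le_def]
  constructor
  · rintro ⟨z, hz, h1, h2⟩
    have : E.coarse k = z := by
      funext i
      have h1 := h1 i
      have h2 := h2 i
      simp only [coarse]
      exact (Int.ediv_eq_iff_of_pos hN).2 ⟨by linarith, by linarith⟩
    rwa [this]
  · intro h
    refine ⟨_, h, fun i => ?_, fun i => ?_⟩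
    · have := (E.mem_block_coarse k i).1
      simpa using this
    · have := (E.mem_block_coarse k i).2
      linarith

theorem card_fine_le (G : Finset (Lattice d)) : (E.fine G).card ≤ G.card * E.N ^ d := by
  classical
  refine Finset.card_biUnion_le_card_mul _ _ _ fun z _ => ?_
  rw [Pi.card_Icc]
  have : ∀ i, (Finset.Icc ((E.N : ℤ) * z i) ((E.N : ℤ) * z i + E.N - 1)).card = E.N := fun i => by
    rw [Int.card_Icc]; omega
  simp [this]

/-- The coarse sites at `ℓ^∞`-distance at most one from `e`. -/
def near (e : Lattice d) : Finset (Lattice d) := Finset.Icc (fun i => e i - 1) (fun i => e i + 1)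

theorem mem_near {e z : Lattice d} : z ∈ near e ↔ ∀ i, |z i - e i| ≤ 1 := by
  simp only [near, Finset.mem_Icc, Pi.le_def, ← forall_and, abs_le]
  exact forall_congr' fun i => by constructor <;> rintro ⟨h1, h2⟩ <;> constructor <;> linarith

theorem card_near (e : Lattice d) : (near e).card = 3 ^ d := by
  rw [near, Pi.card_Icc]
  have : ∀ i, (Finset.Icc (e i - 1) (e i + 1)).card = 3 := fun i => by
    rw [Int.card_Icc]; omega
  simp [this]

variable (Γ : cube d (E.M / E.N) ≃ᵐ unitInterval)

theorem points_assemble_mono (J : ℕ) (D : Set (Lattice d))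
    (r : (Lattice d → S) × (Lattice d × ℕ → ℕ → unitInterval × unitInterval))
    {n n' : Lattice d × ℕ → ℕ} (h : n ≤ n') :
    E.points Γ J D (assemble (r, n)) ⊆ E.points Γ J D (assemble (r, n')) := by
  rintro q ⟨a, ⟨h1, h2, h3, h4⟩, rfl⟩
  exact ⟨a, ⟨h1, h2, lt_of_lt_of_le h3 (h _), h4⟩, rfl⟩

theorem points_assemble_congr (J : ℕ) (F : Finset (Lattice d))
    (r : (Lattice d → S) × (Lattice d × ℕ → ℕ → unitInterval × unitInterval))
    {n n' : Lattice d × ℕ → ℕ} (h : ∀ i ∈ E.fine F ×ˢ Finset.range J, n i = n' i) :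
    E.points Γ J F (assemble (r, n)) = E.points Γ J F (assemble (r, n')) := by
  ext q
  refine exists_congr fun a => and_congr_left fun hq => ?_
  refine and_congr_right fun h1 => and_congr_right fun h2 => ?_
  have := h (a.1, a.2.1) (Finset.mem_product.2 ⟨E.mem_fine.2 h1, Finset.mem_range.2 h2⟩)
  simp only [assemble, this]

/-- Links the two halves of the argument: zero counts, as in the Poisson inequality, amount to
deleted blocks, as in the bound on influences. -/
theorem points_assemble_clear (J : ℕ) (F G : Finset (Lattice d))
    (r : (Lattice d → S) × (Lattice d × ℕ → ℕ → unitInterval × unitInterval))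
    (n : Lattice d × ℕ → ℕ) :
    E.points Γ J F (assemble (r, PoissonCounts.clear
        (E.fine (open scoped Classical in F ∩ G) ×ˢ Finset.range J) n)) =
      E.points Γ J ((F : Set (Lattice d)) \ G) (assemble (r, n)) := by
  classical
  ext q
  refine exists_congr fun a => and_congr ?_ (by rfl)
  simp only [Present, assemble, PoissonCounts.clear, Finset.mem_product, E.mem_fine,
    Finset.mem_inter, Finset.mem_range, Finset.mem_coe, Set.mem_sdiff]
  by_cases hF : E.coarse a.1 ∈ F <;> by_cases hG : E.coarse a.1 ∈ G <;>
    by_cases hJ : a.2.1 < J <;> simp [hF, hG, hJ]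

/-! ### Influences and the effect of raising the intensity -/

/-- The event that `A` is linked to `B` but not without the points near `e`. -/
def nearPivotal (J : ℕ) (F : Finset (Lattice d)) (A B : Set (EuclideanSpace ℝ (Fin d)))
    (e : Lattice d) : Set ((Lattice d → S) × (Lattice d → PoissonSample)) :=
  {ω | Link (E.points Γ J F ω) A B ∧
    ¬ Link (E.points Γ J ((F : Set (Lattice d)) \ near e) ω) A B}

theorem measurableSet_nearPivotal (J : ℕ) (F : Finset (Lattice d))
    (A B : Set (EuclideanSpace ℝ (Fin d))) (e : Lattice d) :
    MeasurableSet (E.nearPivotal Γ J F A B e) :=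
  (E.measurableSet_link_points Γ J F A B).inter (E.measurableSet_link_points Γ J _ A B).compl

/-- Resampling the coordinates of `e` only matters if the points near `e` do. -/
theorem influence_le (hdep : E.OneDependent) (ν : Measure S) [IsProbabilityMeasure ν] (lam : ℝ)
    (J : ℕ) (F : Finset (Lattice d)) (A B : Set (EuclideanSpace ℝ (Fin d))) (e : Lattice d) :
    OSSS.influence ν (poissonLaw lam.toNNReal) E.coarse {ω | Link (E.points Γ J F ω) A B} e ≤
      2 * jointLaw d ν lam (E.nearPivotal Γ J F A B e) := by
  set C := {ω | Link (E.points Γ J F ω) A B} with hCdef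
  have hC : MeasurableSet C := E.measurableSet_link_points Γ J F A B
  set P := (OSSS.law (Lattice d) (Lattice d) ν (poissonLaw lam.toNNReal)).prod
    (OSSS.law (Lattice d) (Lattice d) ν (poissonLaw lam.toNNReal)) with hP
  have hm := OSSS.measurable_mix (A := S) (B := PoissonSample) E.coarse {e}
  -- Exchanging the coordinates of `e` swaps the original and the resampled configuration, so
  -- gaining and losing the link are equally likely; hence the factor 2.
  have hswap : P {p | p.1 ∉ C ∧ OSSS.mix E.coarse {e} p.1 p.2 ∈ C} =
      P {p | p.1 ∈ C ∧ OSSS.mix E.coarse {e} p.1 p.2 ∉ C} := by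
    have hmeas : MeasurableSet {p : ((Lattice d → S) × (Lattice d → PoissonSample)) ×
        ((Lattice d → S) × (Lattice d → PoissonSample)) |
        p.1 ∉ C ∧ OSSS.mix E.coarse {e} p.1 p.2 ∈ C} :=
      (measurable_fst hC).compl.inter (hm hC)
    rw [hP, ← (OSSS.measurePreserving_mix E.coarse ν (poissonLaw lam.toNNReal)
      {e}).measure_preimage hmeas.nullMeasurableSet]
    congr 1
    ext p
    have e1 : OSSS.mix E.coarse {e} (OSSS.mix E.coarse {e} p.1 p.2)
        (OSSS.mix E.coarse {e} p.2 p.1) = p.1 := by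
      ext x <;> simp only [OSSS.mix] <;> split_ifs <;> rfl
    simp only [mem_preimage, mem_ofPred_eq, e1]
    exact and_comm
  have hone : P {p | p.1 ∈ C ∧ OSSS.mix E.coarse {e} p.1 p.2 ∉ C} ≤
      jointLaw d ν lam (E.nearPivotal Γ J F A B e) := by
    have : jointLaw d ν lam (E.nearPivotal Γ J F A B e) =
        P (E.nearPivotal Γ J F A B e ×ˢ univ) := by
      rw [hP, Measure.prod_prod, measure_univ, mul_one]; rfl
    rw [this]
    refine measure_mono ?_
    rintro p ⟨h1, h2⟩
    refine ⟨⟨h1, fun h3 => h2 ?_⟩, mem_univ _⟩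
    -- Points in blocks away from `e` do not see the coordinates of `e`, so a link that uses only
    -- them survives resampling.
    have hag : OSSS.Agree E.coarse (enlarge ((F : Set (Lattice d)) \ near e)) p.1
        (OSSS.mix E.coarse {e} p.1 p.2) := by
      refine (OSSS.mix_agree_left ?_ _ _).symm
      rw [disjoint_singleton_left]
      rintro ⟨z, hz, hez⟩
      refine hz.2 (Finset.mem_coe.2 (mem_near.2 fun i => ?_))
      rw [abs_sub_comm]
      exact hez i
    rw [E.points_congr Γ hdep J hag] at h3
    exact h3.mono (E.points_mono Γ J sdiff_subset _)
  have hsub : {p : ((Lattice d → S) × (Lattice d → PoissonSample)) ×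
      ((Lattice d → S) × (Lattice d → PoissonSample)) |
      ¬ (p.1 ∈ C ↔ OSSS.mix E.coarse {e} p.1 p.2 ∈ C)} ⊆
      {p | p.1 ∈ C ∧ OSSS.mix E.coarse {e} p.1 p.2 ∉ C} ∪
      {p | p.1 ∉ C ∧ OSSS.mix E.coarse {e} p.1 p.2 ∈ C} := by
    intro p hp
    simp only [mem_union, mem_ofPred_eq] at hp ⊢
    tauto
  refine (measure_mono hsub).trans ((measure_union_le _ _).trans ?_)
  rw [← hP, hswap, two_mul]
  exact add_le_add hone hone

/-- Applied for fixed environment and marks, then integrated. A neighbourhood of `e` involves at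
most 3^d N^d J counts, and each count belongs to at most 3^d neighbourhoods; both bounds are
independent of the box. -/
theorem jointLaw_add_sum_nearPivotal_le (ν : Measure S) [IsProbabilityMeasure ν] {s t : ℝ}
    (hs : 0 < s) (hst : s ≤ t) (J : ℕ) (F : Finset (Lattice d))
    (A B : Set (EuclideanSpace ℝ (Fin d))) (G : Finset (Lattice d)) :
    jointLaw d ν s {ω | Link (E.points Γ J F ω) A B} +
        ENNReal.ofReal ((t - s) * Real.exp (-t) * s⁻¹ *
          Real.exp (-((E.fine F ×ˢ Finset.range J).card * (t - s))) *
          (Real.exp (-((3 ^ d * E.N ^ d * J : ℕ) * s)) / (3 ^ d : ℕ))) *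
        ∑ e ∈ G, jointLaw d ν s (E.nearPivotal Γ J F A B e) ≤
      jointLaw d ν t {ω | Link (E.points Γ J F ω) A B} := by
  classical
  have ht : 0 < t := hs.trans_le hst
  have hs' : ((s.toNNReal : ℝ≥0) : ℝ) = s := Real.coe_toNNReal _ hs.le
  have ht' : ((t.toNNReal : ℝ≥0) : ℝ) = t := Real.coe_toNNReal _ ht.le
  have hC := E.measurableSet_link_points Γ J F A B
  have hD := E.measurableSet_nearPivotal Γ J F A B
  have hms := measurePreserving_assemble (d := d) ν s
  have hmt := measurePreserving_assemble (d := d) ν t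
  rw [← hms.measure_preimage hC.nullMeasurableSet, ← hmt.measure_preimage hC.nullMeasurableSet]
  simp_rw [fun e => (hms.measure_preimage (hD e).nullMeasurableSet).symm]
  refine prod_add_sum_le _ _ _ (hms.measurable hC) G (fun e => hms.measurable (hD e)) _ fun r => ?_
  have hsec : MeasurableSet (Prod.mk r ⁻¹' (assemble ⁻¹' {ω | Link (E.points Γ J F ω) A B})) :=
    measurable_prodMk_left (hms.measurable hC)
  have key := PoissonCounts.law_add_sum_clear_le (s := s.toNNReal) (t := t.toNNReal)
    (Real.toNNReal_pos.2 hs) (Real.toNNReal_le_toNNReal hst) (E.fine F ×ˢ Finset.range J) hsec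
    (fun n n' hn h => h.mono (E.points_assemble_mono Γ J F r hn))
    (fun n n' hn => by
      simp only [mem_preimage, mem_ofPred_eq]
      rw [E.points_assemble_congr Γ J F r hn])
    G (fun e => E.fine (F ∩ near e) ×ˢ Finset.range J)
    (fun e _ => Finset.product_subset_product_left fun k hk =>
      E.mem_fine.2 (Finset.mem_inter.1 (E.mem_fine.1 hk)).1)
    (m := 3 ^ d * E.N ^ d * J) (r := 3 ^ d)
    (fun e _ => by
      rw [Finset.card_product, Finset.card_range]
      refine Nat.mul_le_mul_right _ ((E.card_fine_le _).trans (Nat.mul_le_mul_right _ ?_))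
      rw [← card_near e]
      exact Finset.card_le_card Finset.inter_subset_right)
    (fun i _ => by
      rw [← card_near (E.coarse i.1), ← Set.ncard_coe_finset]
      refine Set.ncard_le_ncard ?_ (Finset.finite_toSet _)
      rintro e ⟨-, he⟩
      have := (Finset.mem_inter.1 (E.mem_fine.1 (Finset.mem_product.1 he).1)).2
      rw [Finset.mem_coe, mem_near]
      intro j
      rw [abs_sub_comm]
      exact mem_near.1 this j) (by positivity)
  rw [hs', ht'] at key
  refine le_trans (le_of_eq ?_) key
  congr 2
  refine Finset.sum_congr rfl fun e _ => ?_
  congr 1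
  ext n
  simp only [mem_preimage, nearPivotal, mem_ofPred_eq]
  rw [E.points_assemble_clear Γ J F (near e) r n]

theorem jointLaw_link_mono (ν : Measure S) [IsProbabilityMeasure ν] (J : ℕ)
    (F : Finset (Lattice d)) (A B : Set (EuclideanSpace ℝ (Fin d))) :
    Monotone fun lam => jointLaw d ν lam {ω | Link (E.points Γ J F ω) A B} := by
  classical
  intro s t hst
  have hC := E.measurableSet_link_points Γ J F A B
  have hms := measurePreserving_assemble (d := d) ν s
  have hmt := measurePreserving_assemble (d := d) ν t
  simp only
  rw [← hms.measure_preimage hC.nullMeasurableSet, ← hmt.measure_preimage hC.nullMeasurableSet,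
    Measure.prod_apply (hms.measurable hC), Measure.prod_apply (hmt.measurable hC)]
  refine lintegral_mono fun r => ?_
  have hsec : MeasurableSet (Prod.mk r ⁻¹' (assemble ⁻¹' {ω | Link (E.points Γ J F ω) A B})) :=
    measurable_prodMk_left (hms.measurable hC)
  refine (PoissonCounts.law_le_law_raise (Real.toNNReal_le_toNNReal hst)
    (E.fine F ×ˢ Finset.range J) hsec
    (fun n n' hn h => h.mono (E.points_assemble_mono Γ J F r hn))).trans (le_of_eq ?_)
  refine PoissonCounts.law_raise_eq _ _ _ hsec fun n n' hn => ?_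
  simp only [mem_preimage, mem_ofPred_eq]
  rw [E.points_assemble_congr Γ J F r hn]

end FactorEnvironment

end CoxPercolation

end

noncomputable section

namespace CoxPercolation

/-! ### Chains crossing shells -/

section SupNorm

variable {d : ℕ}

/-- The `ℓ^∞`-norm of a vector in Euclidean space. -/
def supNorm (p : EuclideanSpace ℝ (Fin d)) : ℝ := ‖(WithLp.ofLp p : Fin d → ℝ)‖

theorem supNorm_le_iff {p : EuclideanSpace ℝ (Fin d)} {r : ℝ} (hr : 0 ≤ r) :
    supNorm p ≤ r ↔ ∀ i, |p i| ≤ r := by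
  rw [supNorm, pi_norm_le_iff_of_nonneg hr]; rfl

theorem abs_apply_le_supNorm (p : EuclideanSpace ℝ (Fin d)) (i : Fin d) : |p i| ≤ supNorm p :=
  norm_le_pi_norm (WithLp.ofLp p) i

theorem supNorm_sub_le_dist (p q : EuclideanSpace ℝ (Fin d)) : supNorm (p - q) ≤ dist p q := by
  rw [supNorm_le_iff dist_nonneg, dist_eq_norm]
  intro i
  exact PiLp.norm_apply_le (p - q) i

theorem abs_supNorm_sub_supNorm_le (p q : EuclideanSpace ℝ (Fin d)) :
    |supNorm p - supNorm q| ≤ supNorm (p - q) := by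
  simp only [supNorm, WithLp.ofLp_sub]; exact abs_norm_sub_norm_le _ _

theorem supNorm_nonneg (p : EuclideanSpace ℝ (Fin d)) : 0 ≤ supNorm p := norm_nonneg _

theorem abs_supNorm_sub_lt {p q : EuclideanSpace ℝ (Fin d)} {r : ℝ} (h : dist p q < r) :
    |supNorm p - supNorm q| < r :=
  ((abs_supNorm_sub_supNorm_le p q).trans (supNorm_sub_le_dist p q)).trans_lt h

theorem mem_box_iff {p : EuclideanSpace ℝ (Fin d)} {r : ℝ} (hr : 0 ≤ r) :
    p ∈ box d r ↔ supNorm p ≤ r := (supNorm_le_iff hr).symm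

end SupNorm

namespace FactorEnvironment

variable {d : ℕ} {S : Type*} [MeasurableSpace S] (E : FactorEnvironment d S)

theorem mem_shell_iff {r : ℝ} (hr : 2 * E.M ≤ r) {p : EuclideanSpace ℝ (Fin d)} :
    p ∈ E.shell r ↔ r - 2 * E.M < supNorm p ∧ supNorm p ≤ r - E.M := by
  have hM := E.one_le_M
  rw [shell, Set.mem_sdiff, mem_box_iff (by linarith), mem_box_iff (by linarith), not_le, and_comm]

/-- A chain that starts inside a shell either stays inside or reaches the shell without going
beyond it. -/
theorem chain_dichotomy {X : Set (EuclideanSpace ℝ (Fin d))} {x y : EuclideanSpace ℝ (Fin d)}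
    {r : ℝ} (hr : 2 * E.M ≤ r) (hxr : supNorm x ≤ r - 2 * E.M)
    (hc : Relation.ReflTransGen (Step X) x y) :
    (∃ z ∈ X, z ∈ E.shell r ∧
      Relation.ReflTransGen (Step (X ∩ {p | supNorm p ≤ r - E.M})) x z) ∨
    (Relation.ReflTransGen (Step (X ∩ {p | supNorm p ≤ r - E.M})) x y ∧
      supNorm y ≤ r - 2 * E.M) := by
  have hM := E.one_le_M
  induction hc with
  | refl => exact Or.inr ⟨.refl, hxr⟩
  | @tail y z _ hs ih =>
    rcases ih with h | ⟨hc, hy⟩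
    · exact Or.inl h
    -- A step changes the sup-norm by less than 1 ≤ M, the thickness of the shell, so it cannot jump
    -- across.
    · have h1 := abs_lt.1 (abs_supNorm_sub_lt hs.2.2)
      have hz : supNorm z ≤ r - E.M := by linarith
      have hstep : Step (X ∩ {p | supNorm p ≤ r - E.M}) y z :=
        ⟨⟨hs.1, show supNorm y ≤ r - E.M by linarith⟩, ⟨hs.2.1, hz⟩, hs.2.2⟩
      by_cases hz' : supNorm z ≤ r - 2 * E.M
      · exact Or.inr ⟨hc.tail hstep, hz'⟩
      · exact Or.inl ⟨z, hs.2.1, (E.mem_shell_iff hr).2 ⟨not_le.1 hz', hz⟩, hc.tail hstep⟩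

theorem supNorm_lt_of_mem_thickening_box {x : EuclideanSpace ℝ (Fin d)} {r δ : ℝ} (hr : 0 ≤ r)
    (hx : x ∈ Metric.thickening δ (box d r)) : supNorm x < r + δ := by
  obtain ⟨a, ha, hxa⟩ := Metric.mem_thickening_iff.1 hx
  have h1 := (mem_box_iff hr).1 ha
  have h2 := abs_lt.1 (abs_supNorm_sub_lt hxa)
  linarith

theorem lt_supNorm_of_mem_thickening_shell {y : EuclideanSpace ℝ (Fin d)} {r δ : ℝ}
    (hr : 2 * E.M ≤ r) (hy : y ∈ Metric.thickening δ (E.shell r)) :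
    r - 2 * E.M - δ < supNorm y := by
  obtain ⟨a, ha, hya⟩ := Metric.mem_thickening_iff.1 hy
  have h1 := (E.mem_shell_iff hr).1 ha
  have h2 := abs_lt.1 (abs_supNorm_sub_lt hya)
  linarith

/-- The coarse sites that matter for the connection to `∂Λ_n`. -/
def window (d n : ℕ) : Finset (Lattice d) := Finset.Icc (fun _ => -(n : ℤ) - 1) (fun _ => n)

theorem mem_window_of_cell {n : ℕ} {z : Lattice d} {q : EuclideanSpace ℝ (Fin d)}
    (hq : q ∈ E.cell z) (hn : supNorm q ≤ n) : z ∈ window d n := by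
  have hM := E.one_le_M
  rw [window, Finset.mem_Icc, Pi.le_def, Pi.le_def]
  have key : ∀ i, -(n : ℝ) - 1 ≤ z i ∧ (z i : ℝ) ≤ n := by
    intro i
    have h1 := abs_le.1 ((abs_apply_le_supNorm q i).trans hn)
    have h2 := hq i
    have hn0 : (0 : ℝ) ≤ n := Nat.cast_nonneg n
    constructor
    · by_contra hcon
      push Not at hcon
      nlinarith
    · by_contra hcon
      push Not at hcon
      nlinarith
  constructor
  · intro i
    have := (key i).1
    exact_mod_cast this
  · intro i
    have := (key i).2
    exact_mod_cast this

variable (Γ : cube d (E.M / E.N) ≃ᵐ unitInterval)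

/-- A chain may be stopped when it first enters the shell, so only points within the outer radius
matter; they lie in finitely many blocks. -/
theorem link_points_window_iff (J : ℕ) {n : ℕ} (hn : 5 * E.M + 1 / 2 ≤ n)
    (ω : (Lattice d → S) × (Lattice d → PoissonSample)) :
    Link (E.points Γ J univ ω) (box d (3 * E.M)) (E.shell n) ↔
      Link (E.points Γ J (window d n) ω) (box d (3 * E.M)) (E.shell n) := by
  have hM := E.one_le_M
  refine ⟨?_, fun h => h.mono (E.points_mono Γ J (subset_univ _) ω)⟩
  rintro ⟨x, hx, y, hy, hxA, hyB, hc⟩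
  have hsub : E.points Γ J univ ω ∩ {p | supNorm p ≤ n - E.M} ⊆
      E.points Γ J (window d n) ω := by
    rintro q ⟨hq, hqn⟩
    obtain ⟨z, -, hqz, hq'⟩ := E.exists_mem_cell Γ hq
    have hqn' : supNorm q ≤ n - E.M := hqn
    exact E.points_mono Γ J (singleton_subset_iff.2
      (E.mem_window_of_cell hqz (by linarith))) ω hq'
  have hx' := supNorm_lt_of_mem_thickening_box (by linarith) hxA
  have hxF : x ∈ E.points Γ J (window d n) ω :=
    hsub ⟨hx, show supNorm x ≤ n - E.M by linarith⟩
  rcases E.chain_dichotomy (r := n) (by linarith) (by linarith) hc with ⟨z, hz, hzs, hcz⟩ | ⟨hcy, hyn⟩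
  · refine ⟨x, hxF, z, hsub ⟨hz, ((E.mem_shell_iff (by linarith)).1 hzs).2⟩, hxA,
      Metric.self_subset_thickening (by norm_num) _ hzs, chain_mono hsub hcz⟩
  · exact ⟨x, hxF, y, hsub ⟨hy, show supNorm y ≤ n - E.M by linarith⟩, hxA, hyB,
      chain_mono hsub hcy⟩

/-! ### Exploring the clusters of a shell -/

/-- The coarse sites of `F` whose block is determined by the coordinates in `R`. -/
def known (F R : Finset (Lattice d)) : Set (Lattice d) := {z | z ∈ F ∧ near z ⊆ R}

/-- The cell of `z` is within reach of the part of the clusters of the shell `∂Λ_k` known from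
the coordinates in `R`. -/
def Touched (J k : ℕ) (F R : Finset (Lattice d))
    (ω : (Lattice d → S) × (Lattice d → PoissonSample)) (z : Lattice d) : Prop :=
  z ∈ F ∧ ((E.cell z ∩ Metric.thickening (1 / 2) (E.shell k)).Nonempty ∨
    Link (E.points Γ J (known F R) ω) (Metric.thickening (1 / 2) (E.cell z)) (E.shell k))

theorem enlarge_known_subset (F R : Finset (Lattice d)) : enlarge (known F R) ⊆ R := by
  rintro w ⟨z, hz, hwz⟩
  exact hz.2 (mem_near.2 hwz)

theorem touched_congr (hdep : E.OneDependent) (J k : ℕ) {F R : Finset (Lattice d)}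
    {ω ω' : (Lattice d → S) × (Lattice d → PoissonSample)}
    (h : OSSS.Agree E.coarse (R : Set (Lattice d)) ω ω') (z : Lattice d) :
    E.Touched Γ J k F R ω z ↔ E.Touched Γ J k F R ω' z := by
  unfold Touched
  rw [E.points_congr Γ hdep J (h.mono (enlarge_known_subset F R))]

theorem measurableSet_touched (J k : ℕ) (F R : Finset (Lattice d)) (z : Lattice d) :
    MeasurableSet {ω | E.Touched Γ J k F R ω z} :=
  (MeasurableSet.const _).inter ((MeasurableSet.const _).union
    (E.measurableSet_link_points Γ J _ _ _))

open scoped Classical in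
/-- The coordinates that may be revealed next. -/
def eligible (J k : ℕ) (F R : Finset (Lattice d))
    (ω : (Lattice d → S) × (Lattice d → PoissonSample)) : Finset (Lattice d) :=
  {w ∈ F.biUnion near | w ∉ R ∧ ∃ z ∈ near w, E.Touched Γ J k F R ω z}

open scoped Classical in
/-- A choice of an element of a finite set. -/
def pick (s : Finset (Lattice d)) : Option (Lattice d) :=
  if h : s.Nonempty then some h.choose else none

theorem pick_mem {s : Finset (Lattice d)} {e : Lattice d} (h : pick s = some e) : e ∈ s := by
  unfold pick at h
  split_ifs at h with hs
  rw [← Option.some.inj h]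
  exact hs.choose_spec

theorem pick_eq_none {s : Finset (Lattice d)} (h : pick s = none) : s = ∅ := by
  unfold pick at h
  split_ifs at h with hs
  exact Finset.not_nonempty_iff_eq_empty.1 hs

open scoped Classical in
/-- The exploration of the clusters of the shell `∂Λ_k`. -/
def exploration (hdep : E.OneDependent) (J k : ℕ) (F : Finset (Lattice d)) :
    OSSS.Exploration E.coarse S PoissonSample (F.biUnion near) where
  next R ω := pick (E.eligible Γ J k F R ω)
  next_mem R ω e h := by
    have := Finset.mem_filter.1 (pick_mem h)
    exact ⟨this.1, this.2.1⟩
  next_congr R ω ω' h := by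
    have : E.eligible Γ J k F R ω = E.eligible Γ J k F R ω' := by
      ext w
      simp only [eligible, Finset.mem_filter, E.touched_congr Γ hdep J k h]
    rw [this]
  measurableSet_next R o := by
    have hw : ∀ w, MeasurableSet {ω | w ∈ E.eligible Γ J k F R ω} := by
      intro w
      have : {ω | w ∈ E.eligible Γ J k F R ω} =
          {_ω | w ∈ F.biUnion near} ∩ ({_ω | w ∉ R} ∩
            ⋃ z ∈ near w, {ω | E.Touched Γ J k F R ω z}) := by
        ext ω
        simp only [eligible, Finset.mem_filter, mem_ofPred_eq, mem_inter_iff, mem_iUnion,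
          exists_prop]
      rw [this]
      exact (MeasurableSet.const _).inter ((MeasurableSet.const _).inter
        (Finset.measurableSet_biUnion _ fun z _ => E.measurableSet_touched Γ J k F R z))
    have : {ω | pick (E.eligible Γ J k F R ω) = o} =
        ⋃ s ∈ (F.biUnion near).powerset, {_ω | pick s = o} ∩
          ⋂ w ∈ F.biUnion near, {ω | w ∈ E.eligible Γ J k F R ω ↔ w ∈ s} := by
      ext ω
      simp only [mem_ofPred_eq, mem_iUnion, mem_inter_iff, mem_iInter, Finset.mem_powerset,
        exists_prop]
      constructor
      · intro h
        exact ⟨_, Finset.filter_subset _ _, h, fun w _ => Iff.rfl⟩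
      · rintro ⟨s, hs, h, hiff⟩
        have : E.eligible Γ J k F R ω = s := by
          ext w
          by_cases hw : w ∈ F.biUnion near
          · exact hiff w hw
          · exact ⟨fun h' => absurd (Finset.filter_subset _ _ h') hw, fun h' => absurd (hs h') hw⟩
        rw [this, h]
    rw [this]
    exact Finset.measurableSet_biUnion _ fun s _ => (MeasurableSet.const _).inter
      (Finset.measurableSet_biInter _ fun w _ => (hw w).iff (.const _))

/-- When the rule stops, nothing is eligible: every coordinate needed to determine a touched block
has been revealed. -/
theorem near_subset_final (hdep : E.OneDependent) (J k : ℕ) (F : Finset (Lattice d))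
    (ω : (Lattice d → S) × (Lattice d → PoissonSample)) {z : Lattice d}
    (hz : E.Touched Γ J k F ((E.exploration Γ hdep J k F).final ω) ω z) :
    near z ⊆ (E.exploration Γ hdep J k F).final ω := by
  classical
  intro w hw
  by_contra hcon
  have h1 := pick_eq_none ((E.exploration Γ hdep J k F).next_final ω)
  have h2 : w ∈ E.eligible Γ J k F ((E.exploration Γ hdep J k F).final ω) ω := by
    refine Finset.mem_filter.2 ⟨Finset.mem_biUnion.2 ⟨z, hz.1, hw⟩, hcon, z, ?_, hz⟩
    rw [mem_near] at hw ⊢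
    intro i
    rw [abs_sub_comm]
    exact hw i
  rw [h1] at h2
  exact absurd h2 (Finset.notMem_empty w)

/-- The clusters of the shell are completely known when the exploration stops. -/
theorem chain_known (hdep : E.OneDependent) (J k : ℕ) (F : Finset (Lattice d))
    (ω : (Lattice d → S) × (Lattice d → PoissonSample)) {x y : EuclideanSpace ℝ (Fin d)}
    (hx : x ∈ E.points Γ J F ω) (hxk : x ∈ E.shell k)
    (hc : Relation.ReflTransGen (Step (E.points Γ J F ω)) x y) :
    y ∈ E.points Γ J (known F ((E.exploration Γ hdep J k F).final ω)) ω ∧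
    Relation.ReflTransGen
      (Step (E.points Γ J (known F ((E.exploration Γ hdep J k F).final ω)) ω)) x y := by
  have hxk' : x ∈ Metric.thickening (1 / 2) (E.shell k) :=
    Metric.self_subset_thickening (by norm_num) _ hxk
  induction hc with
  | refl =>
    refine ⟨?_, .refl⟩
    obtain ⟨z, hz, hxz, hxp⟩ := E.exists_mem_cell Γ hx
    have := E.near_subset_final Γ hdep J k F ω (z := z) ⟨hz, Or.inl ⟨x, hxz, hxk'⟩⟩
    exact E.points_mono Γ J (singleton_subset_iff.2 (show z ∈ known F _ from ⟨hz, this⟩)) ω hxp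
  | @tail y y' _ hs ih =>
    obtain ⟨hy, hcy⟩ := ih
    obtain ⟨z, hz, hyz, hyp⟩ := E.exists_mem_cell Γ hs.2.1
    -- The next point `y'` is at distance less than 1 = 1/2 + 1/2 from `y`, whence the doubly
    -- thickened cell in `Touched`.
    have hlink : Link (E.points Γ J (known F ((E.exploration Γ hdep J k F).final ω)) ω)
        (Metric.thickening (1 / 2) (E.cell z)) (E.shell k) := by
      have hx' : x ∈ E.points Γ J (known F ((E.exploration Γ hdep J k F).final ω)) ω := by
        rcases Relation.ReflTransGen.cases_head hcy with rfl | ⟨_, h, -⟩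
        · exact hy
        · exact h.1
      refine ⟨y, hy, x, hx', ?_, hxk', chain_symm hcy⟩
      rw [thickening_thickening (by norm_num) (by norm_num)]
      exact Metric.mem_thickening_iff.2 ⟨y', hyz, by norm_num; exact hs.2.2⟩
    have := E.near_subset_final Γ hdep J k F ω (z := z) ⟨hz, Or.inr hlink⟩
    have hy' := E.points_mono Γ J
      (singleton_subset_iff.2 (show z ∈ known F _ from ⟨hz, this⟩)) ω hyp
    exact ⟨hy', hcy.tail ⟨hy, hy', hs.2.2⟩⟩

/-- A chain from Λ_{3M} to ∂Λ_n has a point in ∂Λ_k. Followed from there in both directions, it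
stays in the clusters of that shell, which are known. -/
theorem link_iff_link_known (hdep : E.OneDependent) (J : ℕ) {k n : ℕ}
    (hk : 5 * E.M + 1 / 2 ≤ k) (hkn : k < n) (F : Finset (Lattice d))
    (ω : (Lattice d → S) × (Lattice d → PoissonSample)) :
    Link (E.points Γ J F ω) (box d (3 * E.M)) (E.shell n) ↔
      Link (E.points Γ J (known F ((E.exploration Γ hdep J k F).final ω)) ω)
        (box d (3 * E.M)) (E.shell n) := by
  have hM := E.one_le_M
  have hkn' : (k : ℝ) + 1 ≤ n := by exact_mod_cast hkn
  refine ⟨?_, fun h => h.mono (E.points_mono Γ J (fun z hz => hz.1) ω)⟩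
  rintro ⟨x, hx, y, hy, hxA, hyB, hc⟩
  have hx' := supNorm_lt_of_mem_thickening_box (by linarith) hxA
  have hy' := E.lt_supNorm_of_mem_thickening_shell (by linarith) hyB
  rcases E.chain_dichotomy (r := k) (by linarith) (by linarith) hc with ⟨z, hz, hzs, hcz⟩ | ⟨-, hyn⟩
  · have hcz' := chain_mono inter_subset_left hcz
    have h1 := E.chain_known Γ hdep J k F ω hz hzs (chain_symm hcz')
    have h2 := E.chain_known Γ hdep J k F ω hz hzs ((chain_symm hcz').trans hc)
    exact ⟨x, h1.1, y, h2.1, hxA, hyB, (chain_symm h1.2).trans h2.2⟩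
  · linarith

theorem exploration_determines (hdep : E.OneDependent) (J : ℕ) {k n : ℕ}
    (hk : 5 * E.M + 1 / 2 ≤ k) (hkn : k < n) (F : Finset (Lattice d))
    (ω ω' : (Lattice d → S) × (Lattice d → PoissonSample))
    (h : OSSS.Agree E.coarse ((E.exploration Γ hdep J k F).final ω : Set (Lattice d)) ω ω') :
    ω ∈ {ω | Link (E.points Γ J F ω) (box d (3 * E.M)) (E.shell n)} ↔
      ω' ∈ {ω | Link (E.points Γ J F ω) (box d (3 * E.M)) (E.shell n)} := by
  have hfinal : (E.exploration Γ hdep J k F).final ω' = (E.exploration Γ hdep J k F).final ω :=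
    (E.exploration Γ hdep J k F).revealed_congr h
  simp only [mem_ofPred_eq]
  rw [E.link_iff_link_known Γ hdep J hk hkn F ω, E.link_iff_link_known Γ hdep J hk hkn F ω',
    hfinal, E.points_congr Γ hdep J (h.mono (enlarge_known_subset F _))]

theorem exists_touched_of_mem_revealed (hdep : E.OneDependent) (J k : ℕ)
    (F : Finset (Lattice d)) (ω : (Lattice d → S) × (Lattice d → PoissonSample)) {w : Lattice d}
    {t : ℕ} (hw : w ∈ (E.exploration Γ hdep J k F).revealed ω t) :
    ∃ z ∈ near w, (E.cell z ∩ Metric.thickening (1 / 2) (E.shell k)).Nonempty ∨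
      Link (E.points Γ J univ ω) (Metric.thickening (1 / 2) (E.cell z)) (E.shell k) := by
  classical
  induction t with
  | zero => exact absurd hw (Finset.notMem_empty w)
  | succ t ih =>
    cases h : (E.exploration Γ hdep J k F).next
        ((E.exploration Γ hdep J k F).revealed ω t) ω with
    | none =>
      rw [(E.exploration Γ hdep J k F).revealed_succ_none h] at hw
      exact ih hw
    | some e =>
      rw [(E.exploration Γ hdep J k F).mem_revealed_succ_some h] at hw
      rcases hw with rfl | hw
      · obtain ⟨-, -, z, hz, -, h'⟩ := Finset.mem_filter.1 (pick_mem h)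
        exact ⟨z, hz, h'.imp_right fun hl => hl.mono (E.points_mono Γ J (subset_univ _) ω)⟩
      · exact ih hw

end FactorEnvironment

end CoxPercolation

end

noncomputable section

namespace CoxPercolation

/-! ### Averaging over the shells -/

theorem sum_shift_le {g : ℕ → ℝ} (hg0 : ∀ m, 0 ≤ g m) (hg1 : ∀ m, g m ≤ 1) (C n : ℕ) :
    ∑ m ∈ Finset.range n, g (m - C) ≤ C + ∑ m ∈ Finset.range n, g m := by
  induction C with
  | zero => simp
  | succ C ih =>
    refine le_trans (?_ : _ ≤ 1 + ∑ m ∈ Finset.range n, g (m - C)) (by push_cast; linarith)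
    cases n with
    | zero => simp
    | succ n =>
      rw [Finset.sum_range_succ', Finset.sum_range_succ]
      have h1 : ∀ m, g (m + 1 - (C + 1)) = g (m - C) := fun m => by congr 1; omega
      simp only [h1]
      linarith [hg1 (0 - (C + 1)), hg0 (n - C)]

/-- Here (k - a) + (a - k) is |k - a| in truncated subtraction. Either side of `a` contributes at
most C + ∑ g, and C is absorbed because ∑ g ≥ g 0 = 1. -/
theorem sum_dist_le {g : ℕ → ℝ} (hg0 : ∀ m, 0 ≤ g m) (hg1 : ∀ m, g m ≤ 1) (hg : Antitone g)
    (hg00 : g 0 = 1) (C a n₀ n : ℕ) (hn : 0 < n) :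
    ∑ k ∈ Finset.Ico n₀ n, g ((k - a) + (a - k) - C) ≤
      2 * (C + 1) * ∑ m ∈ Finset.range n, g m := by
  have h1 : ∑ k ∈ Finset.Ico n₀ n, g ((k - a) + (a - k) - C) ≤
      ∑ k ∈ Finset.range n, g ((k - a) + (a - k) - C) :=
    Finset.sum_le_sum_of_subset_of_nonneg
      (fun k hk => Finset.mem_range.2 (Finset.mem_Ico.1 hk).2) fun _ _ _ => hg0 _
  -- Since `a` may exceed `n`, it is replaced by `min a n` on the left; distances only shrink and
  -- `g` is decreasing.
  have h2 : ∑ k ∈ Finset.range n, g ((k - a) + (a - k) - C) ≤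
      ∑ k ∈ Finset.Ico a n, g (k - a - C) +
        ∑ k ∈ Finset.range (min a n), g (min a n - 1 - k - C) := by
    have : Finset.range n ⊆ Finset.Ico a n ∪ Finset.range (min a n) := by
      intro k hk
      simp only [Finset.mem_union, Finset.mem_Ico, Finset.mem_range, lt_min_iff] at hk ⊢
      omega
    refine (Finset.sum_le_sum_of_subset_of_nonneg this fun _ _ _ => hg0 _).trans ?_
    rw [Finset.sum_union (Finset.disjoint_left.2 fun k h h' => by
      simp only [Finset.mem_Ico, Finset.mem_range, lt_min_iff] at h h'; omega)]
    refine add_le_add (Finset.sum_le_sum fun k hk => hg ?_) (Finset.sum_le_sum fun k hk => hg ?_)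
    · omega
    · have := Finset.mem_range.1 hk
      omega
  have h3 : ∑ k ∈ Finset.Ico a n, g (k - a - C) ≤ ∑ m ∈ Finset.range n, g (m - C) := by
    rw [Finset.sum_Ico_eq_sum_range]
    simp only [Nat.add_sub_cancel_left]
    exact Finset.sum_le_sum_of_subset_of_nonneg (Finset.range_mono (Nat.sub_le n a))
      fun _ _ _ => hg0 _
  have h4 : ∑ k ∈ Finset.range (min a n), g (min a n - 1 - k - C) ≤
      ∑ m ∈ Finset.range n, g (m - C) := by
    rw [Finset.sum_range_reflect (fun k => g (k - C))]
    exact Finset.sum_le_sum_of_subset_of_nonneg (Finset.range_mono (min_le_right a n))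
      fun _ _ _ => hg0 _
  have h5 := sum_shift_le hg0 hg1 C n
  have h6 : 1 ≤ ∑ m ∈ Finset.range n, g m := by
    have := Finset.single_le_sum (f := g) (fun k _ => hg0 k) (Finset.mem_range.2 hn)
    linarith
  have h7 : (0 : ℝ) ≤ C := Nat.cast_nonneg C
  nlinarith

namespace FactorEnvironment

variable {d : ℕ} {S : Type*} [MeasurableSpace S] (E : FactorEnvironment d S)

theorem supNorm_sub_origin_le {w z : Lattice d} (hz : z ∈ near w) {q : EuclideanSpace ℝ (Fin d)}
    (hq : q ∈ E.cell z) : supNorm (q - E.origin w) ≤ 2 * E.M := by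
  have hM := E.one_le_M
  rw [supNorm_le_iff (by linarith)]
  intro i
  have h1 := abs_le.1 (mem_near.1 hz i)
  have h2 : (-1 : ℝ) ≤ (z i : ℝ) - w i := by exact_mod_cast h1.1
  have h3 : (z i : ℝ) - w i ≤ 1 := by exact_mod_cast h1.2
  have h4 := hq i
  have h5 : (q - E.origin w) i = q i - E.M * w i := rfl
  rw [h5, abs_le]
  constructor <;> nlinarith

variable (ν : Measure S) [IsProbabilityMeasure ν] (Γ : cube d (E.M / E.N) ≃ᵐ unitInterval)

/-- The connection probability as a real number. -/
def connReal (n : ℕ) (lam : ℝ) : ℝ := (E.connProb ν Γ lam n).toReal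

theorem connProb_le_one (lam : ℝ) (n : ℕ) : E.connProb ν Γ lam n ≤ 1 := prob_le_one

theorem ofReal_connReal (lam : ℝ) (n : ℕ) :
    ENNReal.ofReal (E.connReal ν Γ n lam) = E.connProb ν Γ lam n :=
  ENNReal.ofReal_toReal (ne_top_of_le_ne_top ENNReal.one_ne_top (E.connProb_le_one ν Γ lam n))

theorem connReal_nonneg (n : ℕ) (lam : ℝ) : 0 ≤ E.connReal ν Γ n lam := ENNReal.toReal_nonneg

theorem connReal_le_one (n : ℕ) (lam : ℝ) : E.connReal ν Γ n lam ≤ 1 :=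
  ENNReal.toReal_le_of_le_ofReal zero_le_one (by simpa using E.connProb_le_one ν Γ lam n)

theorem connReal_anti (lam : ℝ) {m n : ℕ} (hm : 5 * E.M ≤ m) (hmn : m ≤ n) :
    E.connReal ν Γ n lam ≤ E.connReal ν Γ m lam :=
  ENNReal.toReal_mono (measure_ne_top _ _) (measure_mono fun _ hω =>
    E.connected_shell_of_le _ hm (by exact_mod_cast hmn) hω)

theorem connProb_eq_window {ρ : ℝ≥0} (hρ : ∀ᵐ Y ∂(iidLaw d ν), ∀ k, E.U k Y ≤ ρ) {J : ℕ}
    (hJ : ρ < J) (lam : ℝ) {n : ℕ} (hn : 5 * E.M + 1 / 2 ≤ n) :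
    E.connProb ν Γ lam n = jointLaw d ν lam
      {ω | Link (E.points Γ J (window d n) ω) (box d (3 * E.M)) (E.shell n)} := by
  rw [E.connProb_eq Γ ν hρ hJ]
  simp_rw [E.link_points_window_iff Γ J hn]

/-- The probability that the coordinates of `w` are revealed by the exploration of `∂Λ_k`. -/
theorem measure_mem_final_le {ρ : ℝ≥0} (hρ : ∀ᵐ Y ∂(iidLaw d ν), ∀ k, E.U k Y ≤ ρ) {J : ℕ}
    (hJ : ρ < J) (hdep : E.OneDependent) {n₁ C k : ℕ} (hn₁ : 5 * E.M + 1 / 2 ≤ n₁)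
    (hC : 5 * E.M + 3 ≤ C) (hk : 2 * E.M ≤ k) (F : Finset (Lattice d)) (w : Lattice d)
    (lam : ℝ) :
    jointLaw d ν lam {ω | w ∈ (E.exploration Γ hdep J k F).final ω} ≤
      ENNReal.ofReal (SharpThreshold.padded (E.connReal ν Γ) n₁
        ((k - ⌊supNorm (E.origin w)⌋₊) + (⌊supNorm (E.origin w)⌋₊ - k) - C) lam) := by
  have hM := E.one_le_M
  set a := ⌊supNorm (E.origin w)⌋₊ with ha
  set m := (k - a) + (a - k) - C with hm
  have ha1 : (a : ℝ) ≤ supNorm (E.origin w) := Nat.floor_le (supNorm_nonneg _)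
  have ha2 : supNorm (E.origin w) < a + 1 := Nat.lt_floor_add_one _
  rw [SharpThreshold.padded]
  -- If `w` is too close to the shell, the padded value is 1 and there is nothing to prove.
  split_ifs with hmn
  · rw [ENNReal.ofReal_one]; exact prob_le_one
  push Not at hmn
  rw [E.ofReal_connReal, E.connProb_eq Γ ν hρ hJ,
    ← (E.measurePreserving_shift ν lam w).measure_preimage
      (E.measurableSet_link_points Γ J univ _ _).nullMeasurableSet]
  have hmn' : (n₁ : ℝ) ≤ m := by exact_mod_cast hmn
  have hdist : (m : ℝ) + C ≤ |(k : ℝ) - a| := by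
    have h0 : m + C = (k - a) + (a - k) := by
      have : 0 < m := by
        have : (0 : ℝ) < m := by linarith
        exact_mod_cast this
      omega
    rcases le_total a k with h | h
    · have h1 : m + C + a = k := by omega
      have h1' : (m : ℝ) + C + a = k := by exact_mod_cast h1
      rw [abs_of_nonneg] <;> linarith [(m : ℕ).cast_nonneg (α := ℝ), (C : ℕ).cast_nonneg (α := ℝ)]
    · have h1 : m + C + k = a := by omega
      have h1' : (m : ℝ) + C + k = a := by exact_mod_cast h1
      rw [abs_of_nonpos] <;> linarith [(m : ℕ).cast_nonneg (α := ℝ), (C : ℕ).cast_nonneg (α := ℝ)]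
  -- From the corner of the cell of `w` the shell is at distance at least |k - a|, up to 2M for its
  -- position relative to radius k and 1 for the integer part in `a`.
  have hfar : ∀ c ∈ E.shell k, (m : ℝ) + C - 2 * E.M - 1 ≤ supNorm (c - E.origin w) := by
    intro c hc
    have h1 := (E.mem_shell_iff hk).1 hc
    have h2 := abs_le.1 (abs_supNorm_sub_supNorm_le c (E.origin w))
    rcases abs_cases ((k : ℝ) - a) with ⟨h3, -⟩ | ⟨h3, -⟩ <;> rw [h3] at hdist <;> linarith
  refine measure_mono fun ω hω => ?_
  obtain ⟨z, hz, ⟨q, hqz, hq⟩ | hl⟩ := E.exists_touched_of_mem_revealed Γ hdep J k F ω hω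
  · exfalso
    obtain ⟨c, hc, hqc⟩ := Metric.mem_thickening_iff.1 hq
    have h1 := hfar c hc
    have h2 := E.supNorm_sub_origin_le hz hqz
    have h3 : dist (q - E.origin w) (c - E.origin w) < 1 / 2 := by simpa using hqc
    have h4 := abs_lt.1 (abs_supNorm_sub_lt h3)
    linarith
  · obtain ⟨x, hx, y, hy, hxA, hyB, hc⟩ := E.link_shift Γ J w ω _ _ hl
    -- The chain starts within 1/2 + 1/2 of a cell next to `w`, hence after translation within 2M +
    -- 1 ≤ 3M of the origin; this explains the inner box Λ_{3M}.
    have hx' : supNorm x ≤ 3 * E.M := by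
      obtain ⟨a₁, ha₁, hxa₁⟩ := Metric.mem_thickening_iff.1 hxA
      have ha₁' : a₁ + E.origin w ∈ Metric.thickening (1 / 2) (E.cell z) := ha₁
      obtain ⟨a₂, ha₂, ha₁₂⟩ := Metric.mem_thickening_iff.1 ha₁'
      have h1 := E.supNorm_sub_origin_le hz ha₂
      have h2 : dist a₁ (a₂ - E.origin w) < 1 / 2 := by
        have : dist a₁ (a₂ - E.origin w) = dist (a₁ + E.origin w) a₂ := by
          rw [dist_eq_norm, dist_eq_norm]; congr 1; abel
        rw [this]; exact ha₁₂
      have h3 := abs_lt.1 (abs_supNorm_sub_lt hxa₁)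
      have h4 := abs_lt.1 (abs_supNorm_sub_lt h2)
      linarith
    have hy' : (m : ℝ) - 2 * E.M < supNorm y := by
      obtain ⟨c, hc, hyc⟩ := Metric.mem_thickening_iff.1 hyB
      have hc' : c + E.origin w ∈ E.shell k := hc
      have h1 := hfar _ hc'
      have h2 := abs_lt.1 (abs_supNorm_sub_lt hyc)
      simp only [add_sub_cancel_right] at h1
      linarith
    rcases E.chain_dichotomy (r := m) (by linarith) (by linarith) hc with
      ⟨z', hz', hzs, hcz⟩ | ⟨-, hyn⟩
    · exact ⟨x, hx, z', hz', Metric.self_subset_thickening (by norm_num) _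
        ((mem_box_iff (by linarith)).2 hx'), Metric.self_subset_thickening (by norm_num) _ hzs,
        chain_mono inter_subset_left hcz⟩
    · exact absurd hyn (not_le.2 hy')

/-- With a probability bounded from below there are no points near `Λ_{3M}`. -/
theorem jointLaw_link_le {J : ℕ} (lam : ℝ) (hlam : 0 ≤ lam) (F : Finset (Lattice d))
    (B : Set (EuclideanSpace ℝ (Fin d))) :
    jointLaw d ν lam {ω | Link (E.points Γ J F ω) (box d (3 * E.M)) B} ≤
      1 - ENNReal.ofReal (Real.exp (-((E.fine (window d 4) ×ˢ Finset.range J).card * lam))) := by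
  classical
  have hM := E.one_le_M
  have hC := E.measurableSet_link_points Γ J F (box d (3 * E.M)) B
  have hm := measurePreserving_assemble (d := d) ν lam
  rw [← hm.measure_preimage hC.nullMeasurableSet, Measure.prod_apply (hm.measurable hC)]
  set T := E.fine (window d 4) ×ˢ Finset.range J with hT
  have hsec : ∀ r, PoissonCounts.law (fun _ => lam.toNNReal) (Prod.mk r ⁻¹'
      (assemble ⁻¹' {ω | Link (E.points Γ J F ω) (box d (3 * E.M)) B})) ≤
      1 - ENNReal.ofReal (Real.exp (-(T.card * lam))) := by
    intro r
    set D : Set (Lattice d × ℕ → ℕ) := Prod.mk r ⁻¹'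
      (assemble ⁻¹' {ω | Link (E.points Γ J F ω) (box d (3 * E.M)) B}) with hD
    have hDm : MeasurableSet D := measurable_prodMk_left (hm.measurable hC)
    -- With all counts near Λ_{3M} set to zero no chain can start there, so the finite energy
    -- estimate bounds the complement from below.
    have h1 : {n | PoissonCounts.clear T n ∈ Dᶜ} = univ := by
      refine eq_univ_of_forall fun n => ?_
      rintro ⟨x, hx, -, -, hxA, -⟩
      have hx' := supNorm_lt_of_mem_thickening_box (by linarith) hxA
      obtain ⟨a, ⟨h1, h2, h3, -⟩, rfl⟩ := hx
      have hmem : (a.1, a.2.1) ∈ T := by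
        refine Finset.mem_product.2 ⟨E.mem_fine.2 ?_, Finset.mem_range.2 h2⟩
        have h4 := E.position_mem_cell Γ (assemble (r, PoissonCounts.clear T n)) a
        rw [window, Finset.mem_Icc, Pi.le_def, Pi.le_def]
        have key : ∀ i, (-5 : ℝ) < E.coarse a.1 i ∧ (E.coarse a.1 i : ℝ) < 4 := by
          intro i
          have h5 := abs_le.1 (abs_apply_le_supNorm
            (E.position Γ (assemble (r, PoissonCounts.clear T n)) a) i)
          have h6 := h4 i
          constructor
          · by_contra hcon
            push Not at hcon
            nlinarith
          · by_contra hcon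
            push Not at hcon
            nlinarith
        refine ⟨fun i => ?_, fun i => ?_⟩
        · have : (-5 : ℤ) < E.coarse a.1 i := by exact_mod_cast (key i).1
          push_cast
          linarith
        · have : E.coarse a.1 i < (4 : ℤ) := by exact_mod_cast (key i).2
          push_cast
          linarith
      simp [assemble, PoissonCounts.clear, hmem] at h3
    have h2 := PoissonCounts.law_clear_le lam.toNNReal T hDm.compl
    rw [h1, measure_univ, Real.coe_toNNReal _ hlam, prob_compl_eq_one_sub hDm] at h2
    have h3 : ENNReal.ofReal (Real.exp (-(T.card * lam))) ≤
        1 - PoissonCounts.law (fun _ => lam.toNNReal) D := by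
      calc _ = ENNReal.ofReal (Real.exp (-(T.card * lam))) * 1 := (mul_one _).symm
        _ ≤ ENNReal.ofReal (Real.exp (-(T.card * lam))) *
            (ENNReal.ofReal (Real.exp (T.card * lam)) *
              (1 - PoissonCounts.law (fun _ => lam.toNNReal) D)) := by gcongr
        _ = _ := by
            rw [← mul_assoc, ← ENNReal.ofReal_mul (Real.exp_pos _).le, ← Real.exp_add]
            simp
    have h4 := tsub_le_tsub_left h3 1
    rwa [ENNReal.sub_sub_cancel ENNReal.one_ne_top prob_le_one] at h4
  refine (lintegral_mono hsec).trans ?_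
  rw [lintegral_const, measure_univ, mul_one]

theorem connReal_le {ρ : ℝ≥0} (hρ : ∀ᵐ Y ∂(iidLaw d ν), ∀ k, E.U k Y ≤ ρ) {J : ℕ}
    (hJ : ρ < J) (lam : ℝ) (hlam : 0 ≤ lam) {n : ℕ} (hn : 5 * E.M + 1 / 2 ≤ n) :
    E.connReal ν Γ n lam ≤
      1 - Real.exp (-((E.fine (window d 4) ×ˢ Finset.range J).card * lam)) := by
  have h1 : Real.exp (-((E.fine (window d 4) ×ˢ Finset.range J).card * lam)) ≤ 1 :=
    Real.exp_le_one_iff.2 (neg_nonpos.2 (by positivity))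
  refine ENNReal.toReal_le_of_le_ofReal (by linarith) ?_
  rw [E.connProb_eq_window ν Γ hρ hJ lam hn, ENNReal.ofReal_sub _ (Real.exp_pos _).le,
    ENNReal.ofReal_one]
  exact E.jointLaw_link_le ν Γ lam hlam _ _

theorem connReal_mono {ρ : ℝ≥0} (hρ : ∀ᵐ Y ∂(iidLaw d ν), ∀ k, E.U k Y ≤ ρ) {J : ℕ}
    (hJ : ρ < J) {n : ℕ} (hn : 5 * E.M + 1 / 2 ≤ n) : Monotone (E.connReal ν Γ n) := by
  intro s t hst
  refine ENNReal.toReal_mono (measure_ne_top _ _) ?_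
  rw [E.connProb_eq_window ν Γ hρ hJ s hn, E.connProb_eq_window ν Γ hρ hJ t hn]
  exact E.jointLaw_link_mono Γ ν J _ _ _ hst

/-- The OSSS inequality, averaged over the shells. -/
theorem osss_average {ρ : ℝ≥0} (hρ : ∀ᵐ Y ∂(iidLaw d ν), ∀ k, E.U k Y ≤ ρ) {J : ℕ}
    (hJ : ρ < J) (hdep : E.OneDependent) {n₀ C n : ℕ} (hn₀ : 5 * E.M + 1 / 2 ≤ n₀)
    (hC : 5 * E.M + 3 ≤ C) (hn : 2 * n₀ ≤ n) (lam : ℝ) :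
    (n - n₀) * (E.connReal ν Γ n lam * (1 - E.connReal ν Γ n lam)) ≤
      4 * (C + 1) * SharpThreshold.partialSum (E.connReal ν Γ) (2 * n₀) n lam *
        (∑ e ∈ (open scoped Classical in (window d n).biUnion near), jointLaw d ν lam
          (E.nearPivotal Γ J (window d n) (box d (3 * E.M)) (E.shell n) e)).toReal := by
  classical
  have hM := E.one_le_M
  have hn₀pos : 0 < n₀ := by
    have : (0 : ℝ) < n₀ := by linarith
    exact_mod_cast this
  have hnn₀ : (n₀ : ℝ) ≤ n := by
    have : n₀ ≤ n := by omega
    exact_mod_cast this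
  set F := window d n with hF
  set q : Lattice d → ℝ≥0∞ := fun e => jointLaw d ν lam
    (E.nearPivotal Γ J F (box d (3 * E.M)) (E.shell n) e) with hq
  have hqt : ∀ e, q e ≠ ∞ := fun e => measure_ne_top _ _
  set g : ℕ → ℝ := fun m => SharpThreshold.padded (E.connReal ν Γ) (2 * n₀) m lam with hg
  have hg0 : ∀ m, 0 ≤ g m := fun m =>
    SharpThreshold.padded_nonneg (fun n x => E.connReal_nonneg ν Γ n x) m lam
  have hg1 : ∀ m, g m ≤ 1 := fun m => by
    simp only [hg, SharpThreshold.padded]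
    split_ifs
    · exact le_rfl
    · exact E.connReal_le_one ν Γ _ _
  have hganti : Antitone g := by
    intro m m' hmm
    simp only [hg, SharpThreshold.padded]
    split_ifs with h1 h2
    · exact le_rfl
    · omega
    · exact E.connReal_le_one ν Γ _ _
    · refine E.connReal_anti ν Γ lam ?_ hmm
      have : n₀ ≤ m := by omega
      have : (n₀ : ℝ) ≤ m := by exact_mod_cast this
      linarith
  have hg00 : g 0 = 1 := by simp [hg, SharpThreshold.padded, hn₀pos]
  set a : Lattice d → ℕ := fun e => ⌊supNorm (E.origin e)⌋₊ with ha
  set p := E.connReal ν Γ n lam with hp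
  -- One OSSS inequality for each shell. The influences do not depend on `k`, so summing over `k`
  -- affects only the revealment bounds.
  have hstep : ∀ k ∈ Finset.Ico n₀ n, p ≤ p * p +
      ∑ e ∈ F.biUnion near, g ((k - a e) + (a e - k) - C) * (2 * (q e).toReal) := by
    intro k hk
    obtain ⟨hk1, hk2⟩ := Finset.mem_Ico.1 hk
    have hk1' : (n₀ : ℝ) ≤ k := by exact_mod_cast hk1
    have h1 := (E.exploration Γ hdep J k F).osss ν (poissonLaw lam.toNNReal)
      (E.measurableSet_link_points Γ J F (box d (3 * E.M)) (E.shell n))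
      (E.exploration_determines Γ hdep J (by linarith) hk2 F)
    change jointLaw d ν lam _ ≤ jointLaw d ν lam _ * jointLaw d ν lam _ + _ at h1
    rw [← E.connProb_eq_window ν Γ hρ hJ lam (by linarith)] at h1
    have h2 : E.connProb ν Γ lam n ≤ E.connProb ν Γ lam n * E.connProb ν Γ lam n +
        ∑ e ∈ F.biUnion near, ENNReal.ofReal (g ((k - a e) + (a e - k) - C)) * (2 * q e) := by
      refine h1.trans ?_
      gcongr with e he
      · exact E.measure_mem_final_le ν Γ hρ hJ hdep (by push_cast; linarith) hC (by linarith) F e lam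
      · exact E.influence_le Γ hdep ν lam J F _ _ e
    rw [← E.ofReal_connReal] at h2
    have h3 : ∑ e ∈ F.biUnion near, ENNReal.ofReal (g ((k - a e) + (a e - k) - C)) * (2 * q e) =
        ENNReal.ofReal (∑ e ∈ F.biUnion near,
          g ((k - a e) + (a e - k) - C) * (2 * (q e).toReal)) := by
      rw [ENNReal.ofReal_sum_of_nonneg fun e _ => mul_nonneg (hg0 _) (by positivity)]
      refine Finset.sum_congr rfl fun e _ => ?_
      rw [ENNReal.ofReal_mul (hg0 _), ENNReal.ofReal_mul zero_le_two,
        ENNReal.ofReal_toReal (hqt e)]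
      simp
    have hp0 := E.connReal_nonneg ν Γ n lam
    rw [h3, ← ENNReal.ofReal_mul hp0, ← ENNReal.ofReal_add (mul_nonneg hp0 hp0)
      (Finset.sum_nonneg fun e _ => mul_nonneg (hg0 _) (by positivity))] at h2
    refine (ENNReal.ofReal_le_ofReal_iff ?_).1 h2
    exact add_nonneg (mul_nonneg hp0 hp0)
      (Finset.sum_nonneg fun e _ => mul_nonneg (hg0 _) (by positivity))
  have hsum := Finset.sum_le_sum hstep
  rw [Finset.sum_const, Finset.sum_add_distrib, Finset.sum_const, Nat.card_Ico, Finset.sum_comm,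
    nsmul_eq_mul, nsmul_eq_mul, Nat.cast_sub (by omega)] at hsum
  have hbound : ∑ e ∈ F.biUnion near, ∑ k ∈ Finset.Ico n₀ n,
      g ((k - a e) + (a e - k) - C) * (2 * (q e).toReal) ≤
      ∑ e ∈ F.biUnion near, (2 * (C + 1) * ∑ m ∈ Finset.range n, g m) * (2 * (q e).toReal) := by
    refine Finset.sum_le_sum fun e _ => ?_
    rw [← Finset.sum_mul]
    exact mul_le_mul_of_nonneg_right
      (sum_dist_le hg0 hg1 hganti hg00 C (a e) n₀ n (by omega)) (by positivity)
  rw [← Finset.mul_sum, ← Finset.mul_sum, ← ENNReal.toReal_sum fun e _ => hqt e] at hbound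
  have hfin : SharpThreshold.partialSum (E.connReal ν Γ) (2 * n₀) n lam =
      ∑ m ∈ Finset.range n, g m := rfl
  rw [hfin]
  nlinarith

/-- The sum of `nearPivotal` probabilities is bounded below by `osss_average` and governs the
increment through `jointLaw_add_sum_nearPivotal_le`. The constant `c` depends on `b` but not on n;
only the error rate does. Taking n ≥ 2n₀ leaves at least n/2 shells for averaging. -/
theorem differenceInequality {ρ : ℝ≥0} (hρ : ∀ᵐ Y ∂(iidLaw d ν), ∀ k, E.U k Y ≤ ρ) {J : ℕ}
    (hJ : ρ < J) (hdep : E.OneDependent) {n₀ : ℕ} (hn₀ : 5 * E.M + 1 / 2 ≤ n₀)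
    {b : ℝ} (hb : 0 < b) :
    ∃ c, 0 < c ∧ SharpThreshold.DifferenceInequality (E.connReal ν Γ) (2 * n₀) b c := by
  classical
  have hM := E.one_le_M
  obtain ⟨C, hC⟩ := exists_nat_ge (5 * E.M + 3)
  have hC0 : (0 : ℝ) ≤ C := Nat.cast_nonneg C
  have hn₀pos : 0 < n₀ := by
    have : (0 : ℝ) < n₀ := by linarith
    exact_mod_cast this
  set m : ℕ := 3 ^ d * E.N ^ d * J with hm
  set T : ℕ := (E.fine (window d 4) ×ˢ Finset.range J).card with hT
  set c₁ : ℝ := Real.exp (-b) * b⁻¹ * (Real.exp (-(m * b)) / (3 ^ d : ℕ)) with hc₁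
  have hc₁0 : 0 < c₁ := by positivity
  refine ⟨c₁ * (Real.exp (-(T * b)) / (8 * (C + 1))), by positivity, fun n hn => ?_⟩
  have hn' : 5 * E.M + 1 / 2 ≤ n := by
    have : n₀ ≤ n := by omega
    have : (n₀ : ℝ) ≤ n := by exact_mod_cast this
    linarith
  refine ⟨(E.fine (window d n) ×ˢ Finset.range J).card, Nat.cast_nonneg _, fun s t hs hst ht => ?_⟩
  set p := E.connReal ν Γ n s with hp
  set σ := SharpThreshold.partialSum (E.connReal ν Γ) (2 * n₀) n s with hσ
  have hσ1 : 1 ≤ σ := SharpThreshold.one_le_partialSum (fun n x => E.connReal_nonneg ν Γ n x)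
    (by omega) (by omega) s
  have hp0 : 0 ≤ p := E.connReal_nonneg ν Γ n s
  set q := ∑ e ∈ (window d n).biUnion near, jointLaw d ν s
    (E.nearPivotal Γ J (window d n) (box d (3 * E.M)) (E.shell n) e) with hq
  have hqt : q ≠ ∞ := ENNReal.sum_ne_top.2 fun e _ => measure_ne_top _ _
  have h1 := E.osss_average ν Γ hρ hJ hdep hn₀ hC hn s
  have h2 : Real.exp (-(T * b)) ≤ 1 - p := by
    have h3 := E.connReal_le ν Γ hρ hJ s hs.le hn'
    have h4 : Real.exp (-(T * b)) ≤ Real.exp (-(T * s)) := by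
      refine Real.exp_le_exp.2 (neg_le_neg ?_)
      exact mul_le_mul_of_nonneg_left (by linarith) (Nat.cast_nonneg _)
    linarith
  have h3 : Real.exp (-(T * b)) / (8 * (C + 1)) * (n / σ) * p ≤ q.toReal := by
    have h4 : (n : ℝ) / 2 ≤ n - n₀ := by
      have : ((2 * n₀ : ℕ) : ℝ) ≤ n := by exact_mod_cast hn
      push_cast at this
      linarith
    have h5 : (n : ℝ) / 2 * (p * Real.exp (-(T * b))) ≤ 4 * (C + 1) * σ * q.toReal := by
      refine le_trans ?_ h1
      have hn0 : (0 : ℝ) ≤ n := Nat.cast_nonneg n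
      exact mul_le_mul h4 (mul_le_mul_of_nonneg_left h2 hp0) (by positivity) (by linarith)
    have h6 : Real.exp (-(T * b)) / (8 * (C + 1)) * (n / σ) * p =
        (n : ℝ) / 2 * (p * Real.exp (-(T * b))) / (4 * (C + 1) * σ) := by
      field_simp
      ring
    rw [h6, div_le_iff₀ (by positivity)]
    linarith
  set κ : ℝ := (t - s) * Real.exp (-t) * s⁻¹ *
    Real.exp (-((E.fine (window d n) ×ˢ Finset.range J).card * (t - s))) *
    (Real.exp (-(m * s)) / (3 ^ d : ℕ)) with hκ
  have hts : 0 < t - s := by linarith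
  have hκ0 : 0 ≤ κ := by positivity
  have h7 : p + κ * q.toReal ≤ E.connReal ν Γ n t := by
    have h8 := E.jointLaw_add_sum_nearPivotal_le Γ ν hs hst.le J (window d n) (box d (3 * E.M))
      (E.shell n) ((window d n).biUnion near)
    rw [← E.connProb_eq_window ν Γ hρ hJ s hn', ← E.connProb_eq_window ν Γ hρ hJ t hn',
      ← E.ofReal_connReal, ← E.ofReal_connReal, ← hq, ← ENNReal.ofReal_toReal hqt,
      ← ENNReal.ofReal_mul hκ0, ← ENNReal.ofReal_add hp0 (by positivity)] at h8
    exact (ENNReal.ofReal_le_ofReal_iff (E.connReal_nonneg ν Γ n t)).1 h8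
  have h9 : c₁ * ((t - s) * Real.exp (-((E.fine (window d n) ×ˢ Finset.range J).card *
      (t - s)))) ≤ κ := by
    have e1 : Real.exp (-b) ≤ Real.exp (-t) := Real.exp_le_exp.2 (by linarith)
    have e2 : b⁻¹ ≤ s⁻¹ := inv_anti₀ hs (by linarith)
    have e3 : Real.exp (-(m * b)) ≤ Real.exp (-(m * s)) := by
      refine Real.exp_le_exp.2 (neg_le_neg ?_)
      exact mul_le_mul_of_nonneg_left (by linarith) (Nat.cast_nonneg _)
    calc c₁ * ((t - s) * Real.exp (-((E.fine (window d n) ×ˢ Finset.range J).card * (t - s))))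
        ≤ (Real.exp (-t) * s⁻¹ * (Real.exp (-(m * s)) / (3 ^ d : ℕ))) *
          ((t - s) * Real.exp (-((E.fine (window d n) ×ˢ Finset.range J).card * (t - s)))) := by
          rw [hc₁]
          gcongr
      _ = κ := by rw [hκ]; ring
  have h10 : c₁ * ((t - s) * Real.exp (-((E.fine (window d n) ×ˢ Finset.range J).card *
      (t - s)))) * (Real.exp (-(T * b)) / (8 * (C + 1)) * (n / σ) * p) ≤ κ * q.toReal := by
    refine mul_le_mul h9 h3 ?_ hκ0
    have : 0 < σ := by linarith
    positivity
  have h11 : c₁ * (Real.exp (-(T * b)) / (8 * (C + 1))) * (n / σ) * (t - s) *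
      Real.exp (-((E.fine (window d n) ×ˢ Finset.range J).card : ℝ) * (t - s)) * p =
      c₁ * ((t - s) * Real.exp (-((E.fine (window d n) ×ˢ Finset.range J).card *
      (t - s)))) * (Real.exp (-(T * b)) / (8 * (C + 1)) * (n / σ) * p) := by
    rw [neg_mul]; ring
  rw [h11]
  linarith

end FactorEnvironment

end CoxPercolation

end

noncomputable section

namespace CoxPercolation

/-! ### Percolation at high intensity -/

theorem infinite_openCluster_of_forall {d : ℕ} (hd : 0 < d) {ω : Lattice d → Bool}
    (h : ∀ z, ω z = true) : (openCluster ω 0).Infinite := by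
  let e : ℕ → Lattice d := fun n => Pi.single ⟨0, hd⟩ (n : ℤ)
  have he : Function.Injective e := fun m n hmn => by
    have := congrFun hmn ⟨0, hd⟩
    simpa [e] using this
  refine infinite_of_injective_forall_mem he fun n => ?_
  induction n with
  | zero =>
    have : e 0 = 0 := by simp [e]
    rw [this]
    exact Relation.ReflTransGen.refl
  | succ n ih =>
    refine Relation.ReflTransGen.tail ih ⟨?_, h _, h _⟩
    have : ∀ i, |e n i - e (n + 1) i| = if i = ⟨0, hd⟩ then 1 else 0 := fun i => by
      by_cases hi : i = ⟨0, hd⟩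
      · subst hi; simp [e]
      · simp [e, hi]
    simp [NearestNeighbours, this]

/-- The value 1 is admissible for q, so the infimum is over a nonempty set. Positive dimension is
needed: in dimension zero no cluster is infinite. -/
theorem exists_lt_percolates {d : ℕ} (hd : 0 < d) {p : ℝ} (hp : percolationThreshold d < p) :
    ∃ q < p, ∀ μ : Measure (Lattice d → Bool), IsProbabilityMeasure μ →
      IsKDependent 6 μ → (∀ z, q ≤ μ.real {ω | ω z = true}) → Percolates μ := by
  have hone : ∀ μ : Measure (Lattice d → Bool), IsProbabilityMeasure μ →
      IsKDependent 6 μ → (∀ z, 1 ≤ μ.real {ω | ω z = true}) → Percolates μ := by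
    intro μ _ _ h1
    have h2 : ∀ z, ∀ᵐ ω ∂μ, ω z = true := fun z => by
      have hm : MeasurableSet {ω : Lattice d → Bool | ω z = true} :=
        (show Measurable fun ω : Lattice d → Bool => ω z by fun_prop) (measurableSet_singleton true)
      refine (mem_ae_iff_prob_eq_one hm).2 (le_antisymm prob_le_one ?_)
      have := ENNReal.ofReal_le_ofReal (h1 z)
      rwa [ENNReal.ofReal_one, ofReal_measureReal] at this
    filter_upwards [ae_all_iff.2 h2] with ω hω
    exact ⟨0, infinite_openCluster_of_forall hd hω⟩
  have hne : {q | q ∈ Icc (0 : ℝ) 1 ∧ ∀ μ : Measure (Lattice d → Bool), IsProbabilityMeasure μ →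
      IsKDependent 6 μ → (∀ z, q ≤ μ.real {ω | ω z = true}) → Percolates μ}.Nonempty :=
    ⟨1, ⟨zero_le_one, le_rfl⟩, hone⟩
  obtain ⟨q, hq, hqp⟩ := exists_lt_of_csInf_lt hne hp
  exact ⟨q, hqp, hq.2⟩

/-- The Poisson process has a point of height at most `ε` in its first strip. -/
def Charged (ε : ℝ) (s : PoissonSample) : Prop := ∃ i, i < (s 0).1 ∧ (((s 0).2 i).2 : ℝ) ≤ ε

theorem measurableSet_charged (ε : ℝ) : MeasurableSet {s | Charged ε s} := by
  have : {s | Charged ε s} =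
      ⋃ i : ℕ, {s | i < (s 0).1} ∩ {s | (((s 0).2 i).2 : ℝ) ≤ ε} := by
    ext s; simp [Charged]
  rw [this]
  refine .iUnion fun i => .inter ?_ ?_
  · exact measurableSet_lt measurable_const (by fun_prop)
  · exact measurableSet_le (measurable_subtype_coe.comp (by fun_prop)) measurable_const

/-- Either there are fewer than n points, or the first n marks all exceed ε. The latter has
probability v^n with v < 1, so n is fixed first and the intensity sent to infinity afterwards. -/
theorem tendsto_poissonLaw_not_charged {ε : ℝ} (hε : 0 < ε) :
    Tendsto (fun lam : ℝ => poissonLaw lam.toNNReal {s | ¬ Charged ε s}) atTop (𝓝 0) := by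
  set v : ℝ≥0∞ := volume {u : unitInterval × unitInterval | ¬ (u.2 : ℝ) ≤ ε} with hv
  have hv1 : v < 1 := by
    have hm : MeasurableSet {u : unitInterval × unitInterval | (u.2 : ℝ) ≤ ε} :=
      measurableSet_le (measurable_subtype_coe.comp measurable_snd) measurable_const
    have h0 : 0 < volume {u : unitInterval × unitInterval | (u.2 : ℝ) ≤ ε} := by
      have hsnd : MeasurePreserving Prod.snd (volume : Measure (unitInterval × unitInterval))
          (volume : Measure unitInterval) := measurePreserving_snd
      have h1 : (0 : ℝ) < min ε 1 := lt_min hε one_pos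
      have h2 : 0 < volume (Iic (⟨min ε 1, h1.le, min_le_right _ _⟩ : unitInterval)) := by
        rw [unitInterval.volume_Iic]
        exact ENNReal.ofReal_pos.2 h1
      rw [← hsnd.measure_preimage measurableSet_Iic.nullMeasurableSet] at h2
      refine h2.trans_le (measure_mono fun u hu => ?_)
      exact (show (u.2 : ℝ) ≤ min ε 1 from hu).trans (min_le_left _ _)
    have h2 : v = 1 - volume {u : unitInterval × unitInterval | (u.2 : ℝ) ≤ ε} :=
      prob_compl_eq_one_sub hm
    rw [h2]
    exact ENNReal.sub_lt_self ENNReal.one_ne_top one_ne_zero h0.ne'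
  have hbound : ∀ (n : ℕ) (lam : ℝ), poissonLaw lam.toNNReal {s | ¬ Charged ε s} ≤
      v ^ n + ∑ i ∈ Finset.range n, poissonMeasure lam.toNNReal {i} := by
    intro n lam
    have h0 := measurePreserving_eval_infinitePi (fun _ : ℕ =>
      (poissonMeasure lam.toNNReal).prod
        (Measure.infinitePi fun _ : ℕ => (volume : Measure (unitInterval × unitInterval)))) 0
    have h1 : MeasurePreserving (fun s : PoissonSample => (s 0).1) (poissonLaw lam.toNNReal)
        (poissonMeasure lam.toNNReal) := measurePreserving_fst.comp h0
    have h2 : MeasurePreserving (fun s : PoissonSample => (s 0).2) (poissonLaw lam.toNNReal)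
        (Measure.infinitePi fun _ : ℕ => (volume : Measure (unitInterval × unitInterval))) :=
      measurePreserving_snd.comp h0
    set A : Set (ℕ → unitInterval × unitInterval) :=
      Set.pi (Finset.range n) fun _ => {u | ¬ (u.2 : ℝ) ≤ ε} with hA
    have hmu : MeasurableSet {u : unitInterval × unitInterval | ¬ (u.2 : ℝ) ≤ ε} :=
      (measurableSet_le (measurable_subtype_coe.comp measurable_snd) measurable_const).compl
    have hAm : MeasurableSet A := .pi (Finset.countable_toSet _) fun _ _ => hmu
    have hAv : (Measure.infinitePi fun _ : ℕ =>
        (volume : Measure (unitInterval × unitInterval))) A = v ^ n := by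
      rw [hA, Measure.infinitePi_pi _ fun _ _ => hmu]
      simp [hv]
    rw [← hAv, ← h2.measure_preimage hAm.nullMeasurableSet]
    have h3 : ∀ i, poissonMeasure lam.toNNReal {i} =
        poissonLaw lam.toNNReal ((fun s : PoissonSample => (s 0).1) ⁻¹' {i}) := fun i =>
      (h1.measure_preimage (measurableSet_singleton i).nullMeasurableSet).symm
    simp_rw [h3]
    refine le_trans (measure_mono ?_) ((measure_union_le _ _).trans
      (add_le_add le_rfl (measure_biUnion_finset_le _ _)))
    intro s hs
    by_cases hn : (s 0).1 < n
    · exact Or.inr (mem_iUnion₂.2 ⟨(s 0).1, Finset.mem_range.2 hn, rfl⟩)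
    · refine Or.inl fun i hi hle => hs ⟨i, ?_, hle⟩
      have := Finset.mem_range.1 (Finset.mem_coe.1 hi)
      omega
  have hpois : ∀ i : ℕ, Tendsto (fun lam : ℝ => poissonMeasure lam.toNNReal {i}) atTop (𝓝 0) := by
    intro i
    have h1 := (Real.tendsto_pow_mul_exp_neg_atTop_nhds_zero i).mul_const ((i.factorial : ℝ)⁻¹)
    have h2 := ENNReal.tendsto_ofReal h1
    rw [zero_mul, ENNReal.ofReal_zero] at h2
    refine h2.congr' ?_
    filter_upwards [eventually_ge_atTop 0] with lam hlam
    rw [poissonMeasure_singleton, Real.coe_toNNReal _ hlam]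
    congr 1
    ring
  rw [ENNReal.tendsto_nhds_zero]
  intro δ hδ
  have hpow := (ENNReal.tendsto_pow_atTop_nhds_zero_of_lt_one hv1)
  obtain ⟨n, hn⟩ := ((ENNReal.tendsto_nhds_zero.1 hpow) (δ / 2) (ENNReal.half_pos hδ.ne')).exists
  have hsum : Tendsto (fun lam : ℝ => ∑ i ∈ Finset.range n, poissonMeasure lam.toNNReal {i})
      atTop (𝓝 0) := by
    have := tendsto_finsetSum (Finset.range n) fun i _ => hpois i
    simpa using this
  filter_upwards [(ENNReal.tendsto_nhds_zero.1 hsum) (δ / 2) (ENNReal.half_pos hδ.ne')]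
    with lam hlam
  exact (hbound n lam).trans ((add_le_add hn hlam).trans (ENNReal.add_halves δ).le)

/-! ### Good blocks as a finite-range dependent site percolation -/

namespace FactorEnvironment

variable {d : ℕ} {S : Type*} [MeasurableSpace S] (E : FactorEnvironment d S)

theorem block_add_smul (z k : Lattice d) (l r : ℤ) :
    k + (E.N : ℤ) • z ∈ E.block z l r ↔ k ∈ E.block 0 l r := by
  refine forall_congr' fun i => ?_
  simp only [Pi.add_apply, Pi.smul_apply, smul_eq_mul, Pi.zero_apply, zero_add]
  constructor <;> rintro ⟨h1, h2⟩ <;> constructor <;> nlinarith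

theorem finite_block (z : Lattice d) (l r : ℤ) : (E.block z l r).Finite := by
  refine (Set.finite_Icc (fun i => (E.N : ℤ) * (z i + l)) fun i => (E.N : ℤ) * (z i + r)).subset
    fun k hk => ⟨fun i => (hk i).1, fun i => (hk i).2.le⟩

theorem block_mono {z z' : Lattice d} {l r l' r' : ℤ} (hl : ∀ i, z' i + l' ≤ z i + l)
    (hr : ∀ i, z i + r ≤ z' i + r') : E.block z l r ⊆ E.block z' l' r' := by
  intro k hk i
  have hN : (0 : ℤ) ≤ E.N := Int.natCast_nonneg _
  exact ⟨(mul_le_mul_of_nonneg_left (hl i) hN).trans (hk i).1,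
    (hk i).2.trans_le (mul_le_mul_of_nonneg_left (hr i) hN)⟩

theorem coarse_mem_of_mem_block {z k : Lattice d} {l r : ℤ} (hk : k ∈ E.block z l r) (i : Fin d) :
    z i + l ≤ E.coarse k i ∧ E.coarse k i < z i + r := by
  have hN : (0 : ℤ) < E.N := by exact_mod_cast E.N_pos
  exact ⟨(Int.le_ediv_iff_mul_le hN).2 (by linarith [(hk i).1]),
    Int.ediv_lt_of_lt_mul hN (by linarith [(hk i).2])⟩

theorem coarse_eq_of_mem_block {z k : Lattice d} (hk : k ∈ E.block z 0 1) : E.coarse k = z := by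
  funext i
  have := E.coarse_mem_of_mem_block hk i
  omega

/-- A coarse site is good if its block carries intensity at least `ε` and all Poisson processes
nearby have a point of height at most `ε`. -/
def Good (ε : ℝ≥0) (z : Lattice d) (ω : (Lattice d → S) × (Lattice d → PoissonSample)) : Prop :=
  (∃ k ∈ E.block z 0 1, ε ≤ E.U k ω.1) ∧ ∀ k ∈ E.block z (-2) 3, Charged ε (ω.2 k)

theorem measurableSet_exists_le_U (ε : ℝ≥0) (z : Lattice d) :
    MeasurableSet {Y | ∃ k ∈ E.block z 0 1, ε ≤ E.U k Y} := by
  have : {Y | ∃ k ∈ E.block z 0 1, ε ≤ E.U k Y} = ⋃ k ∈ E.block z 0 1, {Y | ε ≤ E.U k Y} := by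
    ext Y; simp
  rw [this]
  exact .biUnion (to_countable _) fun k _ => measurableSet_le measurable_const (E.measurable_U k)

theorem measurableSet_good (ε : ℝ≥0) (z : Lattice d) : MeasurableSet {ω | E.Good ε z ω} := by
  have : {ω | E.Good ε z ω} = Prod.fst ⁻¹' {Y | ∃ k ∈ E.block z 0 1, ε ≤ E.U k Y} ∩
      ⋂ k ∈ E.block z (-2) 3, (fun ω : (Lattice d → S) × (Lattice d → PoissonSample) => ω.2 k) ⁻¹' {s | Charged ε s} := by
    ext ω; simp [Good]
  rw [this]
  refine (measurable_fst (E.measurableSet_exists_le_U ε z)).inter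
    (.biInter (to_countable _) fun k _ => ?_)
  exact (show Measurable fun ω : (Lattice d → S) × (Lattice d → PoissonSample) => ω.2 k by
    fun_prop) (measurableSet_charged ε)

theorem good_shift (ε : ℝ≥0) (z : Lattice d)
    (ω : (Lattice d → S) × (Lattice d → PoissonSample)) :
    E.Good ε 0 (E.shift z ω) ↔ E.Good ε z ω := by
  have h1 : ∀ P : Lattice d → Prop, ∀ l r, (∀ k ∈ E.block z l r, P k) ↔
      ∀ k ∈ E.block 0 l r, P (k + (E.N : ℤ) • z) := fun P l r =>
    ⟨fun h k hk => h _ ((E.block_add_smul z k l r).2 hk), fun h k hk => by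
      have := h (k - (E.N : ℤ) • z) ((E.block_add_smul z _ l r).1 (by simpa using hk))
      simpa using this⟩
  have h2 : ∀ P : Lattice d → Prop, (∃ k ∈ E.block z 0 1, P k) ↔
      ∃ k ∈ E.block 0 0 1, P (k + (E.N : ℤ) • z) := fun P => by
    have := h1 (fun k => ¬ P k) 0 1
    rw [← not_iff_not]
    push Not
    exact this
  unfold Good
  rw [h1, h2]
  simp only [E.U_covariant, shift]

theorem good_congr (hdep : E.OneDependent) (ε : ℝ≥0) (z : Lattice d)
    {ω ω' : (Lattice d → S) × (Lattice d → PoissonSample)}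
    (h : OSSS.Agree E.coarse {w | ∀ i, |w i - z i| ≤ 2} ω ω') :
    E.Good ε z ω ↔ E.Good ε z ω' := by
  have h1 : ∀ k ∈ E.block z 0 1, E.U k ω.1 = E.U k ω'.1 := fun k hk =>
    E.U_eq_of_localEnv_eq (hdep z k hk _ _ fun w hw => h.1 w fun i => (hw i).trans (by norm_num))
  have h2 : ∀ k ∈ E.block z (-2) 3, ω.2 k = ω'.2 k := fun k hk => h.2 k fun i => by
    have := E.coarse_mem_of_mem_block hk i
    rw [abs_le]
    constructor <;> linarith
  refine and_congr (exists_congr fun k => and_congr_right fun hk => by rw [h1 k hk])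
    (forall₂_congr fun k hk => by rw [h2 k hk])

open scoped Classical in
/-- The site percolation model of good coarse sites. -/
def goodField (ε : ℝ≥0) (ω : (Lattice d → S) × (Lattice d → PoissonSample)) : Lattice d → Bool :=
  fun z => decide (E.Good ε z ω)

theorem goodField_eq_true {ε : ℝ≥0} {ω : (Lattice d → S) × (Lattice d → PoissonSample)}
    {z : Lattice d} : E.goodField ε ω z = true ↔ E.Good ε z ω := by
  simp [goodField]

theorem measurable_goodField (ε : ℝ≥0) : Measurable (E.goodField ε) := by
  refine measurable_pi_lambda _ fun z => measurable_to_bool ?_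
  have : (fun ω => E.goodField ε ω z) ⁻¹' {true} = {ω | E.Good ε z ω} := by
    ext ω; simp [goodField]
  rw [this]
  exact E.measurableSet_good ε z

/-- Goodness depends on coordinates within distance 2, so sets of sites at distance larger than 6
involve disjoint coordinates. -/
theorem isKDependent_goodField (hdep : E.OneDependent) (ν : Measure S) [IsProbabilityMeasure ν]
    (lam : ℝ) (ε : ℝ≥0) : IsKDependent 6 ((jointLaw d ν lam).map (E.goodField ε)) := by
  intro A B hAB
  have hf := E.measurable_goodField ε
  rw [indepFun_iff_measure_inter_preimage_eq_mul]
  intro s t hs ht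
  have hmA : ∀ A : Set (Lattice d), Measurable
      (fun ω : Lattice d → Bool => fun a : A => ω a) := fun A => by fun_prop
  have hs' := hmA A hs
  have ht' := hmA B ht
  rw [Measure.map_apply hf (hs'.inter ht'), Measure.map_apply hf hs', Measure.map_apply hf ht',
    preimage_inter]
  have key : ∀ (A : Set (Lattice d)) (s : Set (A → Bool))
      (ω ω' : (Lattice d → S) × (Lattice d → PoissonSample)),
      OSSS.Agree E.coarse {w | ∃ a ∈ A, ∀ i, |w i - a i| ≤ 2} ω ω' →
      (ω ∈ E.goodField ε ⁻¹' ((fun ω : Lattice d → Bool => fun a : A => ω a) ⁻¹' s) ↔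
        ω' ∈ E.goodField ε ⁻¹' ((fun ω : Lattice d → Bool => fun a : A => ω a) ⁻¹' s)) := by
    intro A s ω ω' h
    have : (fun a : A => E.goodField ε ω a) = fun a : A => E.goodField ε ω' a := by
      funext a
      have := E.good_congr hdep ε a (h.mono fun w hw => ⟨a, a.2, hw⟩)
      rw [Bool.eq_iff_iff, goodField_eq_true, goodField_eq_true, this]
    simp only [mem_preimage, this]
  refine OSSS.measure_inter_of_disjoint (g := E.coarse) ν (poissonLaw lam.toNNReal)
    (disjoint_left.2 ?_) (hf hs') (hf ht') (key A s) (key B t)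
  rintro w ⟨a, ha, hwa⟩ ⟨c, hc, hwc⟩
  obtain ⟨i, hi⟩ := hAB a ha c hc
  have h1 := abs_le.1 (hwa i)
  have h2 := abs_le.1 (hwc i)
  rcases abs_cases (a i - c i) with ⟨h3, -⟩ | ⟨h3, -⟩ <;> rw [h3] at hi <;> linarith

/-- At high intensity, good sites are about as likely as non-empty blocks. -/
theorem exists_le_good (ν : Measure S) [IsProbabilityMeasure ν] {η : ℝ≥0} (hη : 0 < η) {q : ℝ}
    (hq : q < (iidLaw d ν).real {Y | ∃ k ∈ E.block 0 0 1, 0 < E.U k Y}) :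
    ∃ ε : ℝ≥0, 0 < ε ∧ ε ≤ η ∧ ∃ lam : ℝ, 0 < lam ∧
      ∀ z, q ≤ (jointLaw d ν lam).real {ω | E.Good ε z ω} := by
  obtain ⟨ε, hε, hεη, hqε⟩ : ∃ ε : ℝ≥0, 0 < ε ∧ ε ≤ η ∧
      q < (iidLaw d ν).real {Y | ∃ k ∈ E.block 0 0 1, ε ≤ E.U k Y} := by
    -- The thresholds η/(n+1) decrease to zero, so these events exhaust the event of a non-empty
    -- block, and one of them already has probability above `q`.
    set A : ℕ → Set (Lattice d → S) := fun n =>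
      {Y | ∃ k ∈ E.block 0 0 1, η / (n + 1 : ℕ) ≤ E.U k Y} with hA
    have hmono : Monotone A := by
      rintro m n hmn Y ⟨k, hk, h⟩
      refine ⟨k, hk, le_trans ?_ h⟩
      gcongr
    have hU : ⋃ n, A n = {Y | ∃ k ∈ E.block 0 0 1, 0 < E.U k Y} := by
      ext Y
      simp only [mem_iUnion]
      constructor
      · rintro ⟨n, k, hk, h⟩
        exact ⟨k, hk, lt_of_lt_of_le (by positivity) h⟩
      · rintro ⟨k, hk, h⟩
        obtain ⟨n, hn⟩ := exists_nat_ge (η / E.U k Y)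
        refine ⟨n, k, hk, ?_⟩
        rw [div_le_iff₀ h] at hn
        rw [div_le_iff₀ (by positivity), mul_comm]
        refine hn.trans (mul_le_mul_of_nonneg_right ?_ zero_le)
        exact_mod_cast Nat.le_succ n
    have ht := tendsto_measure_iUnion_atTop (μ := iidLaw d ν) hmono
    rw [hU] at ht
    have ht' := (ENNReal.tendsto_toReal (measure_ne_top _ _)).comp ht
    obtain ⟨n, hn⟩ := (ht'.eventually (lt_mem_nhds hq)).exists
    refine ⟨η / (n + 1 : ℕ), by positivity, ?_, hn⟩
    exact div_le_self (zero_le) (by exact_mod_cast Nat.succ_le_succ (Nat.zero_le n))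
  refine ⟨ε, hε, hεη, ?_⟩
  set p := (iidLaw d ν).real {Y | ∃ k ∈ E.block 0 0 1, ε ≤ E.U k Y} with hp
  set T := (E.finite_block (0 : Lattice d) (-2) 3).toFinset with hT
  have htend : Tendsto (fun lam : ℝ => T.card *
      (poissonLaw lam.toNNReal {s | ¬ Charged ε s}).toReal) atTop (𝓝 0) := by
    have h1 := (ENNReal.tendsto_toReal ENNReal.zero_ne_top).comp
      (tendsto_poissonLaw_not_charged (ε := ε) (by exact_mod_cast hε))
    have h2 := h1.const_mul (T.card : ℝ)
    simpa using h2
  obtain ⟨lam, hlam, hlam0⟩ := ((htend.eventually (gt_mem_nhds (sub_pos.2 hqε))).and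
    (eventually_gt_atTop 0)).exists
  refine ⟨lam, hlam0, fun z => ?_⟩
  have hz : (jointLaw d ν lam).real {ω | E.Good ε z ω} =
      (jointLaw d ν lam).real {ω | E.Good ε 0 ω} := by
    rw [measureReal_def, measureReal_def, ← (E.measurePreserving_shift ν lam z).measure_preimage
      (E.measurableSet_good ε 0).nullMeasurableSet]
    congr 2
    ext ω
    exact (E.good_shift ε z ω).symm
  rw [hz]
  have hfst : MeasurePreserving (Prod.fst : (Lattice d → S) × (Lattice d → PoissonSample) → _)
      (jointLaw d ν lam) (iidLaw d ν) := measurePreserving_fst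
  have hsnd : ∀ k, MeasurePreserving
      (fun ω : (Lattice d → S) × (Lattice d → PoissonSample) => ω.2 k)
      (jointLaw d ν lam) (poissonLaw lam.toNNReal) := fun k =>
    (measurePreserving_eval_infinitePi (fun _ : Lattice d => poissonLaw lam.toNNReal) k).comp
      measurePreserving_snd
  -- Union bound over the finitely many fine sites of the enlarged block; their failure
  -- probabilities vanish at high intensity.
  have hsub : Prod.fst ⁻¹' {Y | ∃ k ∈ E.block 0 0 1, ε ≤ E.U k Y} ⊆
      {ω | E.Good ε 0 ω} ∪ ⋃ k ∈ T, (fun ω : (Lattice d → S) × (Lattice d → PoissonSample) =>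
        ω.2 k) ⁻¹' {s | ¬ Charged ε s} := by
    intro ω hω
    by_cases h : ∀ k ∈ E.block 0 (-2) 3, Charged ε (ω.2 k)
    · exact Or.inl ⟨hω, h⟩
    · push Not at h
      obtain ⟨k, hk, hc⟩ := h
      exact Or.inr (mem_iUnion₂.2 ⟨k, (Set.Finite.mem_toFinset _).2 hk, hc⟩)
  have h1 := (measureReal_mono hsub (μ := jointLaw d ν lam)).trans
    ((measureReal_union_le _ _).trans (add_le_add le_rfl (measureReal_biUnion_finset_le _ _)))
  have h2 : (jointLaw d ν lam).real (Prod.fst ⁻¹' {Y | ∃ k ∈ E.block 0 0 1, ε ≤ E.U k Y}) = p := by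
    rw [measureReal_def, hfst.measure_preimage (E.measurableSet_exists_le_U ε 0).nullMeasurableSet]
    rfl
  have h3 : ∀ k, (jointLaw d ν lam).real ((fun ω : (Lattice d → S) × (Lattice d → PoissonSample) =>
      ω.2 k) ⁻¹' {s | ¬ Charged ε s}) = (poissonLaw lam.toNNReal {s | ¬ Charged ε s}).toReal :=
    fun k =>
      congrArg ENNReal.toReal ((hsnd k).measure_preimage
        (measurableSet_charged ε).compl.nullMeasurableSet)
  simp only [h2, h3, Finset.sum_const, nsmul_eq_mul] at h1
  linarith

end FactorEnvironment

end CoxPercolation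

end

/-! ### From an infinite cluster of good blocks to percolation of the balls -/

noncomputable section

namespace CoxPercolation

theorem dist_lt_one_of_abs_le {d : ℕ} {p q : EuclideanSpace ℝ (Fin d)} {r : ℝ}
    (hr : d * r < 1) (h : ∀ i, |p i - q i| ≤ r) : dist p q < 1 := by
  have h1 : dist p q ^ 2 = ∑ i, |p i - q i| ^ 2 := by
    rw [EuclideanSpace.dist_eq, Real.sq_sqrt (Finset.sum_nonneg fun i _ => sq_nonneg _)]
    rfl
  have h2 : ∑ i, |p i - q i| ^ 2 ≤ d * r ^ 2 := by
    have := Finset.sum_le_sum fun i (_ : i ∈ (Finset.univ : Finset (Fin d))) =>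
      pow_le_pow_left₀ (abs_nonneg (p i - q i)) (h i) 2
    simpa using this
  rcases Nat.eq_zero_or_pos d with rfl | hd
  · simp only [CharP.cast_eq_zero, zero_mul] at h2
    have h3 := dist_nonneg (x := p) (y := q)
    nlinarith
  · have hr0 : 0 ≤ r := (abs_nonneg _).trans (h ⟨0, hd⟩)
    have hd' : (1 : ℝ) ≤ d := by exact_mod_cast hd
    have h3 : (d : ℝ) * r ^ 2 ≤ (d * r) ^ 2 := by
      rw [mul_pow]
      exact mul_le_mul_of_nonneg_right (by nlinarith) (sq_nonneg r)
    have h4 : (d * r) ^ 2 < 1 := by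
      have : 0 ≤ d * r := by positivity
      nlinarith
    have h5 : dist p q ^ 2 < 1 ^ 2 := by linarith
    exact lt_of_pow_lt_pow_left₀ 2 zero_le_one h5

namespace FactorEnvironment

variable {d : ℕ} {S : Type*} [MeasurableSpace S] (E : FactorEnvironment d S)
  (Γ : cube d (E.M / E.N) ≃ᵐ unitInterval)

/-- Points of adjacent fine cubes differ by at most 2M/N in each coordinate, and N > 2dM makes their
distance less than 1: a chain of adjacent charged sites is a chain of overlapping balls. -/
theorem dist_position_lt (ω : (Lattice d → S) × (Lattice d → PoissonSample))
    {a a' : Lattice d × ℕ × ℕ} (h : ∀ i, |a.1 i - a'.1 i| ≤ 1) :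
    dist (E.position Γ ω a) (E.position Γ ω a') < 1 := by
  have hN : (0 : ℝ) < E.N := by exact_mod_cast E.N_pos
  have hM := E.one_le_M
  have h0 : 0 ≤ E.M / E.N := by positivity
  refine dist_lt_one_of_abs_le (r := 2 * (E.M / E.N)) ?_ fun i => ?_
  · have := E.two_d_M_lt_N
    rw [← mul_div_assoc, ← mul_div_assoc, div_lt_one hN]
    linarith
  · have hp := fun a : Lattice d × ℕ × ℕ =>
      (Γ.symm (E.quantile Γ a.1 ω.1 ((ω.2 a.1 a.2.1).2 a.2.2).1)).2 i
    have he : ∀ a : Lattice d × ℕ × ℕ, E.position Γ ω a i = E.M / E.N * a.1 i +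
        (Γ.symm (E.quantile Γ a.1 ω.1 ((ω.2 a.1 a.2.1).2 a.2.2).1) :
          EuclideanSpace ℝ (Fin d)) i := fun _ => rfl
    rw [he, he]
    have h1 := abs_le.1 (h i)
    have h2 : (-1 : ℝ) ≤ (a.1 i : ℝ) - a'.1 i := by exact_mod_cast h1.1
    have h3 : (a.1 i : ℝ) - a'.1 i ≤ 1 := by exact_mod_cast h1.2
    have h4 := hp a
    have h5 := hp a'
    have h6 := mul_le_mul_of_nonneg_left h2 h0
    have h7 := mul_le_mul_of_nonneg_left h3 h0
    rw [abs_le]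
    constructor
    · linarith [h4.1, h5.2]
    · linarith [h4.2, h5.1]

theorem exists_present_of_charged {J : ℕ} (hJ : 0 < J)
    {ω : (Lattice d → S) × (Lattice d → PoissonSample)} {ε : ℝ≥0} (hε : 0 < ε) {k : Lattice d}
    (hU : ε ≤ E.U k ω.1) (hc : Charged ε (ω.2 k)) :
    ∃ a : Lattice d × ℕ × ℕ, a.1 = k ∧ E.Present J univ ω a := by
  obtain ⟨i, hi, hle⟩ := hc
  refine ⟨(k, 0, i), rfl, mem_univ _, hJ, hi, hε.trans_le hU, ?_⟩
  have : (ε : ℝ) ≤ E.U k ω.1 := by exact_mod_cast hU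
  simpa using hle.trans this

/-- Two points of the Cox process near a good site are joined by a chain. -/
theorem chain_of_good {J : ℕ} (hJ : 0 < J)
    {ω : (Lattice d → S) × (Lattice d → PoissonSample)} {ε η : ℝ≥0} (hε : 0 < ε) (hεη : ε ≤ η)
    (hconn : ∀ z, ∀ k ∈ E.block z (-1) 2, ∀ k' ∈ E.block z (-1) 2,
      0 < E.U k ω.1 → 0 < E.U k' ω.1 → E.SupportedChain η ω.1 z k k')
    {z : Lattice d} (hz : E.Good ε z ω) {a a' : Lattice d × ℕ × ℕ}
    (ha : E.Present J univ ω a) (ha' : E.Present J univ ω a')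
    (haz : a.1 ∈ E.block z (-1) 2) (haz' : a'.1 ∈ E.block z (-1) 2) :
    Relation.ReflTransGen (Step (E.points Γ J univ ω)) (E.position Γ ω a)
      (E.position Γ ω a') := by
  obtain ⟨m, c, hc0, hcm, hadj, hsup⟩ := hconn z _ haz _ haz' ha.2.2.2.1 ha'.2.2.2.1
  have step : ∀ b b' : Lattice d × ℕ × ℕ, E.Present J univ ω b → E.Present J univ ω b' →
      (∀ i, |b.1 i - b'.1 i| ≤ 1) →
      Step (E.points Γ J univ ω) (E.position Γ ω b) (E.position Γ ω b') := fun b b' hb hb' h =>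
    ⟨⟨b, hb, rfl⟩, ⟨b', hb', rfl⟩, E.dist_position_lt Γ ω h⟩
  rcases Nat.eq_zero_or_pos m with rfl | hm
  · refine .single (step a a' ha ha' fun i => ?_)
    rw [← hc0, ← hcm]
    simp
  have key : ∀ i < m, ∃ b : Lattice d × ℕ × ℕ, b.1 = c i ∧ E.Present J univ ω b ∧
      Relation.ReflTransGen (Step (E.points Γ J univ ω)) (E.position Γ ω a)
        (E.position Γ ω b) := by
    intro i
    induction i with
    | zero => exact fun _ => ⟨a, hc0.symm, ha, .refl⟩
    | succ i ih =>
      intro hi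
      obtain ⟨b, hb, hbp, hab⟩ := ih (by omega)
      obtain ⟨hblock, hUi⟩ := hsup (i + 1) (Nat.succ_pos i) hi
      obtain ⟨b', hb', hbp'⟩ := E.exists_present_of_charged hJ hε (hεη.trans hUi)
        (hz.2 _ hblock)
      refine ⟨b', hb', hbp', hab.tail (step b b' hbp hbp' ?_)⟩
      rw [hb, hb']
      exact (hadj i (by omega)).2
  obtain ⟨b, hb, hbp, hab⟩ := key (m - 1) (by omega)
  refine hab.tail (step b a' hbp ha' ?_)
  have := (hadj (m - 1) (by omega)).2
  rwa [← hb, Nat.sub_add_cancel hm, hcm] at this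

/-- An infinite cluster of good sites links a translate of `Λ_{3M}` to all shells. -/
theorem link_shift_of_infinite {J : ℕ} (hJ : 0 < J)
    {ω : (Lattice d → S) × (Lattice d → PoissonSample)} {ε η : ℝ≥0} (hε : 0 < ε) (hεη : ε ≤ η)
    (hconn : ∀ z, ∀ k ∈ E.block z (-1) 2, ∀ k' ∈ E.block z (-1) 2,
      0 < E.U k ω.1 → 0 < E.U k' ω.1 → E.SupportedChain η ω.1 z k k')
    {z : Lattice d} (hz : (openCluster (E.goodField ε ω) z).Infinite) {n : ℕ}
    (hn : 5 * E.M ≤ n) :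
    Link (E.points Γ J univ (E.shift z ω)) (box d (3 * E.M)) (E.shell n) := by
  have hM := E.one_le_M
  have hself : ∀ w : Lattice d, E.block w 0 1 ⊆ E.block w (-1) 2 := fun w =>
    E.block_mono (fun i => by linarith) fun i => by linarith
  have hex : ∀ w, E.Good ε w ω → ∃ a : Lattice d × ℕ × ℕ, a.1 ∈ E.block w 0 1 ∧
      E.Present J univ ω a := by
    intro w hw
    obtain ⟨k, hk, hU⟩ := hw.1
    obtain ⟨a, rfl, ha⟩ := E.exists_present_of_charged hJ hε hU (hw.2 k
      (E.block_mono (fun i => by linarith) (fun i => by linarith) hk))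
    exact ⟨a, hk, ha⟩
  -- The cluster of a closed site is a singleton, so an infinite one has an open starting site.
  have hzgood : E.Good ε z ω := by
    obtain ⟨w, hw, hwz⟩ := hz.exists_notMem_finite (finite_singleton z)
    rcases Relation.ReflTransGen.cases_head hw with h | ⟨c, hc, -⟩
    · exact absurd h.symm hwz
    · exact E.goodField_eq_true.1 hc.2.1
  obtain ⟨a, haz, ha⟩ := hex z hzgood
  have hcluster : ∀ w ∈ openCluster (E.goodField ε ω) z, E.Good ε w ω ∧
      ∀ a' : Lattice d × ℕ × ℕ, a'.1 ∈ E.block w 0 1 → E.Present J univ ω a' →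
        Relation.ReflTransGen (Step (E.points Γ J univ ω)) (E.position Γ ω a)
          (E.position Γ ω a') := by
    intro w hw
    induction hw with
    | refl =>
      exact ⟨hzgood, fun a' haz' ha' =>
        E.chain_of_good Γ hJ hε hεη hconn hzgood ha ha' (hself z haz) (hself z haz')⟩
    | @tail w w' _ hs ih =>
      refine ⟨E.goodField_eq_true.1 hs.2.2, fun a' haw' ha' => ?_⟩
      obtain ⟨b, hbw, hb⟩ := hex w ih.1
      refine (ih.2 b hbw hb).trans
        (E.chain_of_good Γ hJ hε hεη hconn ih.1 hb ha' (hself w hbw) (E.block_mono ?_ ?_ haw'))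
      all_goals
        intro i
        have h1 := Finset.single_le_sum (f := fun i => |w i - w' i|) (fun i _ => abs_nonneg _)
          (Finset.mem_univ i)
        have h2 : |w i - w' i| ≤ 1 := h1.trans hs.1.le
        have h3 := abs_le.1 h2
        linarith
  -- The extra 1 in n + 1 pays for the width `M` of the cell in negative directions.
  obtain ⟨w, hw, hwfar⟩ := hz.exists_notMem_finite
    (Set.finite_Icc (fun i => z i - (n + 1 : ℤ)) fun i => z i + (n + 1 : ℤ))
  obtain ⟨i, hi⟩ : ∃ i, (n + 1 : ℤ) < |w i - z i| := by
    by_contra hcon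
    push Not at hcon
    refine hwfar ⟨fun i => ?_, fun i => ?_⟩ <;> have := abs_le.1 (hcon i) <;> dsimp only <;>
      linarith
  obtain ⟨hwgood, hchain⟩ := hcluster w hw
  obtain ⟨a', haw, ha'⟩ := hex w hwgood
  have hc := hchain a' haw ha'
  have hmem : ∀ x, x ∈ E.points Γ J univ ω →
      x - E.origin z ∈ E.points Γ J univ (E.shift z ω) := fun x hx => by
    rw [mem_points_shift]; simpa using hx
  have hc' : Relation.ReflTransGen (Step (E.points Γ J univ (E.shift z ω)))
      (E.position Γ ω a - E.origin z) (E.position Γ ω a' - E.origin z) :=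
    hc.lift (fun x => x - E.origin z) fun x y hs => ⟨hmem x hs.1, hmem y hs.2.1, by
      simpa using hs.2.2⟩
  have hx : supNorm (E.position Γ ω a - E.origin z) ≤ 2 * E.M := by
    refine E.supNorm_sub_origin_le (z := z) (mem_near.2 fun i => by simp) ?_
    have := E.position_mem_cell Γ ω a
    rwa [E.coarse_eq_of_mem_block haz] at this
  have hy : (n : ℝ) < supNorm (E.position Γ ω a' - E.origin z) := by
    have h1 := E.position_mem_cell Γ ω a' i
    rw [E.coarse_eq_of_mem_block haw] at h1
    refine lt_of_lt_of_le ?_ (abs_apply_le_supNorm _ i)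
    have h2 : (E.position Γ ω a' - E.origin z) i = E.position Γ ω a' i - E.M * z i := rfl
    have h3 : (n : ℝ) + 1 < |(w i : ℝ) - z i| := by exact_mod_cast hi
    rw [h2]
    have hn0 : (0 : ℝ) ≤ n := Nat.cast_nonneg n
    rcases lt_abs.1 h3 with h4 | h4
    · exact lt_of_lt_of_le (by nlinarith) (le_abs_self _)
    · exact lt_of_lt_of_le (by nlinarith) (neg_le_abs _)
  rcases E.chain_dichotomy (r := n) (by linarith) (by linarith) hc' with
    ⟨y, hyX, hys, hcy⟩ | ⟨-, hyn⟩
  · exact ⟨_, hmem _ ⟨a, ha, rfl⟩, y, hyX, Metric.self_subset_thickening (by norm_num) _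
      ((mem_box_iff (by linarith)).2 (by linarith)),
      Metric.self_subset_thickening (by norm_num) _ hys, chain_mono inter_subset_left hcy⟩
  · linarith

/-- The infinite cluster of good sites starts at a random site, so it yields a link from a random
translate of Λ_{3M} to all large shells. There are countably many translates with equal
probabilities, hence the link from Λ_{3M} itself has positive probability. -/
theorem exists_theta_pos (ν : Measure S) [IsProbabilityMeasure ν] (hdep : E.OneDependent)
    (hbdd : E.BoundedIntensity ν) (hcov : E.Coverage ν) (hconn : E.EssentiallyConnected ν) :
    ∃ lam, 0 < lam ∧ 0 < E.theta ν Γ lam := by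
  -- In dimension zero the cube is a single point and cannot be in bijection with the unit interval.
  have hd : 0 < d := by
    by_contra hd
    obtain rfl : d = 0 := by omega
    have h1 : Γ.symm 0 = Γ.symm 1 := Subtype.ext (Subsingleton.elim _ _)
    exact zero_ne_one (Γ.symm.injective h1)
  obtain ⟨ρ, -, hρ⟩ := hbdd
  obtain ⟨J, hJ⟩ := exists_nat_gt ρ
  have hJ0 : 0 < J := by
    have : (0 : ℝ≥0) < J := lt_of_le_of_lt zero_le hJ
    exact_mod_cast this
  obtain ⟨η, hη, hconn⟩ := hconn
  obtain ⟨q, hqp, hperc⟩ := exists_lt_percolates hd hcov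
  obtain ⟨ε, hε, hεη, lam, hlam, hgood⟩ := E.exists_le_good ν hη hqp
  refine ⟨lam, hlam, ?_⟩
  have hf := E.measurable_goodField ε
  have hinf : Percolates ((jointLaw d ν lam).map (E.goodField ε)) := by
    refine hperc _ (Measure.isProbabilityMeasure_map hf.aemeasurable)
      (E.isKDependent_goodField hdep ν lam ε) fun z => (hgood z).trans_eq ?_
    have hm : MeasurableSet {ω : Lattice d → Bool | ω z = true} :=
      (show Measurable fun ω : Lattice d → Bool => ω z by fun_prop) (measurableSet_singleton true)
    rw [measureReal_def, measureReal_def, Measure.map_apply hf hm]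
    congr 2
    ext ω
    exact E.goodField_eq_true.symm
  have hinf' := ae_of_ae_map hf.aemeasurable hinf
  have hfst : MeasurePreserving (Prod.fst : (Lattice d → S) × (Lattice d → PoissonSample) → _)
      (jointLaw d ν lam) (iidLaw d ν) := measurePreserving_fst
  obtain ⟨n₀, hn₀⟩ := exists_nat_ge (5 * E.M)
  set L : Set ((Lattice d → S) × (Lattice d → PoissonSample)) := ⋂ n : ℕ, ⋂ _ : n₀ ≤ n,
    {ω | Link (E.points Γ J univ ω) (box d (3 * E.M)) (E.shell n)} with hL
  have hLm : MeasurableSet L := .iInter fun n => .iInter fun _ =>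
    E.measurableSet_link_points Γ J univ _ _
  have hLpos : jointLaw d ν lam L ≠ 0 := by
    intro h0
    have h1 : ∀ z, ∀ᵐ ω ∂(jointLaw d ν lam), E.shift z ω ∉ L := fun z => by
      have := (E.measurePreserving_shift ν lam z).measure_preimage hLm.nullMeasurableSet
      rw [h0] at this
      exact measure_eq_zero_iff_ae_notMem.1 this
    have h2 : ∀ᵐ _ω ∂(jointLaw d ν lam), False := by
      filter_upwards [ae_all_iff.2 h1, hinf', hfst.quasiMeasurePreserving.ae hconn]
        with ω hω ⟨z, hz⟩ hc
      refine hω z (mem_iInter₂.2 fun n hn => ?_)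
      refine E.link_shift_of_infinite Γ hJ0 hε hεη hc hz ?_
      have : (n₀ : ℝ) ≤ n := by exact_mod_cast hn
      linarith
    exact h2.exists.elim fun _ h => h
  have hpos : 0 < (jointLaw d ν lam L).toReal :=
    ENNReal.toReal_pos hLpos (measure_ne_top _ _)
  refine hpos.trans_le (ge_of_tendsto (E.tendsto_theta ν Γ lam) ?_)
  filter_upwards [eventually_ge_atTop n₀] with n hn
  rw [E.connProb_eq Γ ν hρ hJ]
  exact ENNReal.toReal_mono (measure_ne_top _ _) (measure_mono fun ω hω => mem_iInter₂.1 hω n hn)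

end FactorEnvironment

end CoxPercolation

end

/-! ### Sharpness of the phase transition -/

theorem theorem3p2 {d : ℕ} {S : Type*} [MeasurableSpace S] (ν : Measure S)
    [IsProbabilityMeasure ν]
    (E : CoxPercolation.FactorEnvironment d S) (Γ : CoxPercolation.cube d (E.M / E.N) ≃ᵐ unitInterval)
    (hdep : E.OneDependent) (hbdd : E.BoundedIntensity ν) (hcov : E.Coverage ν)
    (hconn : E.EssentiallyConnected ν) :
    (∀ lam : ℝ, 0 < lam → lam < E.criticalIntensity ν Γ →
      limsup (fun n : ℕ => ENNReal.log (E.connProb ν Γ lam n) / (n : EReal)) atTop < 0) ∧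
    0 < liminf (fun lam : ℝ =>
        ((E.theta ν Γ lam / (lam - E.criticalIntensity ν Γ) : ℝ) : EReal))
      (𝓝[>] E.criticalIntensity ν Γ) := by
  -- Nonemptiness makes `criticalIntensity` a genuine infimum, not the default value 0 of `sInf ∅`.
  have hne := E.exists_theta_pos Γ ν hdep hbdd hcov hconn
  obtain ⟨ρ, -, hρ⟩ := hbdd
  obtain ⟨J, hJ⟩ := exists_nat_gt ρ
  have hM := E.one_le_M
  obtain ⟨n₀, hn₀⟩ := exists_nat_ge (5 * E.M + 1 / 2)
  have hn₀pos : 0 < n₀ := by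
    have : (0 : ℝ) < n₀ := by linarith
    exact_mod_cast this
  have hlarge : ∀ n : ℕ, 2 * n₀ ≤ n → 5 * E.M + 1 / 2 ≤ n := fun n hn => by
    have : n₀ ≤ n := by omega
    have : (n₀ : ℝ) ≤ n := by exact_mod_cast this
    linarith
  obtain ⟨hsub, κ, hκ, hsup⟩ := SharpThreshold.sharp (θ := E.connReal ν Γ) (n₀ := 2 * n₀)
    (l := E.theta ν Γ) (E.connReal_nonneg ν Γ) (E.connReal_le_one ν Γ)
    (fun n hn => E.connReal_mono ν Γ hρ hJ (hlarge n hn))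
    (fun x m n hm hmn => E.connReal_anti ν Γ x (by linarith [hlarge m hm]) hmn)
    (E.tendsto_theta ν Γ) (by omega)
    (fun b hb => E.differenceInequality ν Γ hρ hJ hdep hn₀ hb) hne
  constructor
  · intro lam hlam hlamc
    obtain ⟨κ, hκ, hdecay⟩ := hsub lam hlam hlamc
    refine lt_of_le_of_lt (limsup_le_of_le (a := ((-κ : ℝ) : EReal)) (by isBoundedDefault) ?_) ?_
    · filter_upwards [hdecay, eventually_gt_atTop 0] with n hn hn0
      have hn0' : (0 : ℝ) < n := by exact_mod_cast hn0
      rw [← E.ofReal_connReal]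
      refine (EReal.div_le_div_right_of_nonneg (by positivity)
        (ENNReal.log_monotone (ENNReal.ofReal_le_ofReal hn))).trans ?_
      rw [ENNReal.log_ofReal_of_pos (Real.exp_pos _), Real.log_exp]
      have : ((n : ℕ) : EReal) = ((n : ℝ) : EReal) := rfl
      rw [this, ← EReal.coe_div, EReal.coe_le_coe_iff]
      rw [neg_div, mul_div_cancel_right₀ _ hn0'.ne']
    · exact_mod_cast neg_lt_zero.2 hκ
  · refine lt_of_lt_of_le (b := ((κ : ℝ) : EReal)) (by exact_mod_cast hκ)
      (le_liminf_of_le (by isBoundedDefault) ?_)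
    filter_upwards [hsup] with t ht
    exact EReal.coe_le_coe_iff.2 ht
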